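/- **Theorem 3.2.5.1.** Let $k$ be a commutative ring, $H$ a Hopf $k$-algebra and $A$ a $k$-algebra. Let $E=A\#_f H$ be a crossed product: there are a weak action $(h,a)\mapsto a^h$ of $H$ on $A$ (a bilinear map with $(ab)^h=a^{h^{(1)}}b^{h^{(2)}}$, $1^h=\epsilon(h)1$, $a^1=a$) and a $k$-linear map $f\colon H\otimes H\to A$ such that the product $(a\# h)(b\# l)=a\,b^{h^{(1)}}f(h^{(2)},l^{(1)})\# h^{(3)}l^{(2)}$ on $A\otimes H$ is associative with identity $1\# 1$. Assume that $f$ is convolution invertible. Let $S$ be a separable subalgebra of $A$ that is stable under the weak action ($s^h\in S$ for all $s\in S$, $h\in H$), and assume that $f(h,l)\in S$ for all $h,l\in H$. Let $M$ be an $E$-bimodule (with $k$ acting in the same way on both sides). Put $\widetilde A=A/S$, $\widetilde A^0=S$ and $\widetilde A^r=\widetilde A\otimes_S\cdots\otimes_S\widetilde A$ ($r$ times) for $r\ge1$, and let $S^e=S\otimes S^{\mathrm{op}}$. Let $(\operatorname{Hom}_{S^e}(\widetilde A^*,M),b^*)$ be the normalized $S$-relative Hochschild cochain complex: identifying $\operatorname{Hom}_{S^e}(S,M)$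 with $\{m\in M: sm=ms \text{ for } s\in S\}$ and $\varphi\in\operatorname{Hom}_{S^e}(\widetilde A^r,M)$ with a multilinear map on $A^r$, $$b\varphi(a_0,\dots,a_r)=a_0\varphi(a_1,\dots,a_r)+\sum_{j=0}^{r-1}(-1)^{j+1}\varphi(a_0,\dots,a_ja_{j+1},\dots,a_r)+(-1)^{r+1}\varphi(a_0,\dots,a_{r-1})a_r .$$ Then the map $h\mapsto 1\# h$ is convolution invertible, with inverse denoted $h\mapsto(1\# h)^{-1}$; the formula $$(\varphi\cdot h)(a_1,\dots,a_r)=(1\# h^{(1)})^{-1}\,\varphi\bigl(a_1^{h^{(2)}},\dots,a_r^{h^{(r+1)}}\bigr)\,(1\# h^{(r+2)})$$ makes $(\operatorname{Hom}_{S^e}(\widetilde A^*,M),b^*)$ a cochain complex of right $H$-modules; and for every $n\ge0$ the Hochschild cohomology $\operatorname{H}^n(E,M)$ is isomorphic, as a $k$-module, to the $n$-th cohomology of $H$ with coefficients in this cochain complex of right $H$-modules, that is, to the $n$-th cohomology of the total complex of the double complex $\operatorname{Hom}_k\bigl(H^{\otimes s},\operatorname{Hom}_{S^e}(\widetilde A^r,M)\bigr)$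 ($r,s\ge 0$), whose differentials are the one induced by $b$ and $(-1)^r\delta$, where $$\delta\psi(h_0,\dots,h_s)=\epsilon(h_0)\psi(h_1,\dots,h_s)+\sum_{j=0}^{s-1}(-1)^{j+1}\psi(h_0,\dots,h_jh_{j+1},\dots,h_s)+(-1)^{s+1}\psi(h_0,\dots,h_{s-1})\cdot h_s .$$ Here Hochschild cohomology over $k$ is the cohomology of the Hochschild cochain complex $\operatorname{Hom}_k(E^{\otimes *},M)$. -/

import Mathlib

open scoped TensorProduct

namespace HopfCrossed

noncomputable section

section Sweedler

variable {k H V : Type*} [CommRing k] [AddCommGroup H] [Module k H] [Coalgebra k H]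
  [AddCommGroup V] [Module k V]

/-- For a bilinear map `β` on a coalgebra, `sweedler β h = β (h⁽¹⁾, h⁽²⁾)` (summation understood). -/
def sweedler : (H →ₗ[k] H →ₗ[k] V) →ₗ[k] (H →ₗ[k] V) :=
  LinearMap.lcomp k V (Coalgebra.comul (R := k) (A := H)) ∘ₗ
    (TensorProduct.lift.equiv (.id k) H H V).toLinearMap

theorem sweedler_apply (β : H →ₗ[k] H →ₗ[k] V) (h : H) :
    sweedler β h = TensorProduct.lift β (Coalgebra.comul (R := k) h) := rfl

theorem sweedler_repr (β : H →ₗ[k] H →ₗ[k] V) {ι : Type*} {h : H} (R : Coalgebra.Repr k h ι) :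
    sweedler β h = ∑ i ∈ R.index, β (R.left i) (R.right i) := by
  rw [sweedler_apply, ← R.eq]; simp

end Sweedler

section Crossed

variable {k A H : Type*} [CommRing k] [Ring A] [Algebra k A] [Ring H] [HopfAlgebra k H]

/-- The map `H ⊗ H → A ⊗ H`, `h ⊗ l ↦ f(h⁽¹⁾, l⁽¹⁾) ⊗ h⁽²⁾ l⁽²⁾`. -/
def cocycleMul (f : H ⊗[k] H →ₗ[k] A) : H ⊗[k] H →ₗ[k] A ⊗[k] H :=
  TensorProduct.map f (LinearMap.mul' k H) ∘ₗ Coalgebra.comul (R := k) (A := H ⊗[k] H)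

/-- `(h, b ⊗ l) ↦ b^{h⁽¹⁾} f(h⁽²⁾, l⁽¹⁾) ⊗ h⁽³⁾ l⁽²⁾`, as a linear map in `h`. -/
def crossedMulAux (act : H →ₗ[k] A →ₗ[k] A) (f : H ⊗[k] H →ₗ[k] A) :
    A ⊗[k] H →ₗ[k] H →ₗ[k] A ⊗[k] H :=
  TensorProduct.lift <| LinearMap.mk₂ k
    (fun b l => sweedler <|
      (Algebra.lsmul k k (A ⊗[k] H)).toLinearMap.compl₁₂ (act.flip b)
        ((TensorProduct.curry (cocycleMul f)).flip l))
    (fun b b' l => by rw [← map_add]; congr 1; ext; simp [add_smul])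
    (fun c b l => by rw [← map_smul]; congr 1; ext; simp)
    (fun b l l' => by rw [← map_add]; congr 1; ext; simp)
    (fun c b l => by rw [← map_smul]; congr 1; ext; simp)

/-- The multiplication
`(a ⊗ h)(b ⊗ l) = a b^{h⁽¹⁾} f(h⁽²⁾, l⁽¹⁾) ⊗ h⁽³⁾ l⁽²⁾` on `A ⊗ H`. -/
def crossedMul (act : H →ₗ[k] A →ₗ[k] A) (f : H ⊗[k] H →ₗ[k] A) :
    A ⊗[k] H →ₗ[k] A ⊗[k] H →ₗ[k] A ⊗[k] H :=
  TensorProduct.lift <| LinearMap.mk₂ k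
    (fun a h => (Algebra.lsmul k k (A ⊗[k] H) a) ∘ₗ (crossedMulAux act f).flip h)
    (fun a a' h => by ext; simp [add_smul])
    (fun c a h => by ext; simp)
    (fun a h h' => by ext; simp)
    (fun c a h => by ext; simp [smul_comm a c])

theorem crossedMul_tmul (act : H →ₗ[k] A →ₗ[k] A) (f : H ⊗[k] H →ₗ[k] A) (a b : A) (h l : H)
    {ι : Type*} (R : Coalgebra.Repr k h ι) :
    crossedMul act f (a ⊗ₜ h) (b ⊗ₜ l) =
      ∑ i ∈ R.index, (a * act (R.left i) b) • cocycleMul f (R.right i ⊗ₜ l) := by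
  simp [crossedMul, crossedMulAux, sweedler_repr _ R, Finset.smul_sum, mul_smul]

end Crossed

open WithConv

/-- A crossed product `A #_f H`: a weak action of the Hopf algebra `H` on the algebra `A` and a
linear map `f : H ⊗ H → A` such that the multiplication
`(a ⊗ h)(b ⊗ l) = a b^{h⁽¹⁾} f(h⁽²⁾, l⁽¹⁾) ⊗ h⁽³⁾ l⁽²⁾` on `A ⊗ H` is associative with
identity `1 ⊗ 1`. Here `act h a` is `a^h`. -/
structure CrossedProduct (k A H : Type*) [CommRing k] [Ring A] [Algebra k A] [Ring H]
    [HopfAlgebra k H] where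
  /-- the weak action `act h a = a^h` -/
  act : H →ₗ[k] A →ₗ[k] A
  /-- `(a b)^h = a^{h⁽¹⁾} b^{h⁽²⁾}`, written with the convolution product of `Hom(H, A)` -/
  act_mul : ∀ a b : A, toConv (act.flip (a * b)) = toConv (act.flip a) * toConv (act.flip b)
  /-- `1^h = ε(h) 1` -/
  act_one : ∀ h : H, act h 1 = algebraMap k A (Coalgebra.counit h)
  /-- `a^1 = a` -/
  one_act : ∀ a : A, act 1 a = a
  /-- the cocycle -/
  f : H ⊗[k] H →ₗ[k] A
  crossed_assoc : ∀ x y z : A ⊗[k] H,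
    crossedMul act f (crossedMul act f x y) z = crossedMul act f x (crossedMul act f y z)
  one_crossed : ∀ x : A ⊗[k] H, crossedMul act f (1 ⊗ₜ 1) x = x
  crossed_one : ∀ x : A ⊗[k] H, crossedMul act f x (1 ⊗ₜ 1) = x

namespace CrossedProduct

variable {k A H : Type*} [CommRing k] [Ring A] [Algebra k A] [Ring H] [HopfAlgebra k H]
  (X : CrossedProduct k A H)

/-- The algebra `E = A #_f H`, with underlying module `A ⊗ H`. -/
def E (_X : CrossedProduct k A H) : Type _ := A ⊗[k] H

instance : AddCommGroup X.E := inferInstanceAs (AddCommGroup (A ⊗[k] H))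

instance : Module k X.E := inferInstanceAs (Module k (A ⊗[k] H))

instance : Ring X.E where
  __ := (inferInstance : AddCommGroup X.E)
  mul x y := crossedMul X.act X.f x y
  one := (1 ⊗ₜ[k] 1 : A ⊗[k] H)
  mul_assoc := X.crossed_assoc
  one_mul := X.one_crossed
  mul_one := X.crossed_one
  left_distrib x y z := map_add (crossedMul X.act X.f x) y z
  right_distrib x y z := LinearMap.map_add₂ (crossedMul X.act X.f) x y z
  zero_mul x := LinearMap.map_zero₂ (crossedMul X.act X.f) x
  mul_zero x := map_zero (crossedMul X.act X.f x)

instance : Algebra k X.E :=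
  Algebra.ofModule (fun c x y => LinearMap.map_smul₂ (crossedMul X.act X.f) c x y)
    (fun c x y => map_smul (crossedMul X.act X.f x) c y)

/-- The inclusion `A → E`, `a ↦ a # 1`. -/
def inclA : A →ₗ[k] X.E := (TensorProduct.mk k A H).flip 1

/-- The map `H → E`, `h ↦ 1 # h`. -/
def gamma : H →ₗ[k] X.E := TensorProduct.mk k A H 1

/-- The convolution inverse of `h ↦ 1 # h`, so that `gammaInv h` is `(1 # h)⁻¹`. -/
def gammaInv : H →ₗ[k] X.E := (Ring.inverse (toConv X.gamma)).ofConv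


end CrossedProduct

section Hochschild

variable {k B N : Type*} [CommRing k] [Ring B] [Algebra k B] [AddCommGroup N] [Module k N]

theorem contractNth_update {n : ℕ} (j : Fin n) (b : Fin (n + 1) → B) (p : Fin (n + 1))
    [DecidableEq (Fin (n + 1))] :
    ∃ (q : Fin n) (u : B →ₗ[k] B), ∀ x : B,
      Fin.contractNth j.castSucc (· * ·) (Function.update b p x) =
        Function.update (Fin.contractNth j.castSucc (· * ·) b) q (u x) := by
  have hp := p.2
  have hj := j.2
  rcases lt_trichotomy (p : ℕ) (j : ℕ) with h | h | h
  · refine ⟨⟨p, by omega⟩, .id, fun x => ?_⟩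
    ext i
    simp only [Fin.contractNth, Function.update_apply, Fin.ext_iff, Fin.val_castSucc, Fin.val_succ,
      LinearMap.id_apply]
    grind
  · refine ⟨⟨p, by omega⟩, LinearMap.mulRight k (b j.succ), fun x => ?_⟩
    ext i
    have : p = j.castSucc := Fin.ext h
    subst this
    by_cases hi : i = j
    · subst hi; simp [Fin.contractNth, Fin.ext_iff]
    · have : (i : ℕ) ≠ j := fun h => hi (Fin.ext h)
      simp [Fin.contractNth, Function.update_apply, Fin.ext_iff]
      grind
  · by_cases h' : (p : ℕ) = j + 1
    · refine ⟨j, LinearMap.mulLeft k (b j.castSucc), fun x => ?_⟩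
      ext i
      have : p = j.succ := Fin.ext h'
      subst this
      by_cases hi : i = j
      · subst hi; simp [Fin.contractNth, Fin.ext_iff]
      · have : (i : ℕ) ≠ j := fun h => hi (Fin.ext h)
        simp [Fin.contractNth, Function.update_apply, Fin.ext_iff]
        grind
    · refine ⟨⟨p - 1, by omega⟩, .id, fun x => ?_⟩
      ext i
      simp only [Fin.contractNth, Function.update_apply, Fin.ext_iff, Fin.val_castSucc,
        Fin.val_succ, LinearMap.id_apply]
      grind

/-- The multilinear map
`(b₀, …, bₙ) ↦ φ(b₀, …, bⱼ bⱼ₊₁, …, bₙ)`. -/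
def contractMap {n : ℕ} (j : Fin n) (φ : MultilinearMap k (fun _ : Fin n => B) N) :
    MultilinearMap k (fun _ : Fin (n + 1) => B) N where
  toFun b := φ (Fin.contractNth j.castSucc (· * ·) b)
  map_update_add' b p x y := by
    obtain ⟨q, u, h⟩ := contractNth_update (k := k) j b p
    simp [h]
  map_update_smul' b p c x := by
    obtain ⟨q, u, h⟩ := contractNth_update (k := k) j b p
    simp [h]

/-- The Hochschild coboundary. The left and right actions of `B` on the coefficients `N` are given
by the linear maps `L` and `R` (so `L b n = b n` and `R b n = n b`), and
`(d φ)(b₀, …, bₙ) = b₀ φ(b₁, …, bₙ) + ∑ⱼ (-1)^(j+1) φ(b₀, …, bⱼ bⱼ₊₁, …, bₙ)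
  + (-1)^(n+1) φ(b₀, …, bₙ₋₁) bₙ`, see `hochschildD_apply`. -/
def hochschildD (L R : B →ₗ[k] Module.End k N) (n : ℕ) :
    MultilinearMap k (fun _ : Fin n => B) N →ₗ[k] MultilinearMap k (fun _ : Fin (n + 1) => B) N where
  toFun φ :=
    LinearMap.uncurryLeft (M := fun _ : Fin (n + 1) => B)
      ⟨⟨fun b => (L b).compMultilinearMap φ, fun b b' => by ext; simp⟩, fun c b => by ext; simp⟩
    + ∑ j : Fin n, (-1 : k) ^ ((j : ℕ) + 1) • contractMap j φ
    + (-1 : k) ^ (n + 1) • MultilinearMap.uncurryRight (M := fun _ : Fin (n + 1) => B)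
      (R.flip.compMultilinearMap φ)
  map_add' φ ψ := by
    ext b
    simp [contractMap, Finset.sum_add_distrib]
    abel
  map_smul' c φ := by
    ext b
    simp [contractMap, Finset.smul_sum, smul_smul, mul_comm]

theorem hochschildD_apply (L R : B →ₗ[k] Module.End k N) (n : ℕ)
    (φ : MultilinearMap k (fun _ : Fin n => B) N) (b : Fin (n + 1) → B) :
    hochschildD L R n φ b =
      L (b 0) (φ fun i => b i.succ)
      + ∑ j : Fin n, (-1 : k) ^ ((j : ℕ) + 1) • φ (Fin.contractNth j.castSucc (· * ·) b)
      + (-1 : k) ^ (n + 1) • R (b (Fin.last n)) (φ fun i => b i.castSucc) := by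
  simp [hochschildD, contractMap]
  rfl

end Hochschild

section Cohomology

variable {k : Type*} [CommRing k] {C : ℕ → Type*} [∀ n, AddCommGroup (C n)] [∀ n, Module k (C n)]

/-- The coboundaries of a cochain complex `C⁰ → C¹ → C² → ⋯`. -/
def coboundaries (d : ∀ n, C n →ₗ[k] C (n + 1)) : ∀ n, Submodule k (C n)
  | 0 => ⊥
  | n + 1 => LinearMap.range (d n)

/-- The `n`-th cohomology module (cocycles modulo coboundaries) of a cochain complex
`C⁰ → C¹ → C² → ⋯`. -/
abbrev Cohomology (d : ∀ n, C n →ₗ[k] C (n + 1)) (n : ℕ) : Type _ :=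
  LinearMap.ker (d n) ⧸ (coboundaries d n).submoduleOf (LinearMap.ker (d n))

end Cohomology

section Relative

variable {k A N : Type*} [CommRing k] [Ring A] [Algebra k A] [AddCommGroup N] [Module k N]

/-- `φ : A^r → N` is an `S`-relative normalized cochain. Here `L` and `R` are the left and right
actions of `A` on `N`. For `r ≥ 1` the conditions say that `φ` vanishes when one of its arguments is
in `S`, is balanced over `S` between consecutive arguments, and is left (right) `S`-linear in the
first (last) argument. By the universal property of `⊗_S`, such `φ` are the `S`-bimodule maps
`Ã ⊗_S ⋯ ⊗_S Ã → N` (`r` factors), where `Ã = A/S`. For `r = 0`, `φ` is an element `n` of `N` and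
the condition is `s n = n s` for `s ∈ S`; such elements are the `S`-bimodule maps `S → N`
(take the image of `1`). -/
structure IsRelCochain (S : Subalgebra k A) (L R : A →ₗ[k] Module.End k N) {r : ℕ}
    (φ : MultilinearMap k (fun _ : Fin r => A) N) : Prop where
  map_left : ∀ i : Fin r, (i : ℕ) = 0 → ∀ s ∈ S, ∀ a : Fin r → A,
    φ (Function.update a i (s * a i)) = L s (φ a)
  map_right : ∀ i : Fin r, (i : ℕ) + 1 = r → ∀ s ∈ S, ∀ a : Fin r → A,
    φ (Function.update a i (a i * s)) = R s (φ a)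
  balanced : ∀ i j : Fin r, (j : ℕ) = i + 1 → ∀ s ∈ S, ∀ a : Fin r → A,
    φ (Function.update a i (a i * s)) = φ (Function.update a j (s * a j))
  normalized : ∀ i : Fin r, ∀ a : Fin r → A, a i ∈ S → φ a = 0
  central : r = 0 → ∀ s ∈ S, ∀ a : Fin r → A, L s (φ a) = R s (φ a)

namespace IsRelCochain

variable {S : Subalgebra k A} {L R : A →ₗ[k] Module.End k N} {r : ℕ}
    {φ : MultilinearMap k (fun _ : Fin r => A) N}

theorem map_left' (h : IsRelCochain S L R φ) (i : Fin r) (hi : (i : ℕ) = 0) (s : A) (hs : s ∈ S)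
    (v w : Fin r → A) (h1 : v i = s * w i) (h2 : ∀ t : Fin r, (t : ℕ) ≠ i → v t = w t) :
    φ v = L s (φ w) := by
  rw [← h.map_left i hi s hs]
  congr 1; ext t
  by_cases ht : t = i
  · subst ht; simp [h1]
  · simp [ht, h2 t (fun h => ht (Fin.ext h))]

theorem map_right' (h : IsRelCochain S L R φ) (i : Fin r) (hi : (i : ℕ) + 1 = r) (s : A)
    (hs : s ∈ S) (v w : Fin r → A) (h1 : v i = w i * s) (h2 : ∀ t : Fin r, (t : ℕ) ≠ i → v t = w t) :
    φ v = R s (φ w) := by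
  rw [← h.map_right i hi s hs]
  congr 1; ext t
  by_cases ht : t = i
  · subst ht; simp [h1]
  · simp [ht, h2 t (fun h => ht (Fin.ext h))]

theorem balanced' (h : IsRelCochain S L R φ) (i j : Fin r) (hij : (j : ℕ) = i + 1) (s : A)
    (hs : s ∈ S) (v w : Fin r → A) (h1 : v i = w i * s) (h1' : w j = s * v j)
    (h2 : ∀ t : Fin r, (t : ℕ) ≠ i → (t : ℕ) ≠ j → v t = w t) :
    φ v = φ w := by
  have hne : i ≠ j := fun h => by subst h; omega
  have key := h.balanced i j hij s hs (Function.update v i (w i))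
  convert key using 2
  · ext t
    by_cases ht : t = i
    · subst ht; simp [h1]
    · simp [ht]
  · ext t
    by_cases ht : t = j
    · subst ht; simp [h1', hne.symm]
    · by_cases ht' : t = i
      · subst ht'; simp [ht]
      · simp [ht, ht', h2 t (fun h => ht' (Fin.ext h)) (fun h => ht (Fin.ext h))]

end IsRelCochain

end Relative
section Stable

variable {k A N : Type*} [CommRing k] [Ring A] [Algebra k A] [AddCommGroup N] [Module k N]
variable {S : Subalgebra k A} {L R : A →ₗ[k] Module.End k N} {r : ℕ}
    {φ : MultilinearMap k (fun _ : Fin r => A) N}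

theorem IsRelCochain.hochschildD (hL : ∀ a b n, L (a * b) n = L a (L b n))
    (hR : ∀ a b n, R (a * b) n = R b (R a n)) (hLR : ∀ a b n, L a (R b n) = R b (L a n))
    (h : IsRelCochain S L R φ) : IsRelCochain S L R (hochschildD L R r φ) where
  map_left i hi s hs a := by
    have hi0 : i = 0 := Fin.ext hi
    subst hi0
    simp only [hochschildD_apply, map_add, map_sum, map_smul]
    congr 1
    · congr 1
      · simp [hL]
      · refine Finset.sum_congr rfl fun j _ => ?_
        have hj := j.2
        congr 1
        refine h.map_left' ⟨0, by omega⟩ rfl s hs _ _ ?_ ?_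
        · simp only [Fin.contractNth, Function.update_apply, Fin.ext_iff, Fin.val_castSucc,
            Fin.val_succ, Fin.val_zero]
          grind [Fin.castSucc_mk, Fin.mk_zero]
        · intro t ht
          simp only [Fin.contractNth, Function.update_apply, Fin.ext_iff, Fin.val_castSucc,
            Fin.val_succ, Fin.val_zero]
          grind
    · congr 1
      by_cases hr : r = 0
      · subst hr
        simp [hR]
        rw [hLR, h.central rfl s hs]
        congr 3
        exact Subsingleton.elim _ _
      · rw [hLR]
        congr 1
        · simp [Function.update_apply, Fin.ext_iff, hr]
        · refine h.map_left' ⟨0, by omega⟩ rfl s hs _ _ ?_ ?_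
          · simp [Function.update_apply, Fin.ext_iff]
          · intro t ht
            simp at ht
            simp [Function.update_apply, Fin.ext_iff, ht]
  map_right i hi s hs a := by
    have hi0 : i = Fin.last r := Fin.ext (by simpa using hi)
    subst hi0
    simp only [hochschildD_apply, map_add, map_sum, map_smul]
    congr 1
    · congr 1
      · by_cases hr : r = 0
        · subst hr
          simp [hL]
          rw [← hLR, ← h.central rfl s hs]
        · rw [← hLR]
          have h0 : (0 : ℕ) ≠ r := fun h => hr h.symm
          congr 2
          · simp [Function.update_apply, Fin.ext_iff, h0]
          · refine h.map_right' ⟨r - 1, by omega⟩ (by simp; omega) s hs _ _ ?_ ?_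
            · simp only [Function.update_apply, Fin.ext_iff, Fin.val_succ, Fin.val_last]
              grind
            · intro t ht
              simp only [Function.update_apply, Fin.ext_iff, Fin.val_succ, Fin.val_last]
              grind
      · refine Finset.sum_congr rfl fun j _ => ?_
        have hj := j.2
        congr 1
        refine h.map_right' ⟨r - 1, by omega⟩ (by simp; omega) s hs _ _ ?_ ?_
        · simp only [Fin.contractNth, Function.update_apply, Fin.ext_iff, Fin.val_castSucc,
            Fin.val_succ, Fin.val_last]
          grind
        · intro t ht
          simp only [Fin.contractNth, Function.update_apply, Fin.ext_iff, Fin.val_castSucc,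
            Fin.val_succ, Fin.val_last]
          grind
    · congr 1
      simp [hR, Function.update_apply, Fin.ext_iff, (Nat.ne_of_lt (Fin.is_lt _))]
  balanced i j hij s hs a := by
    have hj := j.2
    simp only [hochschildD_apply]
    congr 1
    · congr 1
      · by_cases hi : (i : ℕ) = 0
        · have hi0 : i = 0 := Fin.ext hi
          subst hi0
          have hj0 : (0 : ℕ) ≠ j := by omega
          have e : (φ fun t => Function.update a j (s * a j) t.succ) =
              L s (φ fun t => Function.update a 0 (a 0 * s) t.succ) := by
            refine h.map_left' ⟨0, by omega⟩ rfl s hs _ _ ?_ ?_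
            · simp only [Function.update_apply, Fin.ext_iff, Fin.val_succ, Fin.val_zero]
              grind
            · intro t ht
              simp only [Function.update_apply, Fin.ext_iff, Fin.val_succ, Fin.val_zero]
              grind
          rw [e, ← hL]
          simp [Fin.ext_iff, hj0]
        · have h0 : (0 : ℕ) ≠ i := fun h => hi h.symm
          have h0' : (0 : ℕ) ≠ j := by omega
          congr 1
          · simp [Fin.ext_iff, h0, h0']
          · refine h.balanced' ⟨i - 1, by omega⟩ ⟨i, by omega⟩ (by simp; omega) s hs _ _ ?_ ?_ ?_
            · simp only [Function.update_apply, Fin.ext_iff, Fin.val_succ]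
              grind
            · simp only [Function.update_apply, Fin.ext_iff, Fin.val_succ]
              grind
            · intro t ht ht'
              simp only [Function.update_apply, Fin.ext_iff, Fin.val_succ]
              grind
      · refine Finset.sum_congr rfl fun t _ => ?_
        have ht := t.2
        congr 1
        rcases lt_trichotomy (t : ℕ) (i : ℕ) with hti | hti | hti
        · refine h.balanced' ⟨i - 1, by omega⟩ ⟨i, by omega⟩ (by simp; omega) s hs _ _ ?_ ?_ ?_
          · simp only [Fin.contractNth, Function.update_apply, Fin.ext_iff, Fin.val_castSucc,
              Fin.val_succ]
            grind
          · simp only [Fin.contractNth, Function.update_apply, Fin.ext_iff, Fin.val_castSucc,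
              Fin.val_succ]
            grind
          · intro u hu hu'
            simp only [Fin.contractNth, Function.update_apply, Fin.ext_iff, Fin.val_castSucc,
              Fin.val_succ]
            grind
        · congr 1
          ext u
          have hi0 : i = t.castSucc := Fin.ext hti.symm
          have hj0 : j = t.succ := Fin.ext (by simp; omega)
          subst hi0 hj0
          by_cases hu : u = t
          · subst hu; simp [Fin.contractNth, Fin.ext_iff, mul_assoc]
          · have hu' : (u : ℕ) ≠ t := fun e => hu (Fin.ext e)
            simp only [Fin.contractNth, Function.update_apply, Fin.ext_iff, Fin.val_castSucc,
              Fin.val_succ]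
            grind
        · have p1 : (i : ℕ) < r := by omega
          have p2 : (i : ℕ) + 1 < r := by omega
          have e1 : Fin.castSucc (⟨i, p1⟩ : Fin r) = i := rfl
          have e2 : Fin.succ (⟨i, p1⟩ : Fin r) = j := Fin.ext hij.symm
          have e3 : Fin.castSucc (⟨i + 1, p2⟩ : Fin r) = j := Fin.ext hij.symm
          refine h.balanced' ⟨i, p1⟩ ⟨i + 1, p2⟩ (by simp) s hs _ _ ?_ ?_ ?_
          · simp only [Fin.contractNth, Function.update_apply, Fin.ext_iff, Fin.val_castSucc,
              Fin.val_succ]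
            grind
          · simp only [Fin.contractNth, Function.update_apply, Fin.ext_iff, Fin.val_castSucc,
              Fin.val_succ]
            grind
          · intro u hu hu'
            simp only [Fin.contractNth, Function.update_apply, Fin.ext_iff, Fin.val_castSucc,
              Fin.val_succ]
            grind
    · congr 1
      by_cases hjr : (j : ℕ) = r
      · have hj0 : j = Fin.last r := Fin.ext hjr
        subst hj0
        have hi0 : r ≠ (i : ℕ) := by omega
        have e : (φ fun t => Function.update a i (a i * s) t.castSucc) =
            R s (φ fun t => Function.update a (Fin.last r) (s * a (Fin.last r)) t.castSucc) := by
          have p1 : (i : ℕ) < r := by omega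
          have e1 : Fin.castSucc (⟨i, p1⟩ : Fin r) = i := rfl
          refine h.map_right' ⟨i, p1⟩ (by simp; omega) s hs _ _ ?_ ?_
          · simp only [Function.update_apply, Fin.ext_iff, Fin.val_castSucc, Fin.val_last]
            grind
          · intro t ht
            simp only [Function.update_apply, Fin.ext_iff, Fin.val_castSucc, Fin.val_last]
            grind
        rw [e, ← hR]
        simp [Fin.ext_iff, hi0]
      · have h0 : r ≠ (i : ℕ) := by omega
        have h0' : r ≠ (j : ℕ) := by omega
        congr 1
        · simp [Fin.ext_iff, h0, h0']
        · have p1 : (i : ℕ) < r := by omega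
          have p2 : (j : ℕ) < r := by omega
          have e1 : Fin.castSucc (⟨i, p1⟩ : Fin r) = i := rfl
          have e2 : Fin.castSucc (⟨j, p2⟩ : Fin r) = j := rfl
          refine h.balanced' ⟨i, p1⟩ ⟨j, p2⟩ (by simp; omega) s hs _ _ ?_ ?_ ?_
          · simp only [Function.update_apply, Fin.ext_iff, Fin.val_castSucc]
            grind
          · simp only [Function.update_apply, Fin.ext_iff, Fin.val_castSucc]
            grind
          · intro t ht ht'
            simp only [Function.update_apply, Fin.ext_iff, Fin.val_castSucc]
            grind
  normalized i a hi := by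
    have hi' := i.2
    -- the `m`-th face of `φ` at `a`
    let F : ℕ → N := fun m =>
      if m = 0 then L (a 0) (φ fun t => a t.succ)
      else if hm : m - 1 < r then
        φ (Fin.contractNth (Fin.castSucc ⟨m - 1, hm⟩) (· * ·) a)
      else R (a (Fin.last r)) (φ fun t => a t.castSucc)
    have hsum : HopfCrossed.hochschildD L R r φ a =
        ∑ m ∈ Finset.range (r + 2), (-1 : k) ^ m • F m := by
      rw [hochschildD_apply, Finset.sum_range_succ, Finset.sum_range_succ', ← Fin.sum_univ_eq_sum_range
        (fun m => (-1 : k) ^ (m + 1) • F (m + 1))]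
      rw [add_comm (∑ _ : Fin r, _) ((-1 : k) ^ 0 • F 0)]
      simp [F]
      rfl
    have hzero : ∀ m, m < r + 2 → m ≠ i → m ≠ i + 1 → F m = 0 := by
      intro m hm h1 h2
      by_cases h0 : m = 0
      · simp only [F, h0, if_true]
        rw [h.normalized ⟨i - 1, by omega⟩ _ _, map_zero]
        have e1 : Fin.succ (⟨i - 1, by omega⟩ : Fin r) = i := Fin.ext (by simp; omega)
        rwa [e1]
      · by_cases hmr : m - 1 < r
        · simp only [F, h0, if_false, hmr, dif_pos]
          by_cases him : (i : ℕ) < m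
          · have p1 : (i : ℕ) < r := by omega
            have e1 : Fin.castSucc (⟨i, p1⟩ : Fin r) = i := rfl
            refine h.normalized ⟨i, p1⟩ _ ?_
            convert hi
            simp only [Fin.contractNth]
            grind
          · have p1 : (i : ℕ) - 1 < r := by omega
            have e1 : Fin.succ (⟨i - 1, p1⟩ : Fin r) = i := Fin.ext (by simp; omega)
            refine h.normalized ⟨i - 1, p1⟩ _ ?_
            convert hi
            simp only [Fin.contractNth]
            grind
        · simp only [F, h0, if_false, hmr, dif_neg, not_false_eq_true]
          rw [h.normalized ⟨i, by omega⟩ _ _, map_zero]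
          exact hi
    have heq : F i = F (i + 1) := by
      by_cases h0 : (i : ℕ) = 0
      · have hi0 : i = 0 := Fin.ext h0
        subst hi0
        by_cases hr : r = 0
        · subst hr
          simp only [F]
          simp only [Fin.val_zero, if_true, Nat.lt_irrefl, dif_neg, not_false_eq_true, zero_add,
            one_ne_zero, if_false, Nat.sub_self]
          rw [h.central rfl _ hi]
          congr 2
          exact Subsingleton.elim _ _
        · have hr' : 0 < r := Nat.pos_of_ne_zero hr
          simp only [F]
          simp only [Fin.val_zero, if_true, zero_add, one_ne_zero, if_false, Nat.sub_self, hr',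
            dif_pos]
          refine (h.map_left' ⟨0, hr'⟩ rfl _ hi _ _ ?_ ?_).symm
          · simp [Fin.contractNth, Fin.ext_iff]
          · intro t ht
            simp only [Fin.contractNth]
            grind
      · have h1 : (i : ℕ) - 1 < r := by omega
        by_cases hir : (i : ℕ) < r
        · simp only [F, h0, if_false, h1, dif_pos, Nat.add_sub_cancel, hir, Nat.succ_ne_zero]
          refine h.balanced' ⟨i - 1, h1⟩ ⟨i, hir⟩ (by simp; omega) _ hi _ _ ?_ ?_ ?_
          · simp only [Fin.contractNth]
            grind
          · simp only [Fin.contractNth]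
            grind
          · intro t ht ht'
            simp only [Fin.contractNth]
            grind
        · have hil : i = Fin.last r := Fin.ext (by simp; omega)
          simp only [F, h0, if_false, h1, dif_pos, Nat.add_sub_cancel, hir, dif_neg,
            not_false_eq_true, Nat.succ_ne_zero]
          rw [← hil]
          refine h.map_right' ⟨i - 1, h1⟩ (by simp; omega) _ hi _ _ ?_ ?_
          · simp only [Fin.contractNth]
            grind
          · intro t ht
            simp only [Fin.contractNth]
            grind
    rw [hsum, Finset.sum_eq_add (i : ℕ) (i + 1) (by omega)
      (fun m hm hne => by
        rw [hzero m (Finset.mem_range.mp hm) hne.1 hne.2, smul_zero])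
      (fun h => absurd (Finset.mem_range.mpr (by omega)) h)
      (fun h => absurd (Finset.mem_range.mpr (by omega)) h), heq, ← add_smul]
    simp [pow_succ]
  central h0 := by omega

end Stable
section Sweedler2

variable {k H V W : Type*} [CommRing k] [AddCommGroup H] [Module k H] [Coalgebra k H]
  [AddCommGroup V] [Module k V] [AddCommGroup W] [Module k W]

theorem comp_sweedler (g : V →ₗ[k] W) (β : H →ₗ[k] H →ₗ[k] V) :
    g ∘ₗ sweedler β = sweedler (β.compr₂ g) := by
  ext h
  simp [sweedler_repr _ (Coalgebra.Repr.arbitrary k h)]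

theorem sweedler_coassoc (T : H →ₗ[k] H →ₗ[k] H →ₗ[k] V) :
    sweedler (sweedler ∘ₗ T) = sweedler (sweedler T) := by
  have key : ∀ z : H ⊗[k] H ⊗[k] H,
      TensorProduct.lift (TensorProduct.lift T) z =
      TensorProduct.lift ((TensorProduct.lift.equiv (.id k) H H V).toLinearMap ∘ₗ T)
        (TensorProduct.assoc k H H H z) := by
    intro z
    rw [← LinearEquiv.coe_toLinearMap, ← LinearMap.comp_apply]
    congr 1
    ext
    simp
  have h1 : ∀ z : H ⊗[k] H, TensorProduct.lift (sweedler T) z =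
      TensorProduct.lift (TensorProduct.lift T) ((Coalgebra.comul (R := k)).rTensor H z) := by
    intro z
    rw [← LinearMap.comp_apply]
    congr 1
    ext
    simp [sweedler_apply]
  have h2 : ∀ z : H ⊗[k] H, TensorProduct.lift (sweedler ∘ₗ T) z =
      TensorProduct.lift ((TensorProduct.lift.equiv (.id k) H H V).toLinearMap ∘ₗ T)
        ((Coalgebra.comul (R := k)).lTensor H z) := by
    intro z
    rw [← LinearMap.comp_apply]
    congr 1
    ext
    simp [sweedler_apply]
    rfl
  ext h
  rw [sweedler_apply, sweedler_apply, h1, h2, key, Coalgebra.coassoc_apply]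

end Sweedler2

section Twist

variable {k A H M : Type*} [CommRing k] [Ring A] [Algebra k A] [AddCommGroup H] [Module k H]
  [Coalgebra k H] [AddCommGroup M] [Module k M]

/-- Postcomposition of a multilinear map with an endomorphism of the target. -/
def postComp (r : ℕ) : Module.End k M →ₗ[k]
    MultilinearMap k (fun _ : Fin r => A) M →ₗ[k] MultilinearMap k (fun _ : Fin r => A) M :=
  LinearMap.mk₂ k (fun g φ => g.compMultilinearMap φ)
    (fun _ _ _ => by ext; simp) (fun _ _ _ => by ext; simp)
    (fun _ _ _ => by ext; simp) (fun _ _ _ => by ext; simp)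

@[simp] theorem postComp_apply (r : ℕ) (g : Module.End k M)
    (φ : MultilinearMap k (fun _ : Fin r => A) M) (a : Fin r → A) :
    postComp r g φ a = g (φ a) := rfl

/-- `(twist act G r φ h)(a₁, …, aᵣ) = G(h⁽ʳ⁺¹⁾) (φ(a₁^{h⁽¹⁾}, …, aᵣ^{h⁽ʳ⁾}))`, by recursion on `r`:
the first argument is acted upon by `h⁽¹⁾`, and `h⁽²⁾` is passed on to the others. -/
def twist (act : H →ₗ[k] A →ₗ[k] A) (G : H →ₗ[k] Module.End k M) : ∀ r : ℕ,
    MultilinearMap k (fun _ : Fin r => A) M →ₗ[k] H →ₗ[k] MultilinearMap k (fun _ : Fin r => A) M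
  | 0 => (postComp 0 ∘ₗ G).flip
  | r + 1 => LinearMap.mk₂ k
      (fun φ h => LinearMap.uncurryLeft (M := fun _ : Fin (r + 1) => A)
        ⟨⟨fun a => sweedler (twist act G r ∘ₗ φ.curryLeft ∘ₗ act.flip a) h,
          fun a b => by simp [LinearMap.comp_add]⟩,
          fun c a => by simp [LinearMap.comp_smul]⟩)
      (fun φ ψ h => by
        ext a
        have : (φ + ψ).curryLeft = φ.curryLeft + ψ.curryLeft := rfl
        simp [this, LinearMap.comp_add, LinearMap.add_comp])
      (fun c φ h => by
        ext a
        have : (c • φ).curryLeft = c • φ.curryLeft := rfl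
        simp [this, LinearMap.comp_smul, LinearMap.smul_comp])
      (fun φ h l => by ext a; simp)
      (fun c φ h => by ext a; simp)

/-- `(diagonalAct act P G r h φ)(a₁, …, aᵣ) = P(h⁽¹⁾) G(h⁽ʳ⁺²⁾) (φ(a₁^{h⁽²⁾}, …, aᵣ^{h⁽ʳ⁺¹⁾}))`, where
`P` and `G` are linear maps from `H` to the endomorphisms of the target. -/
def diagonalAct (act : H →ₗ[k] A →ₗ[k] A) (P G : H →ₗ[k] Module.End k M) (r : ℕ) :
    H →ₗ[k] MultilinearMap k (fun _ : Fin r => A) M →ₗ[k]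
      MultilinearMap k (fun _ : Fin r => A) M :=
  LinearMap.flip <| sweedler ∘ₗ
    ⟨⟨fun φ => (postComp r ∘ₗ P).compl₂ (twist act G r φ), fun φ ψ => by ext; simp⟩,
      fun c φ => by ext; simp⟩

variable {act : H →ₗ[k] A →ₗ[k] A} {P G : H →ₗ[k] Module.End k M}

/-- evaluation of a multilinear map -/
def evalAt {r : ℕ} (a : Fin r → A) : MultilinearMap k (fun _ : Fin r => A) M →ₗ[k] M where
  toFun φ := φ a
  map_add' _ _ := rfl
  map_smul' _ _ := rfl

theorem twist_zero (φ : MultilinearMap k (fun _ : Fin 0 => A) M) (h : H) (a : Fin 0 → A) :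
    twist act G 0 φ h a = G h (φ a) := rfl

theorem twist_succ {r : ℕ} (φ : MultilinearMap k (fun _ : Fin (r + 1) => A) M) (h : H)
    (a : Fin (r + 1) → A) :
    twist act G (r + 1) φ h a =
      sweedler (((twist act G r ∘ₗ φ.curryLeft).compr₂ (evalAt (Fin.tail a))) ∘ₗ act.flip (a 0)) h := by
  simp [twist, sweedler_repr _ (Coalgebra.Repr.arbitrary k h), evalAt]

theorem diagonalAct_apply {r : ℕ} (φ : MultilinearMap k (fun _ : Fin r => A) M) (h : H)
    (a : Fin r → A) :
    diagonalAct act P G r h φ a = sweedler (P.compl₂ (evalAt a ∘ₗ twist act G r φ)) h := by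
  simp [diagonalAct, sweedler_repr _ (Coalgebra.Repr.arbitrary k h), evalAt]


/-- `(x, b₁, …) ↦ ψ(s x, b₁, …)` -/
def mulFirst {r : ℕ} (ψ : MultilinearMap k (fun _ : Fin (r + 1) => A) M) :
    A →ₗ[k] MultilinearMap k (fun _ : Fin (r + 1) => A) M where
  toFun s := LinearMap.uncurryLeft (M := fun _ : Fin (r + 1) => A)
    (ψ.curryLeft ∘ₗ LinearMap.mulLeft k s)
  map_add' s t := by ext; simp [add_mul]
  map_smul' c s := by ext; simp

theorem act_mul_sweedler
    (hact : ∀ a b : A, toConv (act.flip (a * b)) = toConv (act.flip a) * toConv (act.flip b))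
    (a b : A) :
    act.flip (a * b) = sweedler ((LinearMap.mul k A).compl₁₂ (act.flip a) (act.flip b)) := by
  ext h
  have := congrArg (fun g => g h) (hact a b)
  simp only [LinearMap.convMul_apply] at this
  simp only [sweedler_repr _ (Coalgebra.Repr.arbitrary k h)]
  change act.flip (a * b) h = _ at this
  rw [this, ← (Coalgebra.Repr.arbitrary k h).eq]
  simp

theorem sweedler_act_mul {V : Type*} [AddCommGroup V] [Module k V]
    (hact : ∀ a b : A, toConv (act.flip (a * b)) = toConv (act.flip a) * toConv (act.flip b))
    (a b : A) (Λ : A →ₗ[k] H →ₗ[k] V) :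
    sweedler (Λ ∘ₗ act.flip (a * b)) =
      sweedler (sweedler ∘ₗ ((LinearMap.mul k A).compl₁₂ (act.flip a) (act.flip b)).compr₂ Λ) := by
  rw [act_mul_sweedler hact, comp_sweedler, sweedler_coassoc]

theorem twist_mul_first
    (hact : ∀ a b : A, toConv (act.flip (a * b)) = toConv (act.flip a) * toConv (act.flip b))
    {r : ℕ} (ψ : MultilinearMap k (fun _ : Fin (r + 1) => A) M) (h : H)
    (a b : Fin (r + 1) → A) (s : A) (hb0 : b 0 = s * a 0) (hb : Fin.tail b = Fin.tail a) :
    twist act G (r + 1) ψ h b =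
      sweedler (((twist act G (r + 1)).compr₂ (evalAt a) ∘ₗ mulFirst ψ) ∘ₗ act.flip s) h := by
  rw [twist_succ, hb0, hb, sweedler_act_mul hact]
  congr 2
  ext h1 h2
  simp only [LinearMap.comp_apply, LinearMap.compr₂_apply]
  change _ = twist act G (r + 1) (mulFirst ψ (act h1 s)) h2 a
  rw [twist_succ]
  congr 2

end Twist
section Preserve

variable {k A H M : Type*} [CommRing k] [Ring A] [Algebra k A] [AddCommGroup H] [Module k H]
  [Coalgebra k H] [AddCommGroup M] [Module k M]
variable {act : H →ₗ[k] A →ₗ[k] A} {P G : H →ₗ[k] Module.End k M}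
variable {S : Subalgebra k A} {L R : A →ₗ[k] Module.End k M}

theorem twist_normalized (hS : ∀ h, ∀ s ∈ S, act h s ∈ S) {r : ℕ}
    (φ : MultilinearMap k (fun _ : Fin r => A) M)
    (hφ : ∀ i : Fin r, ∀ a : Fin r → A, a i ∈ S → φ a = 0)
    (h : H) (i : Fin r) (a : Fin r → A) (ha : a i ∈ S) : twist act G r φ h a = 0 := by
  induction r generalizing h with
  | zero => exact i.elim0
  | succ r ih =>
    rw [twist_succ]
    suffices e : (((twist act G r ∘ₗ φ.curryLeft).compr₂ (evalAt (Fin.tail a))) ∘ₗ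
        act.flip (a 0)) = 0 by rw [e]; simp
    ext h1 h2
    change twist act G r (φ.curryLeft (act h1 (a 0))) h2 (Fin.tail a) = 0
    refine Fin.cases (fun ha => ?_) (fun i ha => ?_) i ha
    · have : φ.curryLeft (act h1 (a 0)) = 0 := by
        ext b
        exact hφ 0 _ (by simpa using hS h1 _ ha)
      rw [this]; simp
    · refine ih _ (fun j b hb => ?_) h2 i _ ha
      exact hφ j.succ _ (by simpa using hb)

theorem twist_balanced
    (hact : ∀ a b : A, toConv (act.flip (a * b)) = toConv (act.flip a) * toConv (act.flip b))
    {r : ℕ} (φ : MultilinearMap k (fun _ : Fin r => A) M) (s : A) (T : Set A)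
    (hT : s ∈ T) (hS : ∀ h, ∀ s ∈ T, act h s ∈ T)
    (hφ : ∀ i j : Fin r, (j : ℕ) = i + 1 → ∀ s ∈ T, ∀ a : Fin r → A,
      φ (Function.update a i (a i * s)) = φ (Function.update a j (s * a j)))
    (h : H) (i j : Fin r) (hij : (j : ℕ) = i + 1) (a : Fin r → A) :
    twist act G r φ h (Function.update a i (a i * s)) =
      twist act G r φ h (Function.update a j (s * a j)) := by
  induction r generalizing h with
  | zero => exact i.elim0
  | succ r ih =>
    obtain ⟨j, rfl⟩ : ∃ j' : Fin r, j = j'.succ :=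
      ⟨⟨j - 1, by have := j.2; omega⟩, Fin.ext (by simp; omega)⟩
    by_cases hi : (i : ℕ) = 0
    · obtain rfl : i = 0 := Fin.ext hi
      have hj0 : (j : ℕ) = 0 := by simpa using hij
      obtain ⟨r, rfl⟩ : ∃ r', r = r' + 1 := ⟨r - 1, by have := j.2; omega⟩
      obtain rfl : j = 0 := Fin.ext hj0
      rw [twist_succ, twist_succ]
      simp only [Function.update_self, Fin.tail_update_zero]
      rw [sweedler_act_mul hact]
      congr 2
      ext h1 : 1
      have e : Function.update a (Fin.succ 0) (s * a (Fin.succ 0)) 0 = a 0 := by simp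
      rw [e]
      ext h2
      simp only [Fin.tail_update_succ]
      change _ = twist act G (r + 1) (φ.curryLeft (act h1 (a 0))) h2
        (Function.update (Fin.tail a) 0 (s * (Fin.tail a) 0))
      rw [twist_mul_first hact _ h2 (Fin.tail a) _ s (by simp) (by simp)]
      simp only [LinearMap.comp_apply]
      congr 2
      ext h3 h4
      change twist act G (r + 1) (φ.curryLeft (act h1 (a 0) * act h3 s)) h4 (Fin.tail a) =
        twist act G (r + 1) (mulFirst (φ.curryLeft (act h1 (a 0))) (act h3 s)) h4 (Fin.tail a)
      congr 3
      ext b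
      have := hφ 0 (Fin.succ 0) rfl _ (hS h3 s hT) (Fin.cons (act h1 (a 0)) b)
      simp only [Fin.cons_zero, Fin.update_cons_zero, Fin.cons_succ, ← Fin.cons_update] at this
      change φ (Fin.cons _ b) = φ (Fin.cons _ (Fin.cons (act h3 s * b 0) (Fin.tail b)))
      rw [this]
      congr 2
      nth_rewrite 1 [← Fin.cons_self_tail b]
      rw [Fin.update_cons_zero]
    · obtain ⟨i, rfl⟩ : ∃ i' : Fin r, i = i'.succ :=
        ⟨⟨i - 1, by have := i.2; omega⟩, Fin.ext (by simp; omega)⟩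
      rw [twist_succ, twist_succ]
      have e : ∀ (t : Fin r) (x : A), Function.update a t.succ x 0 = a 0 :=
        fun t x => Function.update_of_ne (Fin.succ_ne_zero t).symm _ _
      rw [e, e]
      congr 2
      ext h1 h2
      simp only [Fin.tail_update_succ]
      refine ih (φ.curryLeft (act h1 (a 0))) (fun i j hij s hs b => ?_) h2 i j (by simpa using hij)
        (Fin.tail a)
      have := hφ i.succ j.succ (by simpa using hij) s hs (Fin.cons (act h1 (a 0)) b)
      simp only [← Fin.cons_update, Fin.cons_succ] at this
      exact this

theorem twist_postComp (T : Module.End k M) (hT : ∀ h m, G h (T m) = T (G h m)) {r : ℕ}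
    (φ : MultilinearMap k (fun _ : Fin r => A) M) (h : H) (a : Fin r → A) :
    twist act G r (postComp r T φ) h a = T (twist act G r φ h a) := by
  induction r generalizing h with
  | zero => simp [twist_zero, hT]
  | succ r ih =>
    rw [twist_succ, twist_succ, ← LinearMap.comp_apply, comp_sweedler]
    congr 2
    ext h1 h2
    exact ih (φ.curryLeft (act h1 (a 0))) h2 (Fin.tail a)

theorem twist_right
    (hact : ∀ a b : A, toConv (act.flip (a * b)) = toConv (act.flip a) * toConv (act.flip b))
    {r : ℕ} (φ : MultilinearMap k (fun _ : Fin r => A) M) (s : A) (T : Set A)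
    (hT : s ∈ T) (hS : ∀ h, ∀ s ∈ T, act h s ∈ T)
    (hGR : sweedler ((LinearMap.mul k (Module.End k M)).flip.compl₁₂ (R ∘ₗ act.flip s) G) =
      LinearMap.mulLeft k (R s) ∘ₗ G)
    (hφ : ∀ i : Fin r, (i : ℕ) + 1 = r → ∀ s ∈ T, ∀ a : Fin r → A,
      φ (Function.update a i (a i * s)) = R s (φ a))
    (h : H) (i : Fin r) (hi : (i : ℕ) + 1 = r) (a : Fin r → A) :
    twist act G r φ h (Function.update a i (a i * s)) = R s (twist act G r φ h a) := by
  induction r generalizing h with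
  | zero => exact i.elim0
  | succ r ih =>
    by_cases hr : r = 0
    · subst hr
      obtain rfl : i = 0 := Fin.ext (by simp)
      rw [twist_succ, twist_succ]
      simp only [Function.update_self, Fin.tail_update_zero]
      rw [sweedler_act_mul hact, ← LinearMap.comp_apply, comp_sweedler]
      congr 2
      ext h1 h2
      have e := congrArg (fun g => g h2 (φ (fun _ => act h1 (a 0)))) hGR
      simp only [LinearMap.comp_apply, LinearMap.mulLeft_apply, Module.End.mul_apply] at e
      have e2 : ∀ x : A, φ (Fin.cons x (Fin.tail a)) = φ (fun _ => x) := by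
        intro x; congr 1; ext t; obtain rfl : t = 0 := Fin.ext (by simp); rfl
      change _ = R s (G h2 (φ (Fin.cons (act h1 (a 0)) (Fin.tail a))))
      rw [e2, ← e]
      simp only [LinearMap.comp_apply]
      simp only [sweedler_repr _ (Coalgebra.Repr.arbitrary k h2), LinearMap.sum_apply]
      refine Finset.sum_congr rfl fun t _ => ?_
      change G _ (φ (Fin.cons (act h1 (a 0) * act _ s) (Fin.tail a))) = G _ (R (act _ s) _)
      congr 1
      rw [← hφ 0 rfl _ (hS _ _ hT)]
      congr 1
      ext u
      obtain rfl : u = 0 := Fin.ext (by simp)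
      simp
    · obtain ⟨i, rfl⟩ : ∃ i' : Fin r, i = i'.succ :=
        ⟨⟨i - 1, by have := i.2; omega⟩, Fin.ext (by simp; omega)⟩
      rw [twist_succ, twist_succ, ← LinearMap.comp_apply, comp_sweedler]
      have e : ∀ (t : Fin r) (x : A), Function.update a t.succ x 0 = a 0 :=
        fun t x => Function.update_of_ne (Fin.succ_ne_zero t).symm _ _
      rw [e]
      congr 2
      ext h1 h2
      simp only [Fin.tail_update_succ]
      refine ih (φ.curryLeft (act h1 (a 0))) (fun i hi s hs b => ?_) h2 i (by simpa using hi)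
        (Fin.tail a)
      have := hφ i.succ (by simpa using hi) s hs (Fin.cons (act h1 (a 0)) b)
      simp only [← Fin.cons_update, Fin.cons_succ] at this
      exact this


theorem IsRelCochain.diagonalAct
    (hact : ∀ a b : A, toConv (act.flip (a * b)) = toConv (act.flip a) * toConv (act.flip b))
    (hS : ∀ h, ∀ s ∈ S, act h s ∈ S)
    (hPL : ∀ s ∈ S, sweedler ((LinearMap.mul k (Module.End k M)).compl₁₂ P (L ∘ₗ act.flip s)) =
      LinearMap.mulLeft k (L s) ∘ₗ P)
    (hGR : ∀ s ∈ S,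
      sweedler ((LinearMap.mul k (Module.End k M)).flip.compl₁₂ (R ∘ₗ act.flip s) G) =
        LinearMap.mulLeft k (R s) ∘ₗ G)
    (hGL : ∀ h a m, G h (L a m) = L a (G h m)) (hPR : ∀ h a m, P h (R a m) = R a (P h m))
    {r : ℕ} {φ : MultilinearMap k (fun _ : Fin r => A) M} (hφ : IsRelCochain S L R φ) (h : H) :
    IsRelCochain S L R (HopfCrossed.diagonalAct act P G r h φ) where
  map_left i hi s hs a := by
    obtain ⟨r, rfl⟩ : ∃ r', r = r' + 1 := ⟨r - 1, by have := i.2; omega⟩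
    obtain rfl : i = 0 := Fin.ext hi
    rw [diagonalAct_apply, diagonalAct_apply, ← LinearMap.comp_apply, comp_sweedler]
    have e : evalAt (Function.update a 0 (s * a 0)) ∘ₗ twist act G (r + 1) φ =
        sweedler ((L ∘ₗ act.flip s).compl₂ (evalAt a ∘ₗ twist act G (r + 1) φ)) := by
      ext h1
      change twist act G (r + 1) φ h1 (Function.update a 0 (s * a 0)) = _
      rw [twist_mul_first hact φ h1 a _ s (by simp) (by simp)]
      congr 2
      ext h2 h3
      change twist act G (r + 1) (mulFirst φ (act h2 s)) h3 a =
        L (act h2 s) (twist act G (r + 1) φ h3 a)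
      rw [← twist_postComp (L (act h2 s)) (fun h m => hGL h _ m)]
      congr 3
      ext b
      have := hφ.map_left 0 rfl _ (hS h2 s hs) b
      change φ (Fin.cons (act h2 s * b 0) (Fin.tail b)) = L (act h2 s) (φ b)
      rw [← this]
      congr 1
      nth_rewrite 3 [← Fin.cons_self_tail b]
      rw [Fin.update_cons_zero]
    rw [e]
    have e2 : P.compl₂ (sweedler ((L ∘ₗ act.flip s).compl₂ (evalAt a ∘ₗ twist act G (r + 1) φ))) =
        sweedler ∘ₗ (((LinearMap.mul k (Module.End k M)).compl₁₂ P (L ∘ₗ act.flip s)).compr₂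
          (LinearMap.lcomp k M (evalAt a ∘ₗ twist act G (r + 1) φ))) := by
      ext h1 h2
      simp [sweedler_repr _ (Coalgebra.Repr.arbitrary k h2)]
    rw [e2, sweedler_coassoc, ← comp_sweedler, hPL s hs]
    congr 2
  map_right i hi s hs a := by
    rw [diagonalAct_apply, diagonalAct_apply, ← LinearMap.comp_apply, comp_sweedler]
    congr 2
    ext h1 h2
    change P h1 (twist act G r φ h2 _) = R s (P h1 (twist act G r φ h2 a))
    rw [twist_right hact φ s S hs hS (hGR s hs) hφ.map_right h2 i hi a, hPR]
  balanced i j hij s hs a := by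
    rw [diagonalAct_apply, diagonalAct_apply]
    congr 3
    ext h1
    exact twist_balanced hact φ s S hs hS hφ.balanced h1 i j hij a
  normalized i a ha := by
    rw [diagonalAct_apply]
    have e : evalAt a ∘ₗ twist act G r φ = 0 := by
      ext h1
      exact twist_normalized hS φ hφ.normalized h1 i a ha
    have e2 : P.compl₂ (0 : H →ₗ[k] M) = 0 := by ext; simp
    rw [e, e2, map_zero, LinearMap.zero_apply]
  central hr s hs a := by
    subst hr
    rw [diagonalAct_apply]
    have e : ∀ g : H →ₗ[k] Module.End k M, evalAt a ∘ₗ twist act g 0 φ =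
        LinearMap.applyₗ (φ a) ∘ₗ g := fun g => by ext; rfl
    have hGR' : LinearMap.applyₗ (φ a) ∘ₗ LinearMap.mulLeft k (R s) ∘ₗ G =
        sweedler ((L ∘ₗ act.flip s).compl₂ (LinearMap.applyₗ (φ a) ∘ₗ G)) := by
      rw [← hGR s hs, comp_sweedler]
      congr 1
      ext h1 h2
      change G h2 (R (act h1 s) (φ a)) = L (act h1 s) (G h2 (φ a))
      rw [← hφ.central rfl _ (hS h1 s hs), hGL]
    have e2 : P.compl₂ (sweedler ((L ∘ₗ act.flip s).compl₂ (LinearMap.applyₗ (φ a) ∘ₗ G))) =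
        sweedler ∘ₗ (((LinearMap.mul k (Module.End k M)).compl₁₂ P (L ∘ₗ act.flip s)).compr₂
          (LinearMap.lcomp k M (LinearMap.applyₗ (φ a) ∘ₗ G))) := by
      ext h1 h2
      simp [sweedler_repr _ (Coalgebra.Repr.arbitrary k h2)]
    have e3 : R s ∘ₗ sweedler (P.compl₂ (LinearMap.applyₗ (φ a) ∘ₗ G)) =
        sweedler (P.compl₂ (LinearMap.applyₗ (φ a) ∘ₗ LinearMap.mulLeft k (R s) ∘ₗ G)) := by
      rw [comp_sweedler]
      congr 1
      ext h1 h2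
      exact (hPR h1 s (G h2 (φ a))).symm
    rw [e, ← LinearMap.comp_apply (R s), e3, hGR', e2, sweedler_coassoc, ← LinearMap.comp_apply,
      comp_sweedler, ← comp_sweedler (LinearMap.lcomp k M _), hPL s hs]
    congr 2

end Preserve
section HCohomology

variable {k H : Type*} [CommRing k] [Ring H] [HopfAlgebra k H]
variable {C : ℕ → Type*} [∀ r, AddCommGroup (C r)] [∀ r, Module k (C r)]

/-- The `n`-cochains `⨁_{r+s=n} Hom_k(H^{⊗ s}, C^r)` of the total complex computing the cohomology
of `H` with coefficients in `(C^r)_r`. -/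
abbrev TotCochain (k H : Type*) [CommRing k] [Ring H] [HopfAlgebra k H]
    (C : ℕ → Type*) [∀ r, AddCommGroup (C r)] [∀ r, Module k (C r)] (n : ℕ) : Type _ :=
  ∀ p : {p : ℕ × ℕ // p.1 + p.2 = n}, MultilinearMap k (fun _ : Fin p.1.2 => H) (C p.1.1)

/-- The component in `Hom_k(H^{⊗ s}, C^r)` of a cochain of the total complex. -/
def cochainProj (n r s : ℕ) (h : r + s = n) :
    TotCochain k H C n →ₗ[k] MultilinearMap k (fun _ : Fin s => H) (C r) where
  toFun x := x ⟨(r, s), h⟩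
  map_add' _ _ := rfl
  map_smul' _ _ := rfl

/-- The coboundary `Hom_k(H^{⊗ s}, C) → Hom_k(H^{⊗ (s+1)}, C)` of the bar complex of a right
`H`-module `C`, whose right action is given by `ρ`:
`(δ ψ)(h₀, …, hₛ) = ε(h₀) ψ(h₁, …, hₛ) + ∑ⱼ (-1)^(j+1) ψ(h₀, …, hⱼ hⱼ₊₁, …, hₛ)
  + (-1)^(s+1) ψ(h₀, …, hₛ₋₁) · hₛ`. -/
def barD {N : Type*} [AddCommGroup N] [Module k N] (ρ : H →ₗ[k] Module.End k N) (s : ℕ) :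
    MultilinearMap k (fun _ : Fin s => H) N →ₗ[k] MultilinearMap k (fun _ : Fin (s + 1) => H) N :=
  hochschildD ((Coalgebra.counit (R := k) (A := H)).smulRight (1 : Module.End k N)) ρ s

/-- The part of the total differential that is induced by the differential `d` of `C`. -/
def totHor (d : ∀ r, C r →ₗ[k] C (r + 1)) (n : ℕ) : ∀ r s : ℕ, r + s = n + 1 →
    (TotCochain k H C n →ₗ[k] MultilinearMap k (fun _ : Fin s => H) (C r))
  | 0, _, _ => 0
  | r + 1, s, h => (d r).compMultilinearMapₗ k ∘ₗ cochainProj n r s (by omega)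

/-- The part of the total differential that is induced by the bar coboundary of `H`, with the
sign `(-1)^r`. -/
def totVer (ρ : ∀ r, H →ₗ[k] Module.End k (C r)) (n : ℕ) : ∀ r s : ℕ, r + s = n + 1 →
    (TotCochain k H C n →ₗ[k] MultilinearMap k (fun _ : Fin s => H) (C r))
  | _, 0, _ => 0
  | r, s + 1, h => (-1 : k) ^ r • (barD (ρ r) s ∘ₗ cochainProj n r s (by omega))

/-- The differential of the total complex. -/
def totD (d : ∀ r, C r →ₗ[k] C (r + 1)) (ρ : ∀ r, H →ₗ[k] Module.End k (C r)) (n : ℕ) :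
    TotCochain k H C n →ₗ[k] TotCochain k H C (n + 1) :=
  LinearMap.pi fun p => totHor d n p.1.1 p.1.2 p.2 + totVer ρ n p.1.1 p.1.2 p.2

/-- `(C, d)`, with the maps `ρ r : H → End(C^r)`, is a cochain complex of right `H`-modules;
here `ρ r h x` is `x · h`. -/
structure IsRightModuleComplex (d : ∀ r, C r →ₗ[k] C (r + 1))
    (ρ : ∀ r, H →ₗ[k] Module.End k (C r)) : Prop where
  d_comp_d : ∀ r x, d (r + 1) (d r x) = 0
  act_one : ∀ r x, ρ r 1 x = x
  act_mul : ∀ r h l x, ρ r (h * l) x = ρ r l (ρ r h x)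
  d_act : ∀ r h x, d r (ρ r h x) = ρ (r + 1) h (d r x)

/-- The cohomology of `H` with coefficients in a cochain complex `(C, d)` of right `H`-modules
(with right actions given by `ρ`): the cohomology of the total complex of the double complex
`Hom_k(H^{⊗ s}, C^r)`. -/
abbrev HopfCohomology (d : ∀ r, C r →ₗ[k] C (r + 1)) (ρ : ∀ r, H →ₗ[k] Module.End k (C r))
    (n : ℕ) : Type _ :=
  Cohomology (totD d ρ) n

end HCohomology

section Bimodule

variable (k B N : Type*) [CommRing k] [Ring B] [Algebra k B] [AddCommGroup N] [Module k N]
  [Module B N] [Module Bᵐᵒᵖ N] [IsScalarTower k B N] [IsScalarTower k Bᵐᵒᵖ N]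

/-- The left action of `B` on a `B`-bimodule, `b ↦ (n ↦ b n)`. -/
def leftMul : B →ₗ[k] Module.End k N := (Algebra.lsmul k k N).toLinearMap

/-- The right action of `B` on a `B`-bimodule, `b ↦ (n ↦ n b)`. -/
def rightMul : B →ₗ[k] Module.End k N :=
  (Algebra.lsmul k k N : Bᵐᵒᵖ →ₐ[k] Module.End k N).toLinearMap ∘ₗ
    (MulOpposite.opLinearEquiv k).toLinearMap

/-- The Hochschild cohomology `H^n(B, N)` of a `k`-algebra `B` with coefficients in a
`B`-bimodule `N`. -/
abbrev HochschildCohomology (n : ℕ) : Type _ :=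
  Cohomology (hochschildD (leftMul k B N) (rightMul k B N)) n

/-- `B` is a separable `k`-algebra: it has a separability idempotent, that is, an element `e` of
`B ⊗ B` with `μ(e) = 1` and `b e = e b` for all `b`. -/
def IsSeparableAlgebra (k B : Type*) [CommRing k] [Ring B] [Algebra k B] : Prop :=
  ∃ e : B ⊗[k] B, LinearMap.mul' k B e = 1 ∧ ∀ b : B, (b ⊗ₜ 1) * e = e * (1 ⊗ₜ b)

end Bimodule

namespace CrossedProduct

variable {k A H : Type*} [CommRing k] [Ring A] [Algebra k A] [Ring H] [HopfAlgebra k H]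
  (X : CrossedProduct k A H)

theorem sum_smul_counit {h : H} {ι : Type*} (R : Coalgebra.Repr k h ι) :
    ∑ i ∈ R.index, Coalgebra.counit (R := k) (R.right i) • R.left i = h := by
  have := congrArg (TensorProduct.rid k H) (Coalgebra.sum_tmul_counit_eq R)
  simp only [map_sum, TensorProduct.rid_tmul, one_smul] at this
  exact this

theorem cocycleMul_one (h : H) : cocycleMul X.f (h ⊗ₜ 1) = 1 ⊗ₜ h := by
  have e := X.crossed_one (1 ⊗ₜ h)
  rw [crossedMul_tmul _ _ _ _ _ _ (Coalgebra.Repr.arbitrary k h)] at e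
  simp only [X.act_one, one_mul, algebraMap_smul] at e
  rw [← e]
  have := congrArg (fun z => cocycleMul X.f (z ⊗ₜ 1))
    (Coalgebra.sum_counit_smul (Coalgebra.Repr.arbitrary k h))
  simp only [TensorProduct.sum_tmul, ← TensorProduct.smul_tmul', map_sum, map_smul] at this
  exact this.symm

theorem inclA_mul_gamma (a : A) (h : H) : X.inclA a * X.gamma h = (a ⊗ₜ h : A ⊗[k] H) := by
  have e := X.one_crossed (1 ⊗ₜ h)
  have key : ∀ a : A, crossedMul X.act X.f (a ⊗ₜ 1) (1 ⊗ₜ h) = a • cocycleMul X.f (1 ⊗ₜ h) := by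
    intro a
    let R : Coalgebra.Repr k (1 : H) Unit := ⟨{()}, fun _ => 1, fun _ => 1, by simp; rfl⟩
    rw [crossedMul_tmul _ _ _ _ _ _ R]
    simp [R, X.one_act]
  rw [key, one_smul] at e
  change crossedMul X.act X.f (a ⊗ₜ 1) (1 ⊗ₜ h) = _
  rw [key, e, TensorProduct.smul_tmul']
  simp

theorem gamma_mul_inclA (h : H) (a : A) :
    X.gamma h * X.inclA a =
      sweedler ((LinearMap.mul k X.E).compl₁₂ (X.inclA ∘ₗ X.act.flip a) X.gamma) h := by
  change crossedMul X.act X.f (1 ⊗ₜ h) (a ⊗ₜ 1) = _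
  rw [crossedMul_tmul _ _ _ _ _ _ (Coalgebra.Repr.arbitrary k h),
    sweedler_repr _ (Coalgebra.Repr.arbitrary k h)]
  refine Finset.sum_congr rfl fun i _ => ?_
  change _ = X.inclA _ * X.gamma _
  rw [inclA_mul_gamma, cocycleMul_one, TensorProduct.smul_tmul']
  simp
  rfl

theorem inclA_mul (a b : A) : X.inclA (a * b) = X.inclA a * X.inclA b := by
  change _ = crossedMul X.act X.f (a ⊗ₜ 1) (b ⊗ₜ 1)
  let R : Coalgebra.Repr k (1 : H) Unit := ⟨{()}, fun _ => 1, fun _ => 1, by simp; rfl⟩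
  rw [crossedMul_tmul _ _ _ _ _ _ R]
  simp only [R, Finset.sum_singleton, X.one_act, cocycleMul_one, TensorProduct.smul_tmul']
  simp [inclA]
  rfl

theorem conv_eq (a : A) :
    toConv (X.inclA ∘ₗ X.act.flip a) * toConv X.gamma =
      toConv X.gamma *
        toConv ((Coalgebra.counit (R := k) (A := H)).smulRight (X.inclA a)) := by
  ext h
  have R := Coalgebra.Repr.arbitrary k h
  have e1 := R.convMul_apply (toConv (X.inclA ∘ₗ X.act.flip a)) (toConv X.gamma)
  have e2 := R.convMul_apply (toConv X.gamma)
    (toConv ((Coalgebra.counit (R := k) (A := H)).smulRight (X.inclA a)))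
  have e3 := X.gamma_mul_inclA h a
  rw [sweedler_repr _ R] at e3
  have e4 : X.gamma h * X.inclA a =
      ∑ i ∈ R.index, X.gamma (R.left i) * (Coalgebra.counit (R := k) (R.right i) • X.inclA a) := by
    nth_rewrite 1 [← sum_smul_counit R]
    simp only [map_sum, map_smul, Finset.sum_mul, smul_mul_assoc, mul_smul_comm]
  exact e1.trans (e3.symm.trans (e4.trans e2.symm))

theorem gammaInv_conv (a : A) :
    toConv X.gammaInv * toConv (X.inclA ∘ₗ X.act.flip a) =
      toConv ((Coalgebra.counit (R := k) (A := H)).smulRight (X.inclA a)) * toConv X.gammaInv := by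
  have hg : toConv X.gammaInv = Ring.inverse (toConv X.gamma) := rfl
  rw [hg]
  by_cases hu : IsUnit (toConv X.gamma)
  · have h1 := Ring.inverse_mul_cancel _ hu
    have h2 := Ring.mul_inverse_cancel _ hu
    calc _ = Ring.inverse (toConv X.gamma) * (toConv (X.inclA ∘ₗ X.act.flip a) *
          (toConv X.gamma * Ring.inverse (toConv X.gamma))) := by rw [h2, mul_one]
      _ = Ring.inverse (toConv X.gamma) * ((toConv (X.inclA ∘ₗ X.act.flip a) *
          toConv X.gamma) * Ring.inverse (toConv X.gamma)) := by rw [mul_assoc (toConv (_ ∘ₗ _))]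
      _ = _ := by rw [conv_eq, mul_assoc, ← mul_assoc, h1, one_mul]
  · rw [Ring.inverse_non_unit _ hu, zero_mul, mul_zero]

theorem sweedler_gammaInv (a : A) :
    sweedler ((LinearMap.mul k X.E).compl₁₂ X.gammaInv (X.inclA ∘ₗ X.act.flip a)) =
      LinearMap.mulLeft k (X.inclA a) ∘ₗ X.gammaInv := by
  ext h
  have R := Coalgebra.Repr.arbitrary k h
  rw [sweedler_repr _ R]
  have e0 := congrArg (fun g => g h) (X.gammaInv_conv a)
  have e1 := R.convMul_apply (toConv X.gammaInv) (toConv (X.inclA ∘ₗ X.act.flip a))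
  have e2 := R.convMul_apply
    (toConv ((Coalgebra.counit (R := k) (A := H)).smulRight (X.inclA a))) (toConv X.gammaInv)
  have e4 : X.inclA a * X.gammaInv h =
      ∑ i ∈ R.index, (Coalgebra.counit (R := k) (R.left i) • X.inclA a) * X.gammaInv (R.right i) := by
    nth_rewrite 1 [← Coalgebra.sum_counit_smul R]
    simp only [map_sum, map_smul, Finset.mul_sum, smul_mul_assoc, mul_smul_comm]
  exact e1.symm.trans (e0.trans (e2.trans e4.symm))

variable (M : Type*) [AddCommGroup M] [Module k M] [Module X.E M] [Module X.Eᵐᵒᵖ M]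
  [IsScalarTower k X.E M] [IsScalarTower k X.Eᵐᵒᵖ M]

/-- The left action of `A` on an `E`-bimodule `M`. -/
def leftA : A →ₗ[k] Module.End k M := leftMul k X.E M ∘ₗ X.inclA

/-- The right action of `A` on an `E`-bimodule `M`. -/
def rightA : A →ₗ[k] Module.End k M := rightMul k X.E M ∘ₗ X.inclA

/-- The module `Hom_{S^e}(Ã^r, M)`, where `Ã^r` is the `r`-fold tensor power over `S` of the
`S`-bimodule `Ã = A/S` (and `Ã^0 = S`). An `S`-bimodule map on `Ã^r` is given as the corresponding
multilinear map `φ` on `A^r`, see `IsRelCochain`. -/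
def RelCochain (S : Subalgebra k A) (r : ℕ) :
    Submodule k (MultilinearMap k (fun _ : Fin r => A) M) where
  carrier := {φ | IsRelCochain S (X.leftA M) (X.rightA M) φ}
  add_mem' {φ ψ} hφ hψ :=
    ⟨fun i hi s hs a => by simp [hφ.map_left i hi s hs a, hψ.map_left i hi s hs a],
      fun i hi s hs a => by simp [hφ.map_right i hi s hs a, hψ.map_right i hi s hs a],
      fun i j hij s hs a => by simp [hφ.balanced i j hij s hs a, hψ.balanced i j hij s hs a],
      fun i a ha => by simp [hφ.normalized i a ha, hψ.normalized i a ha],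
      fun h s hs a => by simp [hφ.central h s hs a, hψ.central h s hs a]⟩
  zero_mem' := ⟨by simp, by simp, by simp, by simp, by simp⟩
  smul_mem' c φ hφ :=
    ⟨fun i hi s hs a => by simp [hφ.map_left i hi s hs a],
      fun i hi s hs a => by simp [hφ.map_right i hi s hs a],
      fun i j hij s hs a => by simp [hφ.balanced i j hij s hs a],
      fun i a ha => by simp [hφ.normalized i a ha],
      fun h s hs a => by simp [hφ.central h s hs a]⟩

variable [SMulCommClass X.E X.Eᵐᵒᵖ M]

/-- The coboundary `b^r : Hom_{S^e}(Ã^r, M) → Hom_{S^e}(Ã^{r+1}, M)`. -/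
def relD (S : Subalgebra k A) (r : ℕ) : X.RelCochain M S r →ₗ[k] X.RelCochain M S (r + 1) :=
  (hochschildD (X.leftA M) (X.rightA M) r).restrict fun _ hφ =>
    IsRelCochain.hochschildD
      (fun a b m => by simp [leftA, leftMul, inclA_mul, mul_smul])
      (fun a b m => by simp [rightA, rightMul, inclA_mul, mul_smul])
      (fun a b m => by simp [leftA, rightA, leftMul, rightMul, smul_comm]) hφ

/-- The right action of `H` on `Hom_{S^e}(Ã^r, M)`:
`(φ · h)(a₁, …, aᵣ) = (1 # h⁽¹⁾)⁻¹ φ(a₁^{h⁽²⁾}, …, aᵣ^{h⁽ʳ⁺¹⁾}) (1 # h⁽ʳ⁺²⁾)`. -/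
def relAct (S : Subalgebra k A) (hS : ∀ h, ∀ s ∈ S, X.act h s ∈ S) (r : ℕ) :
    H →ₗ[k] Module.End k (X.RelCochain M S r) where
  toFun h := (diagonalAct X.act (leftMul k X.E M ∘ₗ X.gammaInv) (rightMul k X.E M ∘ₗ X.gamma) r
    h).restrict fun _ hφ => IsRelCochain.diagonalAct X.act_mul hS
      (fun s _ => by
        ext h m
        have := congrArg (fun g => g h • m) (X.sweedler_gammaInv s)
        simpa [sweedler_repr _ (Coalgebra.Repr.arbitrary k h), Finset.sum_smul, leftA, leftMul,
          mul_smul] using this)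
      (fun s _ => by
        ext h m
        have := congrArg (fun g => MulOpposite.op g • m) (X.gamma_mul_inclA h s)
        simpa [sweedler_repr _ (Coalgebra.Repr.arbitrary k h), Finset.sum_smul, rightA, rightMul,
          mul_smul] using this.symm)
      (fun h a m => by simp [leftA, leftMul, rightMul, smul_comm])
      (fun h a m => by simp [rightA, leftMul, rightMul, smul_comm]) hφ h
  map_add' h l := by ext; simp; rfl
  map_smul' c h := by ext; simp; rfl

end CrossedProduct
end
end HopfCrossed

/-! Write γ(h) = 1 # h. Both theories are regarded as functors of the coefficient bimodule N and
compared by dimension shifting. The map m ↦ (y ↦ m y) embeds N into the coinduced bimodule I =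
Hom_k(E, N), with (bξ)(x) = b ξ(x) and (ξb)(x) = ξ(bx); let Q be the cokernel. In degree 0 both
theories give the centre Z(N) = {m : em = me for all e in E}, and both vanish on I in positive
degrees. When 0 → N → I → Q → 0 induces short exact sequences of cochain complexes, H^{n+2}(N) ≅
H^{n+1}(Q), and H^1(N) is Z(Q) modulo the image of Z(I), in either theory. Induction on the degree,
over all bimodules at once (`nonempty_equiv`), finishes; no comparison map is constructed. Since the
coefficients vary, a bimodule is carried as a pair of linear maps L, R.

Exactness for S-relative cochains requires the sequence of coefficients to split over S on both
sides. A separability idempotent ∑ eᵢ ⊗ fᵢ gives the retraction ξ ↦ ∑ ξ(eᵢ)fᵢ of N → I, which is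
left E-linear and right S-linear (`exists_retraction`).

Invertibility of γ: a map u from a coalgebra C to an algebra B is convolution invertible exactly
when b ⊗ c ↦ b u(c⁽¹⁾) ⊗ c⁽²⁾ is bijective. Under E ⊗ H ≅ A ⊗ H ⊗ H this map for γ is the composite
of those for f and for the identity of H. The former is bijective by hypothesis, the latter thanks
to the antipode (`isUnit_gamma`).

The H-action: the weak action is associative only up to f, namely (a^{l⁽¹⁾})^{h⁽¹⁾} f(h⁽²⁾, l⁽²⁾) =
f(h⁽¹⁾, l⁽¹⁾) a^{h⁽²⁾l⁽²⁾}. In (φ·h)·l the product γ(h)γ(l) = f(h⁽¹⁾, l⁽¹⁾)γ(h⁽²⁾l⁽²⁾) puts a value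
of f to the right of φ. As it lies in S, it moves leftwards through all arguments of the relative
cochain and is absorbed by γ⁻¹(l⁽¹⁾)γ⁻¹(h⁽¹⁾)f(h⁽²⁾, l⁽²⁾) = γ⁻¹(hl) (`diagonalAct_mul`).

Vanishing of the double complex on I (`totD_coind_exact`): as E = A ⊗ H is extended from H as a left
A-module, I is coinduced over A, so the rows are contractible in positive degrees. The horizontal
cocycles in column 0 are the left A-linear maps E → N, that is, the linear maps w : H → N. Writing
w(y) = γ(y⁽¹⁾)ζ(y⁽²⁾) turns the action of h into ζ ↦ ζ(h ·), so they form a coinduced H-module,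
whose bar complex is exact in positive degrees. -/

namespace HopfCrossed

noncomputable section

open WithConv

/-! ### Hochschild coboundaries by currying the last argument -/

section HochschildCalculus

variable {k B N N' : Type*} [CommRing k] [Ring B] [Algebra k B] [AddCommGroup N] [Module k N]
  [AddCommGroup N'] [Module k N']

/-- `L` and `R` are commuting left and right actions of `B` on `N`, not assumed to be unital. -/
structure IsActionPair (L R : B →ₗ[k] Module.End k N) : Prop where
  left_mul : ∀ a b n, L (a * b) n = L a (L b n)
  right_mul : ∀ a b n, R (a * b) n = R b (R a n)
  comm : ∀ a b n, L a (R b n) = R b (L a n)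

/-- The left action `(b ξ)(x) = b ξ(x)` on linear maps. -/
def homLeft {C : Type*} [AddCommGroup C] [Module k C] (L : B →ₗ[k] Module.End k N) :
    B →ₗ[k] Module.End k (C →ₗ[k] N) :=
  LinearMap.mk₂ k (fun b ξ => L b ∘ₗ ξ) (fun _ _ _ => by ext; simp) (fun _ _ _ => by ext; simp)
    (fun _ _ _ => by ext; simp) (fun _ _ _ => by ext; simp)

@[simp] theorem homLeft_apply {C : Type*} [AddCommGroup C] [Module k C]
    (L : B →ₗ[k] Module.End k N) (b : B) (ξ : C →ₗ[k] N) (x : C) :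
    homLeft L b ξ x = L b (ξ x) := rfl

/-- The right action `(ξ b)(x) = ξ(b x)` on linear maps. -/
def homRight : B →ₗ[k] Module.End k (B →ₗ[k] N) :=
  LinearMap.mk₂ k (fun b ξ => ξ ∘ₗ LinearMap.mulLeft k b) (fun _ _ _ => by ext; simp [add_mul])
    (fun _ _ _ => by ext; simp) (fun _ _ _ => by ext; simp) (fun _ _ _ => by ext; simp)

@[simp] theorem homRight_apply (b : B) (ξ : B →ₗ[k] N) (x : B) :
    homRight (k := k) b ξ x = ξ (b * x) := rfl

/-- The right action `(ξ b)(x) = ξ(b x) - ξ(b) x` on linear maps. -/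
def homShiftRight (R : B →ₗ[k] Module.End k N) : B →ₗ[k] Module.End k (B →ₗ[k] N) :=
  homRight - LinearMap.mk₂ k (fun b ξ => R.flip (ξ b)) (fun _ _ _ => by ext; simp)
    (fun _ _ _ => by ext; simp) (fun _ _ _ => by ext; simp) (fun _ _ _ => by ext; simp)

@[simp] theorem homShiftRight_apply (R : B →ₗ[k] Module.End k N) (b : B) (ξ : B →ₗ[k] N) (x : B) :
    homShiftRight R b ξ x = ξ (b * x) - R x (ξ b) := rfl

/-- Under the new right action the unit sends ξ to x ↦ ξ(x) - ξ(1)x, which need not be ξ. Unit laws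
are left out of `IsActionPair` so that it is stable under this construction. -/
theorem homShift_isActionPair {L R : B →ₗ[k] Module.End k N} (h : IsActionPair L R) :
    IsActionPair (homLeft L) (homShiftRight R) where
  left_mul a b n := by ext; simp [h.left_mul]
  right_mul a b n := by ext; simp [h.right_mul, mul_assoc]
  comm a b n := by ext; simp [h.comm]

theorem contractNth_castSucc_snoc {α : Type*} {n : ℕ} (op : α → α → α) (j : Fin n)
    (b : Fin (n + 1) → α) (x : α) :
    Fin.contractNth j.castSucc.castSucc op (Fin.snoc b x : Fin (n + 2) → α) =
      (Fin.snoc (Fin.contractNth j.castSucc op b) x : Fin (n + 1) → α) := by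
  ext t
  refine Fin.lastCases ?_ (fun t => ?_) t
  · simp only [Fin.snoc_last]
    rw [Fin.contractNth_apply_of_gt _ _ _ _ (by simp), Fin.succ_last, Fin.snoc_last]
  · simp only [Fin.snoc_castSucc, Fin.contractNth, Fin.val_castSucc, Fin.succ_castSucc]

theorem contractNth_last_snoc {α : Type*} {n : ℕ} (op : α → α → α)
    (b : Fin (n + 1) → α) (x : α) :
    Fin.contractNth (Fin.last n).castSucc op (Fin.snoc b x : Fin (n + 2) → α) =
      (Fin.snoc (Fin.init b) (op (b (Fin.last n)) x) : Fin (n + 1) → α) := by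
  ext t
  refine Fin.lastCases ?_ (fun t => ?_) t
  · rw [Fin.contractNth_apply_of_eq _ _ _ _ (by simp), Fin.succ_last, Fin.snoc_last,
      Fin.snoc_castSucc, Fin.snoc_last]
  · rw [Fin.contractNth_apply_of_lt _ _ _ _ (by simp), Fin.snoc_castSucc, Fin.snoc_castSucc]
    rfl

/-- The last two terms φ(…, bₙx) and φ(…, bₙ)x of the coboundary carry opposite signs; together they
are `homShiftRight` of bₙ, applied to φ(…, bₙ₋₁, ·) and evaluated at x. Thus the degree drops by one
at the price of new coefficients, which allows induction over all coefficients. -/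
theorem hochschildD_curryRight (L R : B →ₗ[k] Module.End k N) (n : ℕ)
    (φ : MultilinearMap k (fun _ : Fin (n + 1) => B) N) :
    (hochschildD L R (n + 1) φ).curryRight =
      hochschildD (homLeft L) (homShiftRight R) n φ.curryRight := by
  ext b x
  rw [MultilinearMap.curryRight_apply, hochschildD_apply, hochschildD_apply,
    Fin.sum_univ_castSucc]
  simp only [LinearMap.add_apply, LinearMap.sum_apply, LinearMap.smul_apply, homLeft_apply,
    homShiftRight_apply, MultilinearMap.curryRight_apply, contractNth_castSucc_snoc,
    contractNth_last_snoc, Fin.snoc_last, Fin.snoc_castSucc, Fin.val_castSucc, Fin.val_last]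
  have e1 : (Fin.snoc b x : Fin (n + 2) → B) 0 = b 0 := by
    rw [← Fin.castSucc_zero, Fin.snoc_castSucc]
  have e2 : (fun i : Fin (n + 1) => (Fin.snoc b x : Fin (n + 2) → B) i.succ) =
      (Fin.snoc (fun i : Fin n => b i.succ) x : Fin (n + 1) → B) := by
    ext t
    refine Fin.lastCases ?_ (fun t => ?_) t
    · rw [Fin.succ_last, Fin.snoc_last, Fin.snoc_last]
    · rw [Fin.succ_castSucc, Fin.snoc_castSucc, Fin.snoc_castSucc]
  have e3 : (Fin.snoc (fun i : Fin n => b i.castSucc) (b (Fin.last n)) : Fin (n + 1) → B) = b :=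
    Fin.snoc_init_self b
  have e4 : (Fin.init b : Fin n → B) = fun i : Fin n => b i.castSucc := rfl
  rw [e1, e2, e3, e4, smul_sub, pow_succ (-1 : k) (n + 1)]
  simp only [mul_neg, mul_one, neg_smul]
  abel

theorem hochschildD_hochschildD_zero {L R : B →ₗ[k] Module.End k N} (h : IsActionPair L R)
    (φ : MultilinearMap k (fun _ : Fin 0 => B) N) :
    hochschildD L R 1 (hochschildD L R 0 φ) = 0 := by
  ext b
  have e : ∀ c : Fin 0 → B, φ c = φ 0 := fun c => by congr 1; exact Subsingleton.elim _ _
  simp [hochschildD_apply, e, h.left_mul, h.right_mul, h.comm, Fin.contractNth]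
  abel

theorem hochschildD_hochschildD_succ {L R : B →ₗ[k] Module.End k N} {n : ℕ}
    (h : ∀ φ, hochschildD (homLeft (C := B) L) (homShiftRight R) (n + 1)
      (hochschildD (homLeft L) (homShiftRight R) n φ) = 0)
    (φ : MultilinearMap k (fun _ : Fin (n + 1) => B) N) :
    hochschildD L R (n + 2) (hochschildD L R (n + 1) φ) = 0 := by
  rw [← MultilinearMap.uncurry_curryRight (hochschildD L R (n + 1 + 1) _),
    hochschildD_curryRight, hochschildD_curryRight, h]
  ext; simp

/-- The universe of N absorbs that of B, so Hom(B, N) stays in it and the induction may change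
coefficients. For arbitrary N one step of currying lands in this case. -/
theorem hochschildD_hochschildD_aux.{u, v} {B : Type u} [Ring B] [Algebra k B] (n : ℕ)
    {N : Type (max u v)} [AddCommGroup N] [Module k N] {L R : B →ₗ[k] Module.End k N}
    (h : IsActionPair L R) (φ : MultilinearMap k (fun _ : Fin n => B) N) :
    hochschildD L R (n + 1) (hochschildD L R n φ) = 0 := by
  induction n generalizing N with
  | zero => exact hochschildD_hochschildD_zero h φ
  | succ n ih => exact hochschildD_hochschildD_succ (ih (homShift_isActionPair h)) φ

theorem hochschildD_hochschildD {L R : B →ₗ[k] Module.End k N} (h : IsActionPair L R) (n : ℕ)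
    (φ : MultilinearMap k (fun _ : Fin n => B) N) :
    hochschildD L R (n + 1) (hochschildD L R n φ) = 0 := by
  cases n with
  | zero => exact hochschildD_hochschildD_zero h φ
  | succ n =>
    exact hochschildD_hochschildD_succ
      (hochschildD_hochschildD_aux n (homShift_isActionPair h)) φ

/-- A map that commutes with the actions induces a map of Hochschild complexes. -/
theorem hochschildD_compMultilinearMap {L R : B →ₗ[k] Module.End k N}
    {L' R' : B →ₗ[k] Module.End k N'} (g : N →ₗ[k] N') (hL : ∀ b n, g (L b n) = L' b (g n))
    (hR : ∀ b n, g (R b n) = R' b (g n)) (n : ℕ) (φ : MultilinearMap k (fun _ : Fin n => B) N) :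
    hochschildD L' R' n (g.compMultilinearMap φ) = g.compMultilinearMap (hochschildD L R n φ) := by
  ext b
  simp [hochschildD_apply, hL, hR]

/-- The operator on Hochschild cochains given by applying `K` to the last variable. -/
def contractLast (K : (B →ₗ[k] N) →ₗ[k] N) (n : ℕ) :
    MultilinearMap k (fun _ : Fin (n + 1) => B) N →ₗ[k] MultilinearMap k (fun _ : Fin n => B) N where
  toFun φ := K.compMultilinearMap φ.curryRight
  map_add' φ ψ := by
    ext b
    have : (φ + ψ).curryRight = φ.curryRight + ψ.curryRight := rfl
    simp [this]
  map_smul' c φ := by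
    ext b
    have : (c • φ).curryRight = c • φ.curryRight := rfl
    simp [this]

theorem contractLast_apply (K : (B →ₗ[k] N) →ₗ[k] N) (n : ℕ)
    (φ : MultilinearMap k (fun _ : Fin (n + 1) => B) N) (b : Fin n → B) :
    contractLast K n φ b = K (φ.curryRight b) := rfl

/-- In curried form the right action is `homRight` minus ξ ↦ `R.flip` (ξ b). K intertwines
everything except the subtracted term, which survives as K ∘ `R.flip`. If K splits `R.flip`, this
is, up to sign, a contracting homotopy in positive degrees; it serves the Hochschild complex, the
bar complex and the rows of the double complex. -/
theorem contractLast_hochschildD {L R : B →ₗ[k] Module.End k N} (K : (B →ₗ[k] N) →ₗ[k] N)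
    (hL : ∀ b ξ, K (homLeft L b ξ) = L b (K ξ)) (hR : ∀ b ξ, K (homRight b ξ) = R b (K ξ)) (n : ℕ)
    (φ : MultilinearMap k (fun _ : Fin (n + 1) => B) N) :
    contractLast K (n + 1) (hochschildD L R (n + 1) φ) =
      hochschildD L R n (contractLast K n φ) +
        (-1 : k) ^ n • (K ∘ₗ R.flip).compMultilinearMap φ := by
  ext b
  rw [contractLast_apply, hochschildD_curryRight, hochschildD_apply, add_apply,
    hochschildD_apply]
  have e : ∀ ξ : B →ₗ[k] N, ∀ b : B, homShiftRight R b ξ = homRight b ξ - R.flip (ξ b) :=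
    fun ξ b => rfl
  have e3 : (Fin.snoc (fun i : Fin n => b i.castSucc) (b (Fin.last n)) : Fin (n + 1) → B) = b :=
    Fin.snoc_init_self b
  simp only [map_add, map_sum, map_smul, hL, hR, e, map_sub, MultilinearMap.curryRight_apply, e3,
    contractLast_apply, smul_sub, smul_apply]
  rw [pow_succ (-1 : k) n]
  simp only [mul_neg, mul_one, neg_smul, LinearMap.compMultilinearMap_apply, LinearMap.comp_apply]
  abel

end HochschildCalculus

/-! ### Connecting isomorphisms of degreewise split sequences -/

section CohomologyShift

variable {k : Type*} [CommRing k]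
  {C' C C'' : ℕ → Type*} [∀ n, AddCommGroup (C' n)] [∀ n, Module k (C' n)]
  [∀ n, AddCommGroup (C n)] [∀ n, Module k (C n)]
  [∀ n, AddCommGroup (C'' n)] [∀ n, Module k (C'' n)]
  {d' : ∀ n, C' n →ₗ[k] C' (n + 1)} {d : ∀ n, C n →ₗ[k] C (n + 1)}
  {d'' : ∀ n, C'' n →ₗ[k] C'' (n + 1)}

/-- A degreewise split short exact sequence of cochain complexes. -/
structure SplitExact (d' : ∀ n, C' n →ₗ[k] C' (n + 1)) (d : ∀ n, C n →ₗ[k] C (n + 1))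
    (d'' : ∀ n, C'' n →ₗ[k] C'' (n + 1)) (i : ∀ n, C' n →ₗ[k] C n) (p : ∀ n, C n →ₗ[k] C'' n)
    (r : ∀ n, C n →ₗ[k] C' n) (t : ∀ n, C'' n →ₗ[k] C n) : Prop where
  i_d : ∀ n x, d n (i n x) = i (n + 1) (d' n x)
  p_d : ∀ n x, d'' n (p n x) = p (n + 1) (d n x)
  p_i : ∀ n x, p n (i n x) = 0
  r_i : ∀ n x, r n (i n x) = x
  p_t : ∀ n x, p n (t n x) = x
  split : ∀ n x, i n (r n x) + t n (p n x) = x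

variable {i : ∀ n, C' n →ₗ[k] C n} {p : ∀ n, C n →ₗ[k] C'' n}
  {r : ∀ n, C n →ₗ[k] C' n} {t : ∀ n, C'' n →ₗ[k] C n}

namespace SplitExact

theorem i_r_of_p (h : SplitExact d' d d'' i p r t) {n : ℕ} {x : C n} (hx : p n x = 0) :
    i n (r n x) = x := by
  have := h.split n x
  rwa [hx, map_zero, add_zero] at this

theorem i_injective (h : SplitExact d' d d'' i p r t) (n : ℕ) : Function.Injective (i n) :=
  fun x y e => by rw [← h.r_i n x, e, h.r_i]

/-- The cochains that become cocycles in the quotient complex. -/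
def liftCocycle (_h : SplitExact d' d d'' i p r t) (n : ℕ) : Submodule k (C n) :=
  LinearMap.ker (d'' n ∘ₗ p n)

theorem d_mem (h : SplitExact d' d d'' i p r t) (hd : ∀ n x, d (n + 1) (d n x) = 0) {n : ℕ}
    (x : h.liftCocycle n) : d' (n + 1) (r (n + 1) (d n x)) = 0 := by
  have hx : p (n + 1) (d n x) = 0 := by rw [← h.p_d]; exact x.2
  apply h.i_injective
  rw [← h.i_d, h.i_r_of_p hx, hd, map_zero]

/-- The map that induces the connecting homomorphism. -/
def connecting (h : SplitExact d' d d'' i p r t) (hd : ∀ n x, d (n + 1) (d n x) = 0) (n : ℕ) :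
    h.liftCocycle n →ₗ[k] Cohomology d' (n + 1) :=
  Submodule.mkQ _ ∘ₗ ((r (n + 1) ∘ₗ d n) ∘ₗ (h.liftCocycle n).subtype).codRestrict _
    (fun x => h.d_mem hd x)

/-- The projection to the cocycles of the quotient complex, modulo coboundaries and images of
cocycles. -/
def project (h : SplitExact d' d d'' i p r t) (n : ℕ) :
    h.liftCocycle n →ₗ[k] LinearMap.ker (d'' n) ⧸
      (coboundaries d'' n ⊔ (LinearMap.ker (d n)).map (p n)).submoduleOf (LinearMap.ker (d'' n)) :=
  Submodule.mkQ _ ∘ₗ (p n ∘ₗ (h.liftCocycle n).subtype).codRestrict _ (fun x => x.2)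

theorem connecting_surjective (h : SplitExact d' d d'' i p r t)
    (hd : ∀ n x, d (n + 1) (d n x) = 0) (n : ℕ)
    (hv : ∀ x : C (n + 1), d (n + 1) x = 0 → ∃ y, d n y = x) :
    Function.Surjective (h.connecting hd n) := by
  intro z
  obtain ⟨⟨z, hz⟩, rfl⟩ := Submodule.mkQ_surjective _ z
  -- The image of z in the middle complex is a cocycle, hence a coboundary.
  obtain ⟨y, hy⟩ := hv (i (n + 1) z) (by rw [h.i_d, LinearMap.mem_ker.mp hz, map_zero])
  refine ⟨⟨y, ?_⟩, ?_⟩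
  · change d'' n (p n y) = 0
    rw [h.p_d, hy, h.p_i]
  · simp only [connecting, LinearMap.comp_apply]
    congr 1
    ext
    change r (n + 1) (d n y) = z
    rw [hy, h.r_i]

theorem project_surjective (h : SplitExact d' d d'' i p r t) (n : ℕ) :
    Function.Surjective (h.project n) := by
  intro z
  obtain ⟨⟨z, hz⟩, rfl⟩ := Submodule.mkQ_surjective _ z
  refine ⟨⟨t n z, ?_⟩, ?_⟩
  · change d'' n (p n (t n z)) = 0
    rw [h.p_t, LinearMap.mem_ker.mp hz]
  · simp only [project, LinearMap.comp_apply]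
    congr 1
    ext
    exact h.p_t n z

/-- Since dx lies in the image of i, r(dx) = d'y amounts to dx = d(iy). The condition is the same as
in `project_ker`, which is what matches the two quotients. -/
theorem connecting_ker (h : SplitExact d' d d'' i p r t)
    (hd : ∀ n x, d (n + 1) (d n x) = 0) (n : ℕ) (x : h.liftCocycle n) :
    h.connecting hd n x = 0 ↔ ∃ y, d n (x - i n y) = 0 := by
  have hx : p (n + 1) (d n x) = 0 := by rw [← h.p_d]; exact x.2
  simp only [connecting, LinearMap.comp_apply, Submodule.mkQ_apply, Submodule.Quotient.mk_eq_zero]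
  change (∃ y, d' n y = r (n + 1) (d n x)) ↔ _
  refine exists_congr fun y => ?_
  rw [map_sub, sub_eq_zero, h.i_d]
  constructor
  · intro e; rw [e, h.i_r_of_p hx]
  · intro e; rw [e, h.r_i]

theorem project_ker (h : SplitExact d' d d'' i p r t)
    (hd : ∀ n x, d (n + 1) (d n x) = 0) (n : ℕ) (x : h.liftCocycle n) :
    h.project n x = 0 ↔ ∃ y, d n (x - i n y) = 0 := by
  simp only [project, LinearMap.comp_apply, Submodule.mkQ_apply, Submodule.Quotient.mk_eq_zero]
  change p n x ∈ coboundaries d'' n ⊔ (LinearMap.ker (d n)).map (p n) ↔ _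
  -- A coboundary of the quotient lifts through t to a coboundary, in particular a cocycle, of the
  -- middle complex.
  have key : coboundaries d'' n ≤ (LinearMap.ker (d n)).map (p n) := by
    cases n with
    | zero => exact bot_le
    | succ n =>
      rintro _ ⟨z, rfl⟩
      exact ⟨d n (t n z), hd n _, by rw [← h.p_d, h.p_t]⟩
  rw [sup_of_le_right key]
  constructor
  · rintro ⟨z, hz, e⟩
    -- As p kills x - z, i r fixes it, and subtracting it from x leaves the cocycle z.
    refine ⟨r n (x - z), ?_⟩
    rw [h.i_r_of_p (by rw [map_sub, e, sub_self])]
    simpa using hz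
  · rintro ⟨y, hy⟩
    exact ⟨_, hy, by rw [map_sub, h.p_i, sub_zero]⟩

/-- The connecting isomorphism of a degreewise split short exact sequence whose middle term has no
cohomology in degree `n + 1`. -/
theorem nonempty_shift (h : SplitExact d' d d'' i p r t)
    (hd : ∀ n x, d (n + 1) (d n x) = 0) (n : ℕ)
    (hv : ∀ x : C (n + 1), d (n + 1) x = 0 → ∃ y, d n y = x) :
    Nonempty (Cohomology d' (n + 1) ≃ₗ[k] LinearMap.ker (d'' n) ⧸
      (coboundaries d'' n ⊔ (LinearMap.ker (d n)).map (p n)).submoduleOf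
        (LinearMap.ker (d'' n))) := by
  -- Two surjections from `liftCocycle` with the same kernel have isomorphic targets.
  have e : LinearMap.ker (h.connecting hd n) = LinearMap.ker (h.project n) := by
    ext x
    rw [LinearMap.mem_ker, LinearMap.mem_ker, h.connecting_ker, h.project_ker hd]
  exact ⟨((h.connecting hd n).quotKerEquivOfSurjective (h.connecting_surjective hd n hv)).symm ≪≫ₗ
    Submodule.quotEquivOfEq _ _ e ≪≫ₗ
    (h.project n).quotKerEquivOfSurjective (h.project_surjective n)⟩

theorem nonempty_shift_succ (h : SplitExact d' d d'' i p r t)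
    (hd : ∀ n x, d (n + 1) (d n x) = 0) (n : ℕ)
    (hv : ∀ n, ∀ x : C (n + 1), d (n + 1) x = 0 → ∃ y, d n y = x) :
    Nonempty (Cohomology d' (n + 2) ≃ₗ[k] Cohomology d'' (n + 1)) := by
  obtain ⟨e⟩ := h.nonempty_shift hd (n + 1) (hv (n + 1))
  refine ⟨e ≪≫ₗ Submodule.quotEquivOfEq _ _ ?_⟩
  congr 1
  -- In positive degree the cocycles of the middle complex are coboundaries, so their images add
  -- nothing.
  refine sup_of_le_left ?_
  rintro _ ⟨x, hx, rfl⟩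
  obtain ⟨y, rfl⟩ := hv n x hx
  exact ⟨p n y, h.p_d n y⟩

end SplitExact

end CohomologyShift

/-! ### Convolution invertibility through the Galois map -/

section Galois

variable {k B C V : Type*} [CommRing k] [Ring B] [Algebra k B] [AddCommGroup C] [Module k C]
  [Coalgebra k C] [AddCommGroup V] [Module k V]

theorem sum_coassoc (T : C →ₗ[k] C →ₗ[k] C →ₗ[k] V) {c : C} {ι : Type*} {κ μ : ι → Type*}
    (r : Coalgebra.Repr k c ι) (r₁ : ∀ i, Coalgebra.Repr k (r.left i) (κ i))
    (r₂ : ∀ i, Coalgebra.Repr k (r.right i) (μ i)) :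
    ∑ i ∈ r.index, ∑ j ∈ (r₁ i).index, T ((r₁ i).left j) ((r₁ i).right j) (r.right i) =
      ∑ i ∈ r.index, ∑ j ∈ (r₂ i).index, T (r.left i) ((r₂ i).left j) ((r₂ i).right j) := by
  have := congrArg (fun g => g c) (sweedler_coassoc T)
  simp only [sweedler_repr _ r, LinearMap.comp_apply, sweedler_repr _ (r₂ _),
    sweedler_repr _ (r₁ _), LinearMap.sum_apply] at this
  exact this.symm

/-- The map `b ⊗ c ↦ b u(c⁽¹⁾) ⊗ c⁽²⁾`. -/
def galois (u : C →ₗ[k] B) : B ⊗[k] C →ₗ[k] B ⊗[k] C :=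
  TensorProduct.lift <| LinearMap.mk₂ k
    (fun b c => sweedler ((TensorProduct.mk k B C) ∘ₗ LinearMap.mulLeft k b ∘ₗ u) c)
    (fun b b' c => by
      simp [sweedler_repr _ (Coalgebra.Repr.arbitrary k c), add_mul,
        Finset.sum_add_distrib])
    (fun x b c => by
      simp [sweedler_repr _ (Coalgebra.Repr.arbitrary k c), Finset.smul_sum,
        TensorProduct.smul_tmul'])
    (fun b c c' => by simp) (fun x b c => by simp)

theorem galois_tmul (u : C →ₗ[k] B) (b : B) {c : C} {ι : Type*} (r : Coalgebra.Repr k c ι) :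
    galois u (b ⊗ₜ c) = ∑ i ∈ r.index, (b * u (r.left i)) ⊗ₜ[k] r.right i := by
  simp [galois, sweedler_repr _ r]

theorem galois_mulLeft (u : C →ₗ[k] B) (b : B) (x : B ⊗[k] C) :
    galois u ((LinearMap.mulLeft k b).rTensor C x) =
      (LinearMap.mulLeft k b).rTensor C (galois u x) := by
  induction x with
  | zero => simp
  | add x y hx hy => simp [hx, hy]
  | tmul b' c =>
    simp [galois_tmul _ _ (Coalgebra.Repr.arbitrary k c), mul_assoc]

theorem galois_one : galois (1 : WithConv (C →ₗ[k] B)).ofConv = .id := by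
  ext b c
  have r := Coalgebra.Repr.arbitrary k c
  have h := congrArg (fun z => b ⊗ₜ[k] z) (Coalgebra.sum_counit_smul r)
  simp only [TensorProduct.tmul_sum] at h
  simp only [TensorProduct.AlgebraTensorModule.curry_apply, TensorProduct.curry_apply,
    LinearMap.restrictScalars_apply, LinearMap.id_apply]
  rw [galois_tmul _ _ r, ← h]
  refine Finset.sum_congr rfl fun i _ => ?_
  change (b * algebraMap k B (Coalgebra.counit (r.left i))) ⊗ₜ[k] _ = _
  rw [← Algebra.commutes, ← Algebra.smul_def, TensorProduct.smul_tmul]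

/-- By coassociativity the composite sends b ⊗ c to b v(c⁽¹⁾) u(c⁽²⁾) ⊗ c⁽³⁾: the factor applied
last stands rightmost, so the order is reversed. -/
theorem galois_galois (u v : WithConv (C →ₗ[k] B)) (x : B ⊗[k] C) :
    galois u.ofConv (galois v.ofConv x) = galois (v * u).ofConv x := by
  induction x with
  | zero => simp
  | add x y hx hy => simp [hx, hy]
  | tmul b c =>
    have r := Coalgebra.Repr.arbitrary k c
    have := sum_coassoc (((LinearMap.mul k B).compl₁₂ (LinearMap.mulLeft k b ∘ₗ v.ofConv)
      u.ofConv).compr₂ (TensorProduct.mk k B C)) r (fun i => Coalgebra.Repr.arbitrary k _)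
      (fun i => Coalgebra.Repr.arbitrary k _)
    simp only [LinearMap.compr₂_apply, LinearMap.compl₁₂_apply, LinearMap.comp_apply,
      LinearMap.mul_apply', LinearMap.mulLeft_apply, TensorProduct.mk_apply] at this
    rw [galois_tmul _ _ r, galois_tmul _ _ r, map_sum]
    simp only [galois_tmul _ _ (Coalgebra.Repr.arbitrary k (r.right _))]
    rw [← this]
    refine Finset.sum_congr rfl fun i _ => ?_
    have e := (Coalgebra.Repr.arbitrary k (r.left i)).convMul_apply v u
    change (v * u).ofConv (r.left i) = _ at e
    rw [e, Finset.mul_sum, TensorProduct.sum_tmul]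
    simp only [mul_assoc]

theorem galois_bijective {u : WithConv (C →ₗ[k] B)} (hu : IsUnit u) :
    Function.Bijective (galois u.ofConv) := by
  obtain ⟨u, rfl⟩ := hu
  refine Function.bijective_iff_has_inverse.mpr ⟨galois (↑u⁻¹ : WithConv (C →ₗ[k] B)).ofConv,
    fun x => ?_, fun x => ?_⟩
  · rw [galois_galois, u.mul_inv, galois_one, LinearMap.id_apply]
  · rw [galois_galois, u.inv_mul, galois_one, LinearMap.id_apply]

/-- The map `b ⊗ c ↦ ε(c) b`. -/
def counitRight : B ⊗[k] C →ₗ[k] B :=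
  (TensorProduct.rid k B).toLinearMap ∘ₗ (Coalgebra.counit (R := k) (A := C)).lTensor B

theorem counitRight_tmul (b : B) (c : C) :
    counitRight (b ⊗ₜ[k] c) = Coalgebra.counit (R := k) c • b := by simp [counitRight]

theorem counitRight_galois (u : C →ₗ[k] B) (c : C) : counitRight (galois u (1 ⊗ₜ c)) = u c := by
  have r := Coalgebra.Repr.arbitrary k c
  have h := congrArg (TensorProduct.rid k C) (Coalgebra.sum_tmul_counit_eq r)
  simp only [map_sum, TensorProduct.rid_tmul, one_smul] at h
  nth_rewrite 2 [← h]
  simp [galois_tmul _ _ r, counitRight_tmul]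

theorem counitRight_mulLeft (b : B) (x : B ⊗[k] C) :
    counitRight ((LinearMap.mulLeft k b).rTensor C x) = b * counitRight x := by
  induction x with
  | zero => simp
  | add x y hx hy => simp [hx, hy, mul_add]
  | tmul b' c => simp [counitRight_tmul]

/-- The inverse of the Galois map is left B-linear, hence determined by its values on 1 ⊗ c.
Applying id ⊗ ε to these values gives the convolution inverse. -/
theorem isUnit_of_galois_bijective {u : WithConv (C →ₗ[k] B)}
    (hu : Function.Bijective (galois u.ofConv)) : IsUnit u := by
  let e := LinearEquiv.ofBijective _ hu
  have he : ∀ x, galois u.ofConv (e.symm x) = x := e.apply_symm_apply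
  have he' : ∀ x, e.symm (galois u.ofConv x) = x := e.symm_apply_apply
  have hlin : ∀ b x, e.symm ((LinearMap.mulLeft k b).rTensor C x) =
      (LinearMap.mulLeft k b).rTensor C (e.symm x) := fun b x => by
    apply hu.injective
    rw [he, galois_mulLeft, he]
  let v : WithConv (C →ₗ[k] B) :=
    toConv (counitRight ∘ₗ e.symm.toLinearMap ∘ₗ TensorProduct.mk k B C 1)
  have hv : ∀ c, v.ofConv c = counitRight (e.symm (1 ⊗ₜ c)) := fun c => rfl
  -- Apply the inverse of the Galois map, then id ⊗ ε, to the image u(c⁽¹⁾) ⊗ c⁽²⁾ of 1 ⊗ c.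
  have huv : u * v = 1 := by
    ext c
    have r := Coalgebra.Repr.arbitrary k c
    have h := congrArg (fun z => counitRight (e.symm z)) (galois_tmul u.ofConv 1 r)
    simp only [he', map_sum, one_mul, counitRight_tmul] at h
    have h2 : ∀ b c, counitRight (e.symm (b ⊗ₜ c)) = b * v.ofConv c := fun b c => by
      rw [hv, ← counitRight_mulLeft, ← hlin]
      simp
    simp only [h2] at h
    refine (r.convMul_apply u v).trans (h.symm.trans ?_)
    simp [Algebra.smul_def]
  -- By u * v = 1 the Galois map of v is a left inverse of the bijection `galois u`, hence also a
  -- right inverse; id ⊗ ε then reads off v * u.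
  have hvu : v * u = 1 := by
    ext c
    have h1 : ∀ x, galois u.ofConv (galois v.ofConv x) = x := fun x => by
      have h2 : ∀ y, galois v.ofConv (galois u.ofConv y) = y := fun y => by
        rw [galois_galois, huv, galois_one, LinearMap.id_apply]
      nth_rewrite 1 [← he x]
      rw [h2, he]
    have h3 := counitRight_galois (v * u).ofConv c
    rw [← galois_galois, h1, counitRight_tmul] at h3
    change (v * u).ofConv c = _
    rw [← h3]
    simp [Algebra.smul_def]
  exact ⟨⟨u, v, huv, hvu⟩, rfl⟩

end Galois

/-! ### Invertibility of h ↦ 1 # h -/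

namespace CrossedProduct

variable {k A H : Type*} [CommRing k] [Ring A] [Algebra k A] [Ring H] [HopfAlgebra k H]
  (X : CrossedProduct k A H)

theorem cocycleMul_repr (f : H ⊗[k] H →ₗ[k] A) {l h : H} {ι κ : Type*} (r : Coalgebra.Repr k l ι)
    (s : Coalgebra.Repr k h κ) : cocycleMul f (l ⊗ₜ h) = ∑ i ∈ r.index, ∑ j ∈ s.index,
      f (r.left i ⊗ₜ s.left j) ⊗ₜ[k] (r.right i * s.right j) := by
  simp only [cocycleMul, LinearMap.comp_apply]
  rw [← (r.tmul s).eq, map_sum]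
  simp [Finset.sum_product]

theorem gamma_mul_gamma {l h : H} {ι κ : Type*} (r : Coalgebra.Repr k l ι)
    (s : Coalgebra.Repr k h κ) : X.gamma l * X.gamma h = ∑ i ∈ r.index, ∑ j ∈ s.index,
      X.inclA (X.f (r.left i ⊗ₜ s.left j)) * X.gamma (r.right i * s.right j) := by
  have e := congrArg (fun z => cocycleMul X.f (z ⊗ₜ h)) (Coalgebra.sum_counit_smul r)
  simp only [TensorProduct.sum_tmul, ← TensorProduct.smul_tmul', map_sum, map_smul] at e
  have e2 := crossedMul_tmul X.act X.f 1 1 l h r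
  simp only [X.act_one, one_mul, algebraMap_smul] at e2
  refine (e2.trans e).trans ((cocycleMul_repr X.f r s).trans ?_)
  exact Finset.sum_congr rfl fun i _ => Finset.sum_congr rfl fun j _ =>
    (X.inclA_mul_gamma _ _).symm

/-- The isomorphism `A ⊗ (H ⊗ H) ≅ E ⊗ H`. -/
def assocE : A ⊗[k] (H ⊗[k] H) ≃ₗ[k] X.E ⊗[k] H := (TensorProduct.assoc k A H H).symm

theorem assocE_tmul (a : A) (l h : H) :
    X.assocE (a ⊗ₜ (l ⊗ₜ h)) = (X.inclA a * X.gamma l) ⊗ₜ[k] h := by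
  rw [inclA_mul_gamma]; rfl

/-- Both sides send a ⊗ l ⊗ h to a f(l⁽¹⁾, h⁽¹⁾) γ(l⁽²⁾h⁽²⁾) ⊗ h⁽³⁾. On the right the cocycle is
produced by the Galois map of f, and the product l⁽²⁾h⁽²⁾ by that of the identity of H. -/
theorem galois_gamma (x : A ⊗[k] (H ⊗[k] H)) :
    galois X.gamma (X.assocE x) =
      X.assocE ((galois (LinearMap.id : H →ₗ[k] H)).lTensor A (galois X.f x)) := by
  induction x with
  | zero => simp
  | add x y hx hy => simp [hx, hy]
  | tmul a x =>
    induction x with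
    | zero => simp
    | add x y hx hy => simp only [TensorProduct.tmul_add, map_add, hx, hy]
    | tmul l h =>
      have r := Coalgebra.Repr.arbitrary k l
      have s := Coalgebra.Repr.arbitrary k h
      let s₁ := fun j => Coalgebra.Repr.arbitrary k (s.left j)
      let s₂ := fun j => Coalgebra.Repr.arbitrary k (s.right j)
      have e1 : galois X.gamma (X.assocE (a ⊗ₜ (l ⊗ₜ h))) =
          ∑ i ∈ r.index, ∑ j ∈ s.index, ∑ t ∈ (s₁ j).index,
            (X.inclA a * X.inclA (X.f (r.left i ⊗ₜ (s₁ j).left t)) *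
              X.gamma (r.right i * (s₁ j).right t)) ⊗ₜ[k] s.right j := by
        rw [assocE_tmul, galois_tmul _ _ s, Finset.sum_comm]
        refine Finset.sum_congr rfl fun j _ => ?_
        rw [mul_assoc, X.gamma_mul_gamma r (s₁ j)]
        simp only [Finset.mul_sum, TensorProduct.sum_tmul, mul_assoc]
      have e2 : X.assocE ((galois (LinearMap.id : H →ₗ[k] H)).lTensor A
          (galois X.f (a ⊗ₜ (l ⊗ₜ h)))) =
          ∑ i ∈ r.index, ∑ j ∈ s.index, ∑ t ∈ (s₂ j).index,
            (X.inclA a * X.inclA (X.f (r.left i ⊗ₜ s.left j)) *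
              X.gamma (r.right i * (s₂ j).left t)) ⊗ₜ[k] (s₂ j).right t := by
        rw [galois_tmul _ _ (r.tmul s)]
        change X.assocE ((galois (LinearMap.id : H →ₗ[k] H)).lTensor A (∑ x ∈ r.index ×ˢ s.index, (a * X.f (r.left x.1 ⊗ₜ s.left x.2)) ⊗ₜ[k]
          (r.right x.1 ⊗ₜ[k] s.right x.2))) = _
        rw [Finset.sum_product, map_sum, map_sum]
        refine Finset.sum_congr rfl fun i _ => ?_
        rw [map_sum, map_sum]
        refine Finset.sum_congr rfl fun j _ => ?_
        rw [LinearMap.lTensor_tmul, galois_tmul _ _ (s₂ j), TensorProduct.tmul_sum, map_sum]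
        refine Finset.sum_congr rfl fun t _ => ?_
        rw [assocE_tmul, inclA_mul, LinearMap.id_apply]
      rw [e1, e2]
      refine Finset.sum_congr rfl fun i _ => ?_
      exact sum_coassoc (((LinearMap.mul k X.E).compl₁₂ (LinearMap.mulLeft k (X.inclA a) ∘ₗ X.inclA ∘ₗ
        X.f ∘ₗ TensorProduct.mk k H H (r.left i)) (X.gamma ∘ₗ LinearMap.mulLeft k (r.right i))).compr₂
        (TensorProduct.mk k X.E H)) s s₁ s₂

theorem isUnit_gamma (hinv : IsUnit (toConv X.f)) : IsUnit (toConv X.gamma) := by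
  apply isUnit_of_galois_bijective
  have h1 : Function.Bijective (galois X.f) :=
    galois_bijective (k := k) (B := A) (C := H ⊗[k] H) (u := toConv X.f) hinv
  have hid : IsUnit (toConv (LinearMap.id : H →ₗ[k] H)) :=
    ⟨⟨toConv LinearMap.id, toConv (HopfAlgebra.antipode k), LinearMap.id_mul_antipode,
      LinearMap.antipode_mul_id⟩, rfl⟩
  have h2 : Function.Bijective (galois (LinearMap.id : H →ₗ[k] H)) := galois_bijective hid
  have h3 : Function.Bijective ((galois (LinearMap.id : H →ₗ[k] H)).lTensor A) :=
    ((LinearEquiv.ofBijective _ h2).lTensor A).bijective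
  have h4 : galois X.gamma = X.assocE.toLinearMap ∘ₗ
      (galois (LinearMap.id : H →ₗ[k] H)).lTensor A ∘ₗ galois X.f ∘ₗ X.assocE.symm.toLinearMap := by
    refine LinearMap.ext fun x => ?_
    have := X.galois_gamma (X.assocE.symm x)
    rw [LinearEquiv.apply_symm_apply] at this
    exact this
  change Function.Bijective (galois X.gamma)
  rw [h4]
  exact X.assocE.bijective.comp (h3.comp (h1.comp X.assocE.symm.bijective))

end CrossedProduct

/-! ### The diagonal action commutes with the coboundary -/

section TwistComplex

variable {k A H M : Type*} [CommRing k] [Ring A] [Algebra k A] [AddCommGroup H] [Module k H]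
  [Coalgebra k H] [AddCommGroup M] [Module k M]
  {act : H →ₗ[k] A →ₗ[k] A} {P G : H →ₗ[k] Module.End k M} {L R : A →ₗ[k] Module.End k M}

/-- The first term `a₀ φ(a₁, …, aᵣ)` of the Hochschild coboundary. -/
def leftTerm (L : A →ₗ[k] Module.End k M) {r : ℕ} (φ : MultilinearMap k (fun _ : Fin r => A) M) :
    MultilinearMap k (fun _ : Fin (r + 1) => A) M :=
  LinearMap.uncurryLeft (M := fun _ : Fin (r + 1) => A) ((postComp r).flip φ ∘ₗ L)

theorem leftTerm_apply {r : ℕ} (φ : MultilinearMap k (fun _ : Fin r => A) M)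
    (a : Fin (r + 1) → A) : leftTerm L φ a = L (a 0) (φ fun i => a i.succ) := rfl

theorem leftTerm_curryLeft {r : ℕ} (φ : MultilinearMap k (fun _ : Fin r => A) M) (x : A) :
    (leftTerm L φ).curryLeft x = postComp r (L x) φ := by
  ext a
  rw [MultilinearMap.curryLeft_apply, leftTerm_apply]
  simp

/-- The last term `φ(a₀, …, aᵣ₋₁) aᵣ` of the Hochschild coboundary. -/
def rightTerm (R : A →ₗ[k] Module.End k M) {r : ℕ} (φ : MultilinearMap k (fun _ : Fin r => A) M) :
    MultilinearMap k (fun _ : Fin (r + 1) => A) M :=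
  MultilinearMap.uncurryRight (M := fun _ : Fin (r + 1) => A) (R.flip.compMultilinearMap φ)

theorem rightTerm_apply {r : ℕ} (φ : MultilinearMap k (fun _ : Fin r => A) M)
    (a : Fin (r + 1) → A) :
    rightTerm R φ a = R (a (Fin.last r)) (φ fun i => a i.castSucc) := rfl

theorem rightTerm_curryLeft {r : ℕ} (φ : MultilinearMap k (fun _ : Fin (r + 1) => A) M) (x : A) :
    (rightTerm R φ).curryLeft x = rightTerm R (φ.curryLeft x) := by
  ext a
  rw [MultilinearMap.curryLeft_apply, rightTerm_apply, rightTerm_apply,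
    MultilinearMap.curryLeft_apply]
  congr 2
  ext t
  refine Fin.cases ?_ (fun t => ?_) t <;> simp

theorem hochschildD_eq_terms {r : ℕ} (φ : MultilinearMap k (fun _ : Fin r => A) M) :
    hochschildD L R r φ = leftTerm L φ + ∑ j : Fin r, (-1 : k) ^ ((j : ℕ) + 1) • contractMap j φ
      + (-1 : k) ^ (r + 1) • rightTerm R φ := rfl

theorem contractMap_apply {r : ℕ} (j : Fin r) (φ : MultilinearMap k (fun _ : Fin r => A) M)
    (a : Fin (r + 1) → A) : contractMap j φ a = φ (Fin.contractNth j.castSucc (· * ·) a) := rfl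

theorem tail_contractNth_succ {α : Type*} {n : ℕ} (op : α → α → α) (j : Fin (n + 1))
    (b : Fin (n + 2) → α) :
    Fin.tail (Fin.contractNth j.succ op b) = Fin.contractNth j op (Fin.tail b) := by
  ext t
  simp only [Fin.tail, Fin.contractNth, Fin.val_succ, Fin.succ_castSucc]
  simp

theorem contractMap_zero_curryLeft {r : ℕ} (φ : MultilinearMap k (fun _ : Fin (r + 1) => A) M)
    (x : A) : (contractMap 0 φ).curryLeft x = mulFirst φ x := by
  ext a
  rw [MultilinearMap.curryLeft_apply, contractMap_apply]
  change _ = φ (Fin.cons (x * a 0) (Fin.tail a))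
  congr 1
  ext t
  refine Fin.cases ?_ (fun t => ?_) t
  · simp [Fin.contractNth]
  · simp [Fin.contractNth, Fin.tail]

theorem contractMap_succ_curryLeft {r : ℕ} (j : Fin r)
    (φ : MultilinearMap k (fun _ : Fin (r + 1) => A) M) (x : A) :
    (contractMap j.succ φ).curryLeft x = contractMap j (φ.curryLeft x) := by
  ext a
  rw [MultilinearMap.curryLeft_apply, contractMap_apply, contractMap_apply,
    MultilinearMap.curryLeft_apply]
  congr 1
  rw [← Fin.succ_castSucc, ← Fin.cons_self_tail (Fin.contractNth _ _ _), tail_contractNth_succ,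
    Fin.tail_cons]
  congr 1

theorem twist_leftTerm (hGL : ∀ h a m, G h (L a m) = L a (G h m)) {r : ℕ}
    (φ : MultilinearMap k (fun _ : Fin r => A) M) (h : H) (a : Fin (r + 1) → A) :
    twist act G (r + 1) (leftTerm L φ) h a =
      sweedler ((L ∘ₗ act.flip (a 0)).compl₂ (evalAt (Fin.tail a) ∘ₗ twist act G r φ)) h := by
  rw [twist_succ]
  congr 2
  ext h1 h2
  change twist act G r ((leftTerm L φ).curryLeft (act h1 (a 0))) h2 (Fin.tail a) =
    L (act h1 (a 0)) (twist act G r φ h2 (Fin.tail a))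
  rw [leftTerm_curryLeft, twist_postComp _ fun h m => hGL h _ m]

/-- The weak action is multiplicative, (ab)^h = a^{h⁽¹⁾}b^{h⁽²⁾}, so neighbouring arguments may be
multiplied before or after acting. Currying peels off the arguments in front of position j. -/
theorem twist_contractMap
    (hact : ∀ a b : A, toConv (act.flip (a * b)) = toConv (act.flip a) * toConv (act.flip b))
    {r : ℕ} (j : Fin r) (φ : MultilinearMap k (fun _ : Fin r => A) M) (h : H)
    (a : Fin (r + 1) → A) :
    twist act G (r + 1) (contractMap j φ) h a =
      twist act G r φ h (Fin.contractNth j.castSucc (· * ·) a) := by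
  induction r generalizing h with
  | zero => exact j.elim0
  | succ r ih =>
    rw [twist_succ]
    refine Fin.cases ?_ (fun j => ?_) j
    · rw [twist_mul_first hact φ h (Fin.tail a) _ (a 0)]
      · congr 2
        ext h1 h2
        change twist act G (r + 1) ((contractMap 0 φ).curryLeft (act h1 (a 0))) h2 (Fin.tail a) = _
        rw [contractMap_zero_curryLeft]
        rfl
      · simp [Fin.contractNth, Fin.tail]
      · ext t
        simp [Fin.contractNth, Fin.tail]
    · rw [twist_succ, ← Fin.succ_castSucc, tail_contractNth_succ]
      have e : Fin.contractNth j.castSucc.succ (· * ·) a 0 = a 0 := by simp [Fin.contractNth]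
      rw [e]
      congr 2
      ext h1 h2
      change twist act G (r + 1) ((contractMap j.succ φ).curryLeft (act h1 (a 0))) h2 (Fin.tail a) =
        twist act G r (φ.curryLeft (act h1 (a 0))) h2 _
      rw [contractMap_succ_curryLeft, ih]

/-- `hGR` says (m a^{h⁽¹⁾}) G(h⁽²⁾) = (m G(h)) a; for E-bimodules this is γ(h)a = a^{h⁽¹⁾}γ(h⁽²⁾).
It is needed only at the last argument, which the induction reaches by currying. -/
theorem twist_rightTerm
    (hGR : ∀ s, sweedler ((LinearMap.mul k (Module.End k M)).flip.compl₁₂ (R ∘ₗ act.flip s) G) =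
      LinearMap.mulLeft k (R s) ∘ₗ G)
    {r : ℕ} (φ : MultilinearMap k (fun _ : Fin r => A) M) (h : H) (a : Fin (r + 1) → A) :
    twist act G (r + 1) (rightTerm R φ) h a =
      R (a (Fin.last r)) (twist act G r φ h fun i => a i.castSucc) := by
  induction r generalizing h with
  | zero =>
    rw [twist_succ, twist_zero]
    have e := congrArg (fun g => g h (φ fun i => a i.castSucc)) (hGR (a 0))
    simp only [sweedler_repr _ (Coalgebra.Repr.arbitrary k h), LinearMap.sum_apply] at e ⊢
    refine Eq.trans (Finset.sum_congr rfl fun i _ => ?_) e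
    change G _ ((rightTerm R φ).curryLeft _ _) = G _ (R (act _ (a 0)) (φ _))
    rw [MultilinearMap.curryLeft_apply, rightTerm_apply]
    congr 2
    congr 1
    exact Subsingleton.elim _ _
  | succ r ih =>
    rw [twist_succ, twist_succ, ← LinearMap.comp_apply, comp_sweedler]
    congr 2
    ext h1 h2
    change twist act G (r + 1) ((rightTerm R φ).curryLeft (act h1 (a 0))) h2 (Fin.tail a) =
      R _ (twist act G r (φ.curryLeft (act h1 (a 0))) h2 _)
    rw [rightTerm_curryLeft, ih]
    rfl

/-- The diagonal action commutes with the Hochschild coboundary. -/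
theorem diagonalAct_hochschildD
    (hact : ∀ a b : A, toConv (act.flip (a * b)) = toConv (act.flip a) * toConv (act.flip b))
    (hPL : ∀ s, sweedler ((LinearMap.mul k (Module.End k M)).compl₁₂ P (L ∘ₗ act.flip s)) =
      LinearMap.mulLeft k (L s) ∘ₗ P)
    (hGR : ∀ s, sweedler ((LinearMap.mul k (Module.End k M)).flip.compl₁₂ (R ∘ₗ act.flip s) G) =
      LinearMap.mulLeft k (R s) ∘ₗ G)
    (hGL : ∀ h a m, G h (L a m) = L a (G h m)) (hPR : ∀ h a m, P h (R a m) = R a (P h m))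
    {r : ℕ} (φ : MultilinearMap k (fun _ : Fin r => A) M) (h : H) :
    diagonalAct act P G (r + 1) h (hochschildD L R r φ) =
      hochschildD L R r (diagonalAct act P G r h φ) := by
  -- Here `hPL` enters: P(h⁽¹⁾) followed inside by a₀^{h⁽²⁾} is a₀ P(h), which for E-bimodules is
  -- γ⁻¹(h⁽¹⁾)a^{h⁽²⁾} = aγ⁻¹(h).
  have h1 : diagonalAct act P G (r + 1) h (leftTerm L φ) =
      leftTerm L (diagonalAct act P G r h φ) := by
    ext a
    rw [leftTerm_apply, diagonalAct_apply, diagonalAct_apply, ← LinearMap.comp_apply,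
      comp_sweedler]
    have e : evalAt a ∘ₗ twist act G (r + 1) (leftTerm L φ) =
        sweedler ((L ∘ₗ act.flip (a 0)).compl₂ (evalAt (Fin.tail a) ∘ₗ twist act G r φ)) := by
      ext h1
      exact twist_leftTerm hGL φ h1 a
    have e2 : P.compl₂ (sweedler ((L ∘ₗ act.flip (a 0)).compl₂
          (evalAt (Fin.tail a) ∘ₗ twist act G r φ))) =
        sweedler ∘ₗ (((LinearMap.mul k (Module.End k M)).compl₁₂ P (L ∘ₗ act.flip (a 0))).compr₂
          (LinearMap.lcomp k M (evalAt (Fin.tail a) ∘ₗ twist act G r φ))) := by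
      ext h1 h2
      simp [sweedler_repr _ (Coalgebra.Repr.arbitrary k h2)]
    rw [e, e2, sweedler_coassoc, ← comp_sweedler, hPL]
    congr 2
  have h2 : ∀ j, diagonalAct act P G (r + 1) h (contractMap j φ) =
      contractMap j (diagonalAct act P G r h φ) := by
    intro j
    ext a
    rw [contractMap_apply, diagonalAct_apply, diagonalAct_apply]
    congr 3
    ext h1
    exact twist_contractMap hact j φ h1 a
  have h3 : diagonalAct act P G (r + 1) h (rightTerm R φ) =
      rightTerm R (diagonalAct act P G r h φ) := by
    ext a
    rw [rightTerm_apply, diagonalAct_apply, diagonalAct_apply, ← LinearMap.comp_apply,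
      comp_sweedler]
    congr 2
    ext h1 h2
    change P h1 (twist act G (r + 1) _ h2 a) = R _ (P h1 (twist act G r φ h2 _))
    rw [twist_rightTerm hGR, hPR]
  simp only [hochschildD_eq_terms, map_add, map_sum, map_smul, h1, h2, h3]

/-- A map that commutes with `P` and `G` commutes with the diagonal action. -/
theorem twist_compMultilinearMap {N : Type*} [AddCommGroup N] [Module k N]
    {G' : H →ₗ[k] Module.End k N} (g : M →ₗ[k] N) (hG : ∀ h m, g (G h m) = G' h (g m)) {r : ℕ}
    (φ : MultilinearMap k (fun _ : Fin r => A) M) (h : H) (a : Fin r → A) :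
    twist act G' r (g.compMultilinearMap φ) h a = g (twist act G r φ h a) := by
  induction r generalizing h with
  | zero => simp [twist_zero, hG]
  | succ r ih =>
    rw [twist_succ, twist_succ, ← LinearMap.comp_apply, comp_sweedler]
    congr 2
    ext h1 h2
    exact ih (φ.curryLeft (act h1 (a 0))) h2 (Fin.tail a)

theorem diagonalAct_compMultilinearMap {N : Type*} [AddCommGroup N] [Module k N]
    {P' G' : H →ₗ[k] Module.End k N} (g : M →ₗ[k] N) (hP : ∀ h m, g (P h m) = P' h (g m))
    (hG : ∀ h m, g (G h m) = G' h (g m)) {r : ℕ}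
    (φ : MultilinearMap k (fun _ : Fin r => A) M) (h : H) :
    diagonalAct act P' G' r h (g.compMultilinearMap φ) =
      g.compMultilinearMap (diagonalAct act P G r h φ) := by
  ext a
  rw [LinearMap.compMultilinearMap_apply, diagonalAct_apply, diagonalAct_apply,
    ← LinearMap.comp_apply, comp_sweedler]
  congr 2
  ext h1 h2
  change P' h1 (twist act G' r _ h2 a) = g (P h1 (twist act G r φ h2 a))
  rw [twist_compMultilinearMap g hG, hP]

end TwistComplex

/-! ### Moving a cocycle through the arguments of a cochain -/

section TwistChange

variable {k A C M : Type*} [CommRing k] [Ring A] [Algebra k A] [AddCommGroup C] [Module k C]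
  [Coalgebra k C] [AddCommGroup M] [Module k M]

/-- Multiplication of the first argument by `s` from the left, or of the value by `s` from the
right if there is no argument. -/
def insertLeft (R : A →ₗ[k] Module.End k M) : ∀ r : ℕ,
    MultilinearMap k (fun _ : Fin r => A) M → A →ₗ[k] MultilinearMap k (fun _ : Fin r => A) M
  | 0, φ => (postComp 0).flip φ ∘ₗ R
  | _ + 1, φ => mulFirst φ

/-- `φ` is balanced over `T` between consecutive arguments and right linear over `T`. -/
def IsBalanced (R : A →ₗ[k] Module.End k M) (T : Set A) : ∀ r : ℕ,
    MultilinearMap k (fun _ : Fin r => A) M → Prop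
  | 0, _ => True
  | r + 1, φ => ∀ x, IsBalanced R T r (φ.curryLeft x) ∧
      ∀ s ∈ T, insertLeft R r (φ.curryLeft x) s = φ.curryLeft (x * s)

/-- By `hG`, G₁ leaves a factor F to the right of the value, in front of G₂. Right linearity over T
puts it behind the last argument, `hF` in the form α(a)F = Fβ(a) takes it past that argument while
replacing α by β, and balancedness hands it to the previous one. It ends up in front of the first
argument, where `insertLeft` records it. -/
theorem twist_change {R : A →ₗ[k] Module.End k M} {T : Set A} {α β : C →ₗ[k] A →ₗ[k] A}
    {G₁ G₂ : C →ₗ[k] Module.End k M} {F : C →ₗ[k] A} (hFT : ∀ c, F c ∈ T)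
    (hF : ∀ a, sweedler ((LinearMap.mul k A).compl₁₂ (α.flip a) F) =
      sweedler ((LinearMap.mul k A).compl₁₂ F (β.flip a)))
    (hG : G₁ = sweedler ((LinearMap.mul k (Module.End k M)).flip.compl₁₂ (R ∘ₗ F) G₂))
    {r : ℕ} (φ : MultilinearMap k (fun _ : Fin r => A) M) (hφ : IsBalanced R T r φ) (c : C)
    (a : Fin r → A) :
    twist α G₁ r φ c a =
      sweedler ((twist β G₂ r).compr₂ (evalAt a) ∘ₗ insertLeft R r φ ∘ₗ F) c := by
  induction r generalizing c with
  | zero =>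
    rw [twist_zero, hG]
    simp only [sweedler_repr _ (Coalgebra.Repr.arbitrary k c), LinearMap.sum_apply]
    rfl
  | succ r ih =>
    rw [twist_succ]
    -- By induction F has already reached the second argument (or the value); balancedness moves it
    -- behind the first.
    have e : ((twist α G₁ r ∘ₗ φ.curryLeft).compr₂ (evalAt (Fin.tail a))) ∘ₗ α.flip (a 0) =
        sweedler ∘ₗ (((LinearMap.mul k A).compl₁₂ (α.flip (a 0)) F).compr₂
          ((twist β G₂ r ∘ₗ φ.curryLeft).compr₂ (evalAt (Fin.tail a)))) := by
      ext c1 c2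
      change twist α G₁ r (φ.curryLeft (α c1 (a 0))) c2 (Fin.tail a) = sweedler _ c2
      rw [ih _ (hφ _).1]
      congr 2
      ext c3 c4
      change twist β G₂ r (insertLeft R r (φ.curryLeft (α c1 (a 0))) (F c3)) c4 _ =
        twist β G₂ r (φ.curryLeft (α c1 (a 0) * F c3)) c4 _
      rw [(hφ _).2 _ (hFT c3)]
    have e2 : (twist β G₂ (r + 1)).compr₂ (evalAt a) ∘ₗ insertLeft R (r + 1) φ ∘ₗ F =
        sweedler ∘ₗ (((LinearMap.mul k A).compl₁₂ F (β.flip (a 0))).compr₂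
          ((twist β G₂ r ∘ₗ φ.curryLeft).compr₂ (evalAt (Fin.tail a)))) := by
      ext c1 c2
      change twist β G₂ (r + 1) (mulFirst φ (F c1)) c2 a = _
      rw [twist_succ]
      congr 2
    rw [e, e2, sweedler_coassoc, sweedler_coassoc, ← comp_sweedler, ← comp_sweedler, hF]

end TwistChange

/-! ### Associativity and unit law of the right action -/

section TwistMul

variable {k A H M : Type*} [CommRing k] [Ring A] [Algebra k A] [Ring H] [HopfAlgebra k H]
  [AddCommGroup M] [Module k M] (act : H →ₗ[k] A →ₗ[k] A) (G : H →ₗ[k] Module.End k M)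

/-- `h ⊗ l ↦ G(h) G(l)` -/
def pairing {N : Type*} [AddCommGroup N] [Module k N] (G : H →ₗ[k] Module.End k N) :
    H ⊗[k] H →ₗ[k] Module.End k N :=
  TensorProduct.lift ((LinearMap.mul k (Module.End k N)).compl₁₂ G G)

/-- `h ⊗ l ↦ G(l) G(h)` -/
def pairingRev {N : Type*} [AddCommGroup N] [Module k N] (G : H →ₗ[k] Module.End k N) :
    H ⊗[k] H →ₗ[k] Module.End k N :=
  TensorProduct.lift ((LinearMap.mul k (Module.End k N)).flip.compl₁₂ G G)

theorem sweedler_tmul {V : Type*} [AddCommGroup V] [Module k V]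
    (β : H ⊗[k] H →ₗ[k] H ⊗[k] H →ₗ[k] V) {h l : H} {ι κ : Type*} (r : Coalgebra.Repr k h ι)
    (s : Coalgebra.Repr k l κ) :
    sweedler β (h ⊗ₜ l) = ∑ i ∈ r.index, ∑ j ∈ s.index,
      β (r.left i ⊗ₜ s.left j) (r.right i ⊗ₜ s.right j) := by
  rw [sweedler_repr _ (r.tmul s)]
  exact Finset.sum_product _ _ _

theorem sweedler_mul {V : Type*} [AddCommGroup V] [Module k V]
    (β : H →ₗ[k] H →ₗ[k] V) {h l : H} {ι κ : Type*} (r : Coalgebra.Repr k h ι)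
    (s : Coalgebra.Repr k l κ) :
    sweedler β (h * l) = ∑ i ∈ r.index, ∑ j ∈ s.index,
      β (r.left i * s.left j) (r.right i * s.right j) := by
  rw [sweedler_apply, Bialgebra.comul_mul, ← r.eq, ← s.eq]
  simp [Finset.sum_mul_sum]

theorem twist_succ_curryLeft {r : ℕ} (φ : MultilinearMap k (fun _ : Fin (r + 1) => A) M) {h : H}
    (x : A) {ι : Type*} (s : Coalgebra.Repr k h ι) :
    (twist act G (r + 1) φ h).curryLeft x =
      ∑ i ∈ s.index, twist act G r (φ.curryLeft (act (s.left i) x)) (s.right i) := by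
  ext a
  rw [MultilinearMap.curryLeft_apply, twist_succ, sweedler_repr _ s]
  simp [evalAt]

/-- An iterated twist is one twist over the coalgebra H ⊗ H, acting on arguments by a ↦ (a^l)^h. The
value receives G(h) before G(l), hence `pairingRev` beside `pairing`. -/
theorem twist_twist {r : ℕ} (φ : MultilinearMap k (fun _ : Fin r => A) M) (h l : H)
    (a : Fin r → A) :
    twist act G r (twist act G r φ h) l a = twist (pairing act) (pairingRev G) r φ (h ⊗ₜ l) a := by
  induction r generalizing h l with
  | zero => rfl
  | succ r ih =>
    have s := Coalgebra.Repr.arbitrary k h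
    have t := Coalgebra.Repr.arbitrary k l
    rw [twist_succ, twist_succ, sweedler_tmul _ s t, sweedler_repr _ t, Finset.sum_comm]
    refine Finset.sum_congr rfl fun j _ => ?_
    change twist act G r ((twist act G (r + 1) φ h).curryLeft (act (t.left j) (a 0))) (t.right j)
      (Fin.tail a) = _
    rw [twist_succ_curryLeft _ _ _ _ s, map_sum, LinearMap.sum_apply, sum_apply]
    exact Finset.sum_congr rfl fun i _ => ih _ _ _ _

/-- The multiplication H ⊗ H → H is compatible with comultiplication, so twisting by hl can also be
carried out over H ⊗ H. -/
theorem twist_mul {r : ℕ} (φ : MultilinearMap k (fun _ : Fin r => A) M) (h l : H)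
    (a : Fin r → A) :
    twist (act ∘ₗ LinearMap.mul' k H) (G ∘ₗ LinearMap.mul' k H) r φ (h ⊗ₜ l) a =
      twist act G r φ (h * l) a := by
  induction r generalizing h l with
  | zero => rfl
  | succ r ih =>
    have s := Coalgebra.Repr.arbitrary k h
    have t := Coalgebra.Repr.arbitrary k l
    rw [twist_succ, twist_succ, sweedler_tmul _ s t, sweedler_mul _ s t]
    exact Finset.sum_congr rfl fun i _ => Finset.sum_congr rfl fun j _ => ih _ _ _ _

variable {act G} {P : H →ₗ[k] Module.End k M}

/-- Over H ⊗ H the two sides differ only by the cocycle: `hG` produces f on the right of φ,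
`twist_change` with `hf` carries it to the left, `hφL` releases it as a left factor, and `hP`
absorbs it into P(hl). -/
theorem diagonalAct_mul {L R : A →ₗ[k] Module.End k M} {T : Set A} {f : H ⊗[k] H →ₗ[k] A}
    (hfT : ∀ c, f c ∈ T)
    (hf : ∀ a, sweedler ((LinearMap.mul k A).compl₁₂ ((pairing act).flip a) f) =
      sweedler ((LinearMap.mul k A).compl₁₂ f ((act ∘ₗ LinearMap.mul' k H).flip a)))
    (hG : pairingRev G = sweedler ((LinearMap.mul k (Module.End k M)).flip.compl₁₂ (R ∘ₗ f)
      (G ∘ₗ LinearMap.mul' k H)))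
    (hP : sweedler ((LinearMap.mul k (Module.End k M)).compl₁₂ (pairingRev P) (L ∘ₗ f)) =
      P ∘ₗ LinearMap.mul' k H)
    (hGL : ∀ h a m, G h (L a m) = L a (G h m)) (hGP : ∀ h l m, G h (P l m) = P l (G h m))
    {r : ℕ} (φ : MultilinearMap k (fun _ : Fin r => A) M) (hφ : IsBalanced R T r φ)
    (hφL : ∀ s ∈ T, insertLeft R r φ s = postComp r (L s) φ) (h l : H) :
    diagonalAct act P G r (h * l) φ = diagonalAct act P G r l (diagonalAct act P G r h φ) := by
  ext a
  have s := Coalgebra.Repr.arbitrary k h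
  have t := Coalgebra.Repr.arbitrary k l
  have e1 : diagonalAct act P G r h φ =
      ∑ i ∈ s.index, postComp r (P (s.left i)) (twist act G r φ (s.right i)) := by
    ext b
    rw [diagonalAct_apply, sweedler_repr _ s, sum_apply]
    rfl
  have e2 : diagonalAct act P G r l (diagonalAct act P G r h φ) a =
      sweedler ((pairingRev P).compl₂ (evalAt a ∘ₗ twist (pairing act) (pairingRev G) r φ))
        (h ⊗ₜ l) := by
    rw [e1, map_sum, sum_apply, sweedler_tmul _ s t]
    refine Finset.sum_congr rfl fun i _ => ?_
    rw [diagonalAct_apply, sweedler_repr _ t]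
    refine Finset.sum_congr rfl fun j _ => ?_
    change P _ (twist act G r (postComp r _ _) _ a) = P _ (P _ (twist _ _ r φ _ a))
    rw [twist_postComp _ fun x m => hGP x _ m, twist_twist]
  have e3 : evalAt a ∘ₗ twist (pairing act) (pairingRev G) r φ =
      sweedler ((L ∘ₗ f).compl₂ (evalAt a ∘ₗ
        twist (act ∘ₗ LinearMap.mul' k H) (G ∘ₗ LinearMap.mul' k H) r φ)) := by
    refine LinearMap.ext fun c => ?_
    refine (twist_change hfT hf hG φ hφ c a).trans ?_
    congr 2
    refine LinearMap.ext fun c1 => LinearMap.ext fun c2 => ?_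
    change twist _ _ r (insertLeft R r φ (f c1)) c2 a = L (f c1) (twist _ _ r φ c2 a)
    -- The value of f leaves the first argument on the left; in arity 0 this is centrality over T.
    rw [hφL _ (hfT c1), twist_postComp]
    exact fun x m => hGL _ _ _
  have e4 : (pairingRev P).compl₂ (sweedler ((L ∘ₗ f).compl₂ (evalAt a ∘ₗ
        twist (act ∘ₗ LinearMap.mul' k H) (G ∘ₗ LinearMap.mul' k H) r φ))) =
      sweedler ∘ₗ (((LinearMap.mul k (Module.End k M)).compl₁₂ (pairingRev P) (L ∘ₗ f)).compr₂
        (LinearMap.lcomp k M (evalAt a ∘ₗ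
          twist (act ∘ₗ LinearMap.mul' k H) (G ∘ₗ LinearMap.mul' k H) r φ))) := by
    refine LinearMap.ext fun c1 => LinearMap.ext fun c2 => ?_
    simp [sweedler_repr _ (Coalgebra.Repr.arbitrary k c2)]
  rw [e2, e3, e4, sweedler_coassoc, ← comp_sweedler, hP, diagonalAct_apply, sweedler_mul _ s t,
    sweedler_tmul _ s t]
  refine Finset.sum_congr rfl fun i _ => Finset.sum_congr rfl fun j _ => ?_
  change P _ (twist act G r φ _ a) = P _ (twist _ _ r φ _ a)
  rw [twist_mul, LinearMap.mul'_apply]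

theorem sweedler_one {V : Type*} [AddCommGroup V] [Module k V] (β : H →ₗ[k] H →ₗ[k] V) :
    sweedler β 1 = β 1 1 := by
  rw [sweedler_apply, Bialgebra.comul_one]
  rfl

theorem twist_one (hact : ∀ a, act 1 a = a) (hG : ∀ m, G 1 m = m) {r : ℕ}
    (φ : MultilinearMap k (fun _ : Fin r => A) M) (a : Fin r → A) : twist act G r φ 1 a = φ a := by
  induction r with
  | zero => rw [twist_zero, hG]
  | succ r ih =>
    rw [twist_succ, sweedler_one]
    change twist act G r (φ.curryLeft (act 1 (a 0))) 1 (Fin.tail a) = _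
    rw [ih, hact, MultilinearMap.curryLeft_apply, Fin.cons_self_tail]

theorem diagonalAct_one (hact : ∀ a, act 1 a = a) (hG : ∀ m, G 1 m = m) (hP : ∀ m, P 1 m = m)
    {r : ℕ} (φ : MultilinearMap k (fun _ : Fin r => A) M) : diagonalAct act P G r 1 φ = φ := by
  ext a
  rw [diagonalAct_apply, sweedler_one]
  change P 1 (twist act G r φ 1 a) = φ a
  rw [hP, twist_one hact hG]

end TwistMul

section RelBalanced

variable {k A M : Type*} [CommRing k] [Ring A] [Algebra k A] [AddCommGroup M] [Module k M]
  {S : Subalgebra k A} {L R : A →ₗ[k] Module.End k M}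

/-- The conditions indexed by positions become the recursive ones, which fit inductions that curry
the first argument. -/
theorem isBalanced_of_balanced {r : ℕ} {φ : MultilinearMap k (fun _ : Fin r => A) M}
    (hb : ∀ i j : Fin r, (j : ℕ) = i + 1 → ∀ s ∈ S, ∀ a : Fin r → A,
      φ (Function.update a i (a i * s)) = φ (Function.update a j (s * a j)))
    (hr : ∀ i : Fin r, (i : ℕ) + 1 = r → ∀ s ∈ S, ∀ a : Fin r → A,
      φ (Function.update a i (a i * s)) = R s (φ a)) : IsBalanced R (S : Set A) r φ := by
  induction r with
  | zero => trivial
  | succ r ih =>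
    refine fun x => ⟨ih (fun i j hij s hs a => ?_) (fun i hi s hs a => ?_), fun s hs => ?_⟩
    · have := hb i.succ j.succ (by simpa using hij) s hs (Fin.cons x a)
      simp only [← Fin.cons_update, Fin.cons_succ] at this
      exact this
    · have := hr i.succ (by simpa using hi) s hs (Fin.cons x a)
      simp only [← Fin.cons_update, Fin.cons_succ] at this
      exact this
    · ext a
      cases r with
      | zero =>
        have := hr 0 rfl s hs (Fin.cons x a)
        simp only [Fin.update_cons_zero, Fin.cons_zero] at this
        exact this.symm
      | succ r =>
        have := hb 0 (Fin.succ 0) rfl s hs (Fin.cons x a)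
        simp only [Fin.cons_zero, Fin.update_cons_zero, Fin.cons_succ, ← Fin.cons_update] at this
        change φ (Fin.cons x (Fin.cons (s * a 0) (Fin.tail a))) = φ (Fin.cons (x * s) a)
        rw [this]
        congr 2
        nth_rewrite 3 [← Fin.cons_self_tail a]
        rw [Fin.update_cons_zero]

theorem IsRelCochain.isBalanced {r : ℕ} {φ : MultilinearMap k (fun _ : Fin r => A) M}
    (h : IsRelCochain S L R φ) : IsBalanced R (S : Set A) r φ :=
  isBalanced_of_balanced h.balanced h.map_right

/-- Left S-linearity in positive arity. In arity 0 there is no first argument and centrality of the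
value takes its place. -/
theorem IsRelCochain.insertLeft_eq {r : ℕ} {φ : MultilinearMap k (fun _ : Fin r => A) M}
    (h : IsRelCochain S L R φ) (s : A) (hs : s ∈ (S : Set A)) :
    insertLeft R r φ s = postComp r (L s) φ := by
  ext a
  cases r with
  | zero => exact (h.central rfl s hs a).symm
  | succ r =>
    have := h.map_left 0 rfl s hs a
    change φ (Fin.cons (s * a 0) (Fin.tail a)) = L s (φ a)
    rw [← this]
    congr 1
    nth_rewrite 3 [← Fin.cons_self_tail a]
    rw [Fin.update_cons_zero]

end RelBalanced

/-! ### Convolution on H ⊗ H -/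

section ConvTmul

variable {k H B : Type*} [CommRing k] [Ring H] [HopfAlgebra k H] [Ring B] [Algebra k B]

theorem convMul_tmul (u v : WithConv (H ⊗[k] H →ₗ[k] B)) {h l : H} {ι κ : Type*}
    (r : Coalgebra.Repr k h ι) (s : Coalgebra.Repr k l κ) :
    (u * v).ofConv (h ⊗ₜ l) = ∑ i ∈ r.index, ∑ j ∈ s.index,
      u.ofConv (r.left i ⊗ₜ s.left j) * v.ofConv (r.right i ⊗ₜ s.right j) :=
  ((r.tmul s).convMul_apply u v).trans (Finset.sum_product _ _ _)

theorem convOne_tmul (h l : H) : (1 : WithConv (H ⊗[k] H →ₗ[k] B)).ofConv (h ⊗ₜ l) =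
    algebraMap k B (Coalgebra.counit (R := k) h * Coalgebra.counit (R := k) l) := by
  change algebraMap k B (Coalgebra.counit (R := k) (h ⊗ₜ[k] l)) = _
  rw [TensorProduct.counit_tmul, smul_eq_mul, mul_comm]

theorem ofConv_mul {C : Type*} [AddCommGroup C] [Module k C] [Coalgebra k C]
    (u v : WithConv (C →ₗ[k] B)) :
    (u * v).ofConv = sweedler ((LinearMap.mul k B).compl₁₂ u.ofConv v.ofConv) := by
  ext c
  rw [sweedler_repr _ (Coalgebra.Repr.arbitrary k c)]
  exact (Coalgebra.Repr.arbitrary k c).convMul_apply u v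

/-- The multiplication of H is compatible with comultiplication, so precomposing with it respects
convolution. Hence the inverse of γ gives one of (h, l) ↦ γ(hl). -/
theorem convMul_comp_mul (u v : WithConv (H →ₗ[k] B)) :
    toConv ((u * v).ofConv ∘ₗ LinearMap.mul' k H) =
      toConv (u.ofConv ∘ₗ LinearMap.mul' k H) * toConv (v.ofConv ∘ₗ LinearMap.mul' k H) := by
  apply WithConv.ofConv_injective
  ext h l
  have s := Coalgebra.Repr.arbitrary k h
  have t := Coalgebra.Repr.arbitrary k l
  refine Eq.trans ?_ (convMul_tmul _ _ s t).symm
  change (u * v).ofConv (h * l) = _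
  rw [ofConv_mul, sweedler_mul _ s t]
  rfl

theorem convOne_comp_mul :
    toConv ((1 : WithConv (H →ₗ[k] B)).ofConv ∘ₗ LinearMap.mul' k H) = 1 := by
  apply WithConv.ofConv_injective
  ext h l
  refine Eq.trans ?_ (convOne_tmul _ _).symm
  change algebraMap k B (Coalgebra.counit (h * l)) = _
  rw [Bialgebra.counit_mul]

end ConvTmul

/-! ### Identities between γ, its inverse and the cocycle -/

namespace CrossedProduct

variable {k A H : Type*} [CommRing k] [Ring A] [Algebra k A] [Ring H] [HopfAlgebra k H]
  (X : CrossedProduct k A H)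

theorem inclA_one : X.inclA 1 = 1 := rfl

theorem gamma_one : X.gamma 1 = 1 := rfl

theorem inclA_injective : Function.Injective X.inclA := by
  intro a b h
  have := congrArg (counitRight (k := k) (B := A) (C := H)) (show a ⊗ₜ[k] (1 : H) = b ⊗ₜ 1 from h)
  simpa [counitRight_tmul] using this

theorem gammaInv_mul (hu : IsUnit (toConv X.gamma)) : toConv X.gammaInv * toConv X.gamma = 1 :=
  Ring.inverse_mul_cancel _ hu

theorem mul_gammaInv (hu : IsUnit (toConv X.gamma)) : toConv X.gamma * toConv X.gammaInv = 1 :=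
  Ring.mul_inverse_cancel _ hu

theorem sum_gammaInv_mul (hu : IsUnit (toConv X.gamma)) {h : H} {ι : Type*}
    (r : Coalgebra.Repr k h ι) : ∑ i ∈ r.index, X.gammaInv (r.left i) * X.gamma (r.right i) =
      algebraMap k X.E (Coalgebra.counit h) :=
  (r.convMul_apply (toConv X.gammaInv) (toConv X.gamma)).symm.trans
    (by rw [X.gammaInv_mul hu]; rfl)

theorem sum_mul_gammaInv (hu : IsUnit (toConv X.gamma)) {h : H} {ι : Type*}
    (r : Coalgebra.Repr k h ι) : ∑ i ∈ r.index, X.gamma (r.left i) * X.gammaInv (r.right i) =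
      algebraMap k X.E (Coalgebra.counit h) :=
  (r.convMul_apply (toConv X.gamma) (toConv X.gammaInv)).symm.trans
    (by rw [X.mul_gammaInv hu]; rfl)

theorem gammaInv_one (hu : IsUnit (toConv X.gamma)) : X.gammaInv 1 = 1 := by
  let r : Coalgebra.Repr k (1 : H) Unit := ⟨{()}, fun _ => 1, fun _ => 1, by simp; rfl⟩
  have := X.sum_gammaInv_mul hu r
  simpa [r, X.gamma_one] using this

/-- `h ⊗ l ↦ γ(h) γ(l)` -/
def gammaGamma : WithConv (H ⊗[k] H →ₗ[k] X.E) :=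
  toConv (TensorProduct.lift ((LinearMap.mul k X.E).compl₁₂ X.gamma X.gamma))

theorem gammaGamma_tmul (h l : H) : X.gammaGamma.ofConv (h ⊗ₜ l) = X.gamma h * X.gamma l := rfl

/-- `h ⊗ l ↦ γ(h l)` -/
def gammaMul : WithConv (H ⊗[k] H →ₗ[k] X.E) := toConv (X.gamma ∘ₗ LinearMap.mul' k H)

theorem gammaMul_tmul (h l : H) : X.gammaMul.ofConv (h ⊗ₜ l) = X.gamma (h * l) := rfl

/-- The cocycle with values in `E`. -/
def cocycleE : WithConv (H ⊗[k] H →ₗ[k] X.E) := toConv (X.inclA ∘ₗ X.f)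

theorem gammaGamma_eq : X.gammaGamma = X.cocycleE * X.gammaMul := by
  apply WithConv.ofConv_injective
  refine TensorProduct.ext' fun h l => ?_
  rw [convMul_tmul _ _ (Coalgebra.Repr.arbitrary k h) (Coalgebra.Repr.arbitrary k l)]
  exact X.gamma_mul_gamma _ _

theorem isUnit_gammaMul (hu : IsUnit (toConv X.gamma)) :
    X.gammaMul * toConv (X.gammaInv ∘ₗ LinearMap.mul' k H) = 1 ∧
    toConv (X.gammaInv ∘ₗ LinearMap.mul' k H) * X.gammaMul = 1 := by
  have h1 := convMul_comp_mul (toConv X.gamma) (toConv X.gammaInv)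
  have h2 := convMul_comp_mul (toConv X.gammaInv) (toConv X.gamma)
  rw [X.mul_gammaInv hu, convOne_comp_mul] at h1
  rw [X.gammaInv_mul hu, convOne_comp_mul] at h2
  exact ⟨h1.symm, h2.symm⟩

theorem gamma_mul_inclA_repr {h : H} {ι : Type*} (r : Coalgebra.Repr k h ι) (a : A) :
    X.gamma h * X.inclA a =
      ∑ i ∈ r.index, X.inclA (X.act (r.left i) a) * X.gamma (r.right i) := by
  rw [gamma_mul_inclA, sweedler_repr _ r]
  rfl

theorem sum_sum_smul_counit {h l : H} {ι κ : Type*} (r : Coalgebra.Repr k h ι)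
    (s : Coalgebra.Repr k l κ) : ∑ i ∈ r.index, ∑ j ∈ s.index,
      (Coalgebra.counit (R := k) (r.right i) * Coalgebra.counit (R := k) (s.right j)) •
        (r.left i ⊗ₜ[k] s.left j) = h ⊗ₜ[k] l := by
  conv_rhs => rw [← sum_smul_counit r, ← sum_smul_counit s]
  simp only [TensorProduct.sum_tmul, TensorProduct.tmul_sum, TensorProduct.smul_tmul_smul]
  exact Finset.sum_comm

/-- Writing right multiplication by a constant as a convolution lets commutation rules with A be
handled by cancellation in the convolution algebra. -/
theorem convMul_const (u : WithConv (H ⊗[k] H →ₗ[k] X.E)) (e : X.E) (h l : H) :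
    (u * toConv ((Coalgebra.counit (R := k) (A := H ⊗[k] H)).smulRight e)).ofConv (h ⊗ₜ l) =
      u.ofConv (h ⊗ₜ l) * e := by
  have s := Coalgebra.Repr.arbitrary k h
  have t := Coalgebra.Repr.arbitrary k l
  rw [convMul_tmul _ _ s t]
  conv_rhs => rw [← sum_sum_smul_counit s t]
  simp only [map_sum, map_smul, Finset.sum_mul]
  refine Finset.sum_congr rfl fun i _ => Finset.sum_congr rfl fun j _ => ?_
  change _ * (Coalgebra.counit (R := k) (_ ⊗ₜ[k] _) • e) = _
  rw [TensorProduct.counit_tmul, smul_eq_mul, mul_smul_comm, smul_mul_assoc, mul_comm]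

theorem gammaGamma_const (a : A) : X.gammaGamma *
      toConv ((Coalgebra.counit (R := k) (A := H ⊗[k] H)).smulRight (X.inclA a)) =
    toConv (X.inclA ∘ₗ (pairing X.act).flip a) * X.gammaGamma := by
  apply WithConv.ofConv_injective
  refine TensorProduct.ext' fun h l => ?_
  have s := Coalgebra.Repr.arbitrary k h
  have t := Coalgebra.Repr.arbitrary k l
  rw [convMul_const, convMul_tmul _ _ s t, gammaGamma_tmul, mul_assoc,
    X.gamma_mul_inclA_repr t, Finset.mul_sum, Finset.sum_comm]
  refine Finset.sum_congr rfl fun j _ => ?_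
  rw [← mul_assoc, X.gamma_mul_inclA_repr s, Finset.sum_mul]
  refine Finset.sum_congr rfl fun i _ => ?_
  rw [gammaGamma_tmul, mul_assoc]
  rfl

theorem gammaMul_const (a : A) : X.gammaMul *
      toConv ((Coalgebra.counit (R := k) (A := H ⊗[k] H)).smulRight (X.inclA a)) =
    toConv (X.inclA ∘ₗ (X.act ∘ₗ LinearMap.mul' k H).flip a) * X.gammaMul := by
  apply WithConv.ofConv_injective
  refine TensorProduct.ext' fun h l => ?_
  have s := Coalgebra.Repr.arbitrary k h
  have t := Coalgebra.Repr.arbitrary k l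
  rw [convMul_const, convMul_tmul _ _ s t, gammaMul_tmul, gamma_mul_inclA, sweedler_mul _ s t]
  rfl

/-- `(a^l)^{h} f = f a^{h l}`, the compatibility of the weak action with the cocycle. -/
theorem cocycle_act (hu : IsUnit (toConv X.gamma)) (a : A) :
    sweedler ((LinearMap.mul k A).compl₁₂ ((pairing X.act).flip a) X.f) =
      sweedler ((LinearMap.mul k A).compl₁₂ X.f ((X.act ∘ₗ LinearMap.mul' k H).flip a)) := by
  have h : toConv (X.inclA ∘ₗ (pairing X.act).flip a) * X.cocycleE =
      X.cocycleE * toConv (X.inclA ∘ₗ (X.act ∘ₗ LinearMap.mul' k H).flip a) := by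
    -- Move a to the left across γ(h)γ(l) directly, and across f * γ(hl) through its second factor;
    -- then cancel the invertible (h, l) ↦ γ(hl) on the right.
    have h1 := X.gammaGamma_const a
    rw [gammaGamma_eq, mul_assoc, gammaMul_const, ← mul_assoc, ← mul_assoc] at h1
    have h2 := congrArg (· * toConv (X.gammaInv ∘ₗ LinearMap.mul' k H)) h1
    simp only [mul_assoc, (X.isUnit_gammaMul hu).1, mul_one] at h2
    exact h2.symm
  have h3 := congrArg WithConv.ofConv h
  rw [ofConv_mul, ofConv_mul] at h3
  refine LinearMap.ext fun c => X.inclA_injective ?_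
  have h4 := congrArg (fun g => g c) h3
  rw [← LinearMap.comp_apply, ← LinearMap.comp_apply, comp_sweedler, comp_sweedler]
  refine Eq.trans ?_ (h4.trans ?_)
  · congr 2
    refine LinearMap.ext fun c1 => LinearMap.ext fun c2 => ?_
    exact X.inclA_mul _ _
  · congr 2
    refine LinearMap.ext fun c1 => LinearMap.ext fun c2 => ?_
    exact (X.inclA_mul _ _).symm

/-- `h ⊗ l ↦ γ⁻¹(l) γ⁻¹(h)` -/
def gammaInvGammaInv : WithConv (H ⊗[k] H →ₗ[k] X.E) :=
  toConv (TensorProduct.lift ((LinearMap.mul k X.E).flip.compl₁₂ X.gammaInv X.gammaInv))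

theorem gammaInvGammaInv_mul (hu : IsUnit (toConv X.gamma)) :
    X.gammaInvGammaInv * X.gammaGamma = 1 := by
  apply WithConv.ofConv_injective
  refine TensorProduct.ext' fun h l => ?_
  have s := Coalgebra.Repr.arbitrary k h
  have t := Coalgebra.Repr.arbitrary k l
  rw [convMul_tmul _ _ s t, convOne_tmul, Finset.sum_comm]
  have e : ∀ i j, X.gammaInvGammaInv.ofConv (s.left i ⊗ₜ t.left j) *
      X.gammaGamma.ofConv (s.right i ⊗ₜ t.right j) = X.gammaInv (t.left j) *
        (X.gammaInv (s.left i) * X.gamma (s.right i)) * X.gamma (t.right j) := fun i j => by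
    change X.gammaInv _ * X.gammaInv _ * (X.gamma _ * X.gamma _) = _
    simp only [mul_assoc]
  simp only [e, ← Finset.sum_mul, ← Finset.mul_sum, X.sum_gammaInv_mul hu s]
  simp only [← Algebra.commutes, mul_assoc]
  rw [← Finset.mul_sum, X.sum_gammaInv_mul hu t, map_mul]

/-- γ⁻¹(l)γ⁻¹(h) is left inverse to γ(h)γ(l) = f * γ(hl). So its convolution with f is a left
inverse of γ(hl), and equals the right inverse γ⁻¹(hl). -/
theorem gammaInvGammaInv_cocycle (hu : IsUnit (toConv X.gamma)) :
    X.gammaInvGammaInv * X.cocycleE = toConv (X.gammaInv ∘ₗ LinearMap.mul' k H) := by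
  have h1 := X.gammaInvGammaInv_mul hu
  rw [gammaGamma_eq, ← mul_assoc] at h1
  exact left_inv_eq_right_inv h1 (X.isUnit_gammaMul hu).1

end CrossedProduct

/-! ### Exactness of the total complex -/

section TotalComplex

variable {k H : Type*} [CommRing k] [Ring H] [HopfAlgebra k H]
variable {C C' : ℕ → Type*} [∀ r, AddCommGroup (C r)] [∀ r, Module k (C r)]
  [∀ r, AddCommGroup (C' r)] [∀ r, Module k (C' r)]
  {d : ∀ r, C r →ₗ[k] C (r + 1)} {ρ : ∀ r, H →ₗ[k] Module.End k (C r)}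
  {d' : ∀ r, C' r →ₗ[k] C' (r + 1)} {ρ' : ∀ r, H →ₗ[k] Module.End k (C' r)}

theorem barD_isActionPair {N : Type*} [AddCommGroup N] [Module k N] {ρ : H →ₗ[k] Module.End k N}
    (hρ : ∀ h l x, ρ (h * l) x = ρ l (ρ h x)) :
    IsActionPair ((Coalgebra.counit (R := k) (A := H)).smulRight (1 : Module.End k N)) ρ where
  left_mul a b n := by simpa [mul_smul] using smul_comm _ _ _
  right_mul := hρ
  comm a b n := by simp

theorem barD_barD {N : Type*} [AddCommGroup N] [Module k N] {ρ : H →ₗ[k] Module.End k N}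
    (hρ : ∀ h l x, ρ (h * l) x = ρ l (ρ h x)) (s : ℕ)
    (φ : MultilinearMap k (fun _ : Fin s => H) N) : barD ρ (s + 1) (barD ρ s φ) = 0 :=
  hochschildD_hochschildD (barD_isActionPair hρ) s φ

theorem barD_compMultilinearMap {N N' : Type*} [AddCommGroup N] [Module k N] [AddCommGroup N']
    [Module k N'] {ρ : H →ₗ[k] Module.End k N} {ρ' : H →ₗ[k] Module.End k N'} (g : N →ₗ[k] N')
    (hg : ∀ h x, g (ρ h x) = ρ' h (g x)) (s : ℕ) (φ : MultilinearMap k (fun _ : Fin s => H) N) :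
    barD ρ' s (g.compMultilinearMap φ) = g.compMultilinearMap (barD ρ s φ) :=
  hochschildD_compMultilinearMap g (by simp) hg s φ

theorem totD_zero_succ (n s : ℕ) (h : 0 + (s + 1) = n + 1) (x : TotCochain k H C n) :
    totD d ρ n x ⟨(0, s + 1), h⟩ = barD (ρ 0) s (x ⟨(0, s), by omega⟩) := by
  have : totD d ρ n x ⟨(0, s + 1), h⟩ = 0 + (-1 : k) ^ 0 • barD (ρ 0) s (x ⟨(0, s), by omega⟩) := rfl
  rw [this, pow_zero, one_smul, zero_add]

theorem totD_succ_zero (n r : ℕ) (h : r + 1 + 0 = n + 1) (x : TotCochain k H C n) :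
    totD d ρ n x ⟨(r + 1, 0), h⟩ = (d r).compMultilinearMap (x ⟨(r, 0), by omega⟩) := by
  have : totD d ρ n x ⟨(r + 1, 0), h⟩ =
    (d r).compMultilinearMap (x ⟨(r, 0), by omega⟩) + 0 := rfl
  rw [this, add_zero]

theorem totD_succ_succ (n r s : ℕ) (h : r + 1 + (s + 1) = n + 1) (x : TotCochain k H C n) :
    totD d ρ n x ⟨(r + 1, s + 1), h⟩ = (d r).compMultilinearMap (x ⟨(r, s + 1), by omega⟩) +
      (-1 : k) ^ (r + 1) • barD (ρ (r + 1)) s (x ⟨(r + 1, s), by omega⟩) := rfl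

/-- The map of total complexes induced by maps of the coefficients. -/
def totMap (k H : Type*) [CommRing k] [Ring H] [HopfAlgebra k H] {C C' : ℕ → Type*}
    [∀ r, AddCommGroup (C r)] [∀ r, Module k (C r)]
    [∀ r, AddCommGroup (C' r)] [∀ r, Module k (C' r)] (g : ∀ r, C r →ₗ[k] C' r) (n : ℕ) :
    TotCochain k H C n →ₗ[k] TotCochain k H C' n :=
  LinearMap.pi fun p => (g p.1.1).compMultilinearMapₗ k ∘ₗ LinearMap.proj p

theorem totMap_apply (g : ∀ r, C r →ₗ[k] C' r) (n : ℕ) (x : TotCochain k H C n)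
    (p : {p : ℕ × ℕ // p.1 + p.2 = n}) :
    totMap k H g n x p = (g p.1.1).compMultilinearMap (x p) := rfl

theorem totD_totMap (g : ∀ r, C r →ₗ[k] C' r) (hd : ∀ r x, g (r + 1) (d r x) = d' r (g r x))
    (hρ : ∀ r h x, g r (ρ r h x) = ρ' r h (g r x)) (n : ℕ) (x : TotCochain k H C n) :
    totD d' ρ' n (totMap k H g n x) = totMap k H g (n + 1) (totD d ρ n x) := by
  have e : ∀ (r s : ℕ) (φ : MultilinearMap k (fun _ : Fin s => H) (C r)),
      (d' r).compMultilinearMap ((g r).compMultilinearMap φ) =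
        (g (r + 1)).compMultilinearMap ((d r).compMultilinearMap φ) := fun r s φ => by
    ext; simp [hd]
  funext p
  rcases p with ⟨⟨_ | r, _ | s⟩, h⟩
  · omega
  · simp only [totMap_apply, totD_zero_succ, barD_compMultilinearMap _ (hρ 0)]
  · simp only [totMap_apply, totD_succ_zero, e]
  · simp only [totMap_apply, totD_succ_succ, e, barD_compMultilinearMap _ (hρ (r + 1))]
    ext
    simp

/-- The differential of C is H-linear and so commutes with the bar coboundary; the sign (-1)^r makes
the two mixed terms cancel. -/
theorem totD_totD (hC : IsRightModuleComplex d ρ) (n : ℕ) (x : TotCochain k H C n) :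
    totD d ρ (n + 1) (totD d ρ n x) = 0 := by
  have e : ∀ (r s : ℕ) (φ : MultilinearMap k (fun _ : Fin s => H) (C r)),
      (d (r + 1)).compMultilinearMap ((d r).compMultilinearMap φ) = 0 := fun r s φ => by
    ext; simp [hC.d_comp_d]
  have e2 : ∀ r s (φ : MultilinearMap k (fun _ : Fin s => H) (C r)),
      barD (ρ (r + 1)) s ((d r).compMultilinearMap φ) =
      (d r).compMultilinearMap (barD (ρ r) s φ) := fun r =>
    barD_compMultilinearMap (d r) (hC.d_act r)
  have e3 : ∀ (r s : ℕ) (c : k) (φ ψ : MultilinearMap k (fun _ : Fin s => H) (C r)),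
      (d r).compMultilinearMap (φ + c • ψ) =
      (d r).compMultilinearMap φ + c • (d r).compMultilinearMap ψ := fun r s c φ ψ => by
    ext; simp
  funext p
  rcases p with ⟨⟨r, s⟩, h⟩
  rcases r with _ | _ | r <;> rcases s with _ | _ | s
  · omega
  · omega
  · rw [totD_zero_succ, totD_zero_succ, barD_barD (hC.act_mul 0)]; rfl
  · omega
  · rw [totD_succ_succ, totD_zero_succ, totD_succ_zero, e2]
    simp
  · rw [totD_succ_succ, totD_zero_succ, totD_succ_succ, map_add, map_smul, e2,
      barD_barD (hC.act_mul _)]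
    simp
  · rw [totD_succ_zero, totD_succ_zero, e]; rfl
  · rw [totD_succ_succ, totD_succ_succ, totD_succ_zero, e3, e, e2, pow_succ (-1 : k) (r + 1)]
    simp
  · rw [totD_succ_succ, totD_succ_succ, totD_succ_succ, e3, e, map_add, map_smul, e2,
      barD_barD (hC.act_mul _), pow_succ (-1 : k) (r + 1)]
    simp

/-- The total complex has no cohomology in positive degrees if the rows are contractible in positive
degrees and the horizontal cocycles in column `0` form a coinduced `H`-module. -/
theorem totD_exact (hC : IsRightModuleComplex d ρ) (s : ∀ r, C (r + 1) →ₗ[k] C r)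
    (hs : ∀ r x, d (r + 1) x = 0 → d r (s r x) = x) (K : (H →ₗ[k] C 0) →ₗ[k] C 0)
    (hKd : ∀ ξ, d 0 (K ξ) = 0) (hKr : ∀ h ξ, K (homRight h ξ) = ρ 0 h (K ξ))
    (hK : ∀ x, d 0 x = 0 → K ((ρ 0).flip x) = x) (n : ℕ) (x : TotCochain k H C (n + 1))
    (hx : totD d ρ (n + 1) x = 0) : ∃ y, totD d ρ n y = x := by
  -- Induction on the last column j in which x may be nonzero; for j = n + 1 this is no restriction
  -- in total degree n + 1.
  suffices ∀ j : ℕ, ∀ x : TotCochain k H C (n + 1), totD d ρ (n + 1) x = 0 →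
      (∀ p, j < p.1.1 → x p = 0) → ∃ y, totD d ρ n y = x from
    this (n + 1) x hx (fun p hp => by have := p.2; omega)
  clear hx x
  intro j
  induction j with
  | zero =>
    intro x hx h0
    -- Now x lives in column 0, so the component of its differential in column 1 is purely
    -- horizontal. Hence its values are horizontal cocycles, on which K splits the map into the
    -- coinduced module.
    have hd : ∀ t (ht : 0 + t = n + 1), (d 0).compMultilinearMap (x ⟨(0, t), ht⟩) = 0 := by
      rintro (_ | t) ht
      · omega
      · have := congrFun hx ⟨(1, t + 1), by omega⟩
        rw [totD_succ_succ, h0 ⟨(0 + 1, t), _⟩ (by simp)] at this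
        simpa using this
    have hK' : ∀ t (ht : 0 + t = n + 1), (K ∘ₗ (ρ 0).flip).compMultilinearMap (x ⟨(0, t), ht⟩) =
        x ⟨(0, t), ht⟩ := fun t ht => by
      ext b
      exact hK _ (congrArg (fun g => g b) (hd t ht))
    have hδ : ∀ t (ht : 0 + (t + 1) = n + 1), barD (ρ 0) (t + 1) (x ⟨(0, t + 1), ht⟩) = 0 :=
      fun t ht => by
        have := congrFun hx ⟨(0, t + 2), by omega⟩
        rwa [totD_zero_succ] at this
    have hδK : ∀ t (ht : 0 + (t + 1) = n + 1), barD (ρ 0) t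
        ((-1 : k) ^ (t + 1) • contractLast K t (x ⟨(0, t + 1), ht⟩)) = x ⟨(0, t + 1), ht⟩ := by
      intro t ht
      have := contractLast_hochschildD
        (L := (Coalgebra.counit (R := k) (A := H)).smulRight (1 : Module.End k (C 0))) (R := ρ 0) K
        (fun b ξ => by
          have : homLeft ((Coalgebra.counit (R := k) (A := H)).smulRight
            (1 : Module.End k (C 0))) b ξ = Coalgebra.counit (R := k) b • ξ := by ext; simp
          rw [this]; simp) hKr t (x ⟨(0, t + 1), ht⟩)
      rw [hK'] at this
      have h2 : barD (ρ 0) t (contractLast K t (x ⟨(0, t + 1), ht⟩)) +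
          (-1 : k) ^ t • x ⟨(0, t + 1), ht⟩ = 0 := by
        refine this.symm.trans ?_
        have h3 := hδ t ht
        change hochschildD _ _ _ _ = _ at h3
        rw [h3, map_zero]
      rw [map_smul, eq_neg_of_add_eq_zero_left h2, smul_neg, smul_smul, ← pow_add, ← neg_smul]
      have : -(-1 : k) ^ (t + 1 + t) = 1 := by
        rw [show t + 1 + t = 2 * t + 1 by ring, pow_succ, pow_mul]
        simp
      rw [this, one_smul]
    let y : TotCochain k H C n := fun p => match p with
      | ⟨(0, t), ht⟩ => (-1 : k) ^ (t + 1) • contractLast K t (x ⟨(0, t + 1), by omega⟩)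
      | ⟨(r + 1, t), ht⟩ => 0
    -- K takes values in horizontal cocycles, so the differential of y stays in column 0.
    have hy : ∀ t (ht : 0 + t = n), (d 0).compMultilinearMap (y ⟨(0, t), ht⟩) = 0 := fun t ht => by
      ext b
      change d 0 ((-1 : k) ^ (t + 1) • K _) = 0
      rw [map_smul, hKd, smul_zero]
    refine ⟨y, ?_⟩
    funext p
    rcases p with ⟨⟨_ | r, _ | t⟩, h⟩
    · omega
    · rw [totD_zero_succ]
      exact hδK t h
    · rw [totD_succ_zero, h0 ⟨(r + 1, 0), _⟩ (by simp)]
      cases r with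
      | zero => exact hy _ _
      | succ r => ext; exact (d (r + 1)).map_zero
    · rw [totD_succ_succ, h0 ⟨(r + 1, t + 1), _⟩ (by simp)]
      change _ + _ • barD (ρ (r + 1)) t 0 = 0
      rw [map_zero, smul_zero, add_zero]
      cases r with
      | zero => exact hy _ _
      | succ r => ext; exact (d (r + 1)).map_zero
  | succ j ih =>
    intro x hx h0
    -- In column j + 1, the last one possibly nonzero, x is a horizontal cocycle. Applying s gives a
    -- y whose differential agrees with x in the columns beyond j; changes in lower columns are
    -- harmless.
    let y : TotCochain k H C n := fun p =>
      (s p.1.1).compMultilinearMap (x ⟨(p.1.1 + 1, p.1.2), by have := p.2; omega⟩)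
    have hd : ∀ r t (ht : r + 1 + t = n + 1), j < r + 1 →
        (d (r + 1)).compMultilinearMap (x ⟨(r + 1, t), ht⟩) = 0 := by
      rintro r (_ | t) ht hr
      · have := congrFun hx ⟨(r + 2, 0), by omega⟩
        rwa [totD_succ_zero] at this
      · have := congrFun hx ⟨(r + 2, t + 1), by omega⟩
        rw [totD_succ_succ, h0 ⟨(r + 1 + 1, t), _⟩ (by simp; omega)] at this
        simpa using this
    have hds : ∀ r t (ht : r + 1 + t = n + 1), j < r + 1 →
        (d r).compMultilinearMap (y ⟨(r, t), by omega⟩) = x ⟨(r + 1, t), ht⟩ := by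
      intro r t ht hr
      ext b
      exact hs r _ (congrArg (fun g => g b) (hd r t ht hr))
    obtain ⟨z, hz⟩ := ih (x - totD d ρ n y) (by rw [map_sub, hx, totD_totD hC, sub_zero])
      (fun p hp => by
        rcases p with ⟨⟨_ | r, _ | t⟩, h⟩
        · simp at hp
        · simp at hp
        · rw [Pi.sub_apply, totD_succ_zero, hds _ _ h hp, sub_self]
        · have hy : y ⟨(r + 1, t), by omega⟩ = 0 := by
            change (s (r + 1)).compMultilinearMap (x ⟨(r + 1 + 1, t), _⟩) = 0
            rw [h0 ⟨(r + 1 + 1, t), _⟩ (by simpa using hp)]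
            ext; exact (s (r + 1)).map_zero
          rw [Pi.sub_apply, totD_succ_succ, hds _ _ h hp, hy, map_zero, smul_zero, add_zero,
            sub_self])
    exact ⟨z + y, by rw [map_add, hz, sub_add_cancel]⟩

end TotalComplex

/-! ### Coinduced bimodules and their Hochschild cohomology -/

section Bimodules

variable {k B N : Type*} [CommRing k] [Ring B] [Algebra k B] [AddCommGroup N] [Module k N]

/-- `L` and `R` are the left and right actions of a `B`-bimodule structure on `N`. -/
structure IsBimodule (L R : B →ₗ[k] Module.End k N) : Prop extends IsActionPair L R where
  left_one : ∀ n, L 1 n = n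
  right_one : ∀ n, R 1 n = n

theorem coind_isBimodule {L R : B →ₗ[k] Module.End k N} (h : IsBimodule L R) :
    IsBimodule (homLeft (C := B) L) (homRight (k := k) (B := B) (N := N)) where
  left_mul a b n := by ext; simp [h.left_mul]
  right_mul a b n := by ext; simp [mul_assoc]
  comm a b n := by ext; simp
  left_one n := by ext; simp [h.left_one]
  right_one n := by ext; simp

/-- The action induced on the quotient by a stable submodule. -/
def quotAct (W : Submodule k N) (L : B →ₗ[k] Module.End k N) (hW : ∀ b, W ≤ W.comap (L b)) :
    B →ₗ[k] Module.End k (N ⧸ W) where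
  toFun b := W.mapQ W (L b) (hW b)
  map_add' a b := by ext; simp
  map_smul' c b := by ext; simp

theorem quotAct_mkQ (W : Submodule k N) (L : B →ₗ[k] Module.End k N)
    (hW : ∀ b, W ≤ W.comap (L b)) (b : B) (n : N) :
    quotAct W L hW b (W.mkQ n) = W.mkQ (L b n) := rfl

theorem quot_isBimodule {L R : B →ₗ[k] Module.End k N} (h : IsBimodule L R) (W : Submodule k N)
    (hL : ∀ b, W ≤ W.comap (L b)) (hR : ∀ b, W ≤ W.comap (R b)) :
    IsBimodule (quotAct W L hL) (quotAct W R hR) where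
  left_mul a b n := by
    obtain ⟨n, rfl⟩ := W.mkQ_surjective n
    simp only [quotAct_mkQ, h.left_mul]
  right_mul a b n := by
    obtain ⟨n, rfl⟩ := W.mkQ_surjective n
    simp only [quotAct_mkQ, h.right_mul]
  comm a b n := by
    obtain ⟨n, rfl⟩ := W.mkQ_surjective n
    simp only [quotAct_mkQ, h.comm]
  left_one n := by
    obtain ⟨n, rfl⟩ := W.mkQ_surjective n
    simp only [quotAct_mkQ, h.left_one]
  right_one n := by
    obtain ⟨n, rfl⟩ := W.mkQ_surjective n
    simp only [quotAct_mkQ, h.right_one]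

/-- The embedding of `N` into `Hom(B, N)` is `m ↦ (y ↦ m y)`; this is its image. -/
def coindRange (R : B →ₗ[k] Module.End k N) : Submodule k (B →ₗ[k] N) := LinearMap.range R.flip

theorem coindRange_left {L R : B →ₗ[k] Module.End k N} (h : IsBimodule L R) (b : B) :
    coindRange R ≤ (coindRange R).comap (homLeft L b) := by
  rintro _ ⟨m, rfl⟩
  exact ⟨L b m, by ext; simp [h.comm]⟩

theorem coindRange_right {L R : B →ₗ[k] Module.End k N} (h : IsBimodule L R) (b : B) :
    coindRange R ≤ (coindRange R).comap (homRight b) := by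
  rintro _ ⟨m, rfl⟩
  exact ⟨R b m, by ext; simp [h.right_mul]⟩

/-- The elements `m` with `b m = m b` for all `b`. -/
def center (L R : B →ₗ[k] Module.End k N) : Submodule k N where
  carrier := {m | ∀ b, L b m = R b m}
  add_mem' {m n} hm hn b := by rw [map_add, map_add, hm, hn]
  zero_mem' b := by rw [map_zero, map_zero]
  smul_mem' c m hm b := by rw [map_smul, map_smul, hm]

/-- The coboundary of the 0-cochain with value m is b ↦ bm - mb. -/
theorem map_ker_hochschildD_zero (L R : B →ₗ[k] Module.End k N) :
    (LinearMap.ker (hochschildD L R 0)).map (evalAt (0 : Fin 0 → B)) = center L R := by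
  have e : ∀ (φ : MultilinearMap k (fun _ : Fin 0 => B) N) (c : Fin 0 → B), φ c = φ 0 :=
    fun φ c => by congr 1; exact Subsingleton.elim _ _
  ext m
  constructor
  · rintro ⟨φ, hφ, rfl⟩ b
    have := congrArg (fun g => g (fun _ => b)) hφ
    simp only [hochschildD_apply, e φ] at this
    simpa [add_neg_eq_zero, evalAt] using this
  · intro hm
    refine ⟨MultilinearMap.constOfIsEmpty k _ m, ?_, rfl⟩
    ext b
    simpa [hochschildD_apply, add_neg_eq_zero] using hm _

theorem evalAt_zero_injective :
    Function.Injective (evalAt (k := k) (M := N) (0 : Fin 0 → B)) := by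
  intro φ ψ h
  ext c
  rw [Subsingleton.elim c 0]
  exact h

/-- The map `ξ ↦ (y ↦ ξ(y)(1))`. -/
def evalOne : (B →ₗ[k] (B →ₗ[k] N)) →ₗ[k] (B →ₗ[k] N) where
  toFun ξ := ξ.flip 1
  map_add' _ _ := rfl
  map_smul' _ _ := rfl

/-- `evalOne` commutes with both actions and splits ξ ↦ (y ↦ ξy), because (ξy)(1) = ξ(y). So
`contractLast` is a contracting homotopy. -/
theorem hochschildD_coind_exact (L : B →ₗ[k] Module.End k N) (n : ℕ)
    (φ : MultilinearMap k (fun _ : Fin (n + 1) => B) (B →ₗ[k] N))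
    (hφ : hochschildD (homLeft L) homRight (n + 1) φ = 0) :
    ∃ ψ, hochschildD (homLeft L) homRight n ψ = φ := by
  have h := contractLast_hochschildD (L := homLeft (C := B) L)
    (R := homRight (k := k) (B := B) (N := N)) evalOne (fun b ξ => rfl)
    (fun b ξ => rfl) n φ
  have e : (evalOne ∘ₗ (homRight (k := k) (B := B) (N := N)).flip) = .id := by
    ext ξ y
    change ξ (y * 1) = ξ y
    rw [mul_one]
  rw [hφ, map_zero, e] at h
  -- For a cocycle the homotopy formula leaves -(-1)^n φ; the sign compensates this.
  refine ⟨(-1 : k) ^ (n + 1) • contractLast evalOne n φ, ?_⟩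
  have e2 : (LinearMap.id : (B →ₗ[k] N) →ₗ[k] _).compMultilinearMap φ = φ := rfl
  rw [map_smul, eq_neg_of_add_eq_zero_left h.symm, e2, smul_neg, smul_smul, ← pow_add, ← neg_smul]
  have : -(-1 : k) ^ (n + 1 + n) = 1 := by
    rw [show n + 1 + n = 2 * n + 1 by ring, pow_succ, pow_mul]
    simp
  rw [this, one_smul]

end Bimodules

/-! ### Splitting by a separability idempotent -/

section Separable

variable {k S B N : Type*} [CommRing k] [Ring S] [Algebra k S] [Ring B] [Algebra k B]
  [AddCommGroup N] [Module k N] {L R : B →ₗ[k] Module.End k N} (j : S →ₗ[k] B)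

/-- The map `n ↦ ∑ n(eᵢ) fᵢ` for `e = ∑ eᵢ ⊗ fᵢ`. -/
def sepRetract (R : B →ₗ[k] Module.End k N) (e : S ⊗[k] S) : (B →ₗ[k] N) →ₗ[k] N where
  toFun n := TensorProduct.lift ((R.flip ∘ₗ n ∘ₗ j).compl₂ j) e
  map_add' n m := by
    rw [← LinearMap.add_apply]
    congr 1
    ext
    simp
  map_smul' c n := by
    rw [RingHom.id_apply, ← LinearMap.smul_apply]
    congr 1
    ext
    simp

theorem sepRetract_apply (e : S ⊗[k] S) (n : B →ₗ[k] N) :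
    sepRetract j R e n = TensorProduct.lift ((R.flip ∘ₗ n ∘ₗ j).compl₂ j) e := rfl

variable {j}

/-- ∑ (m eᵢ)fᵢ = m μ(e) = m. -/
theorem sepRetract_flip (h : IsBimodule L R) (hj : ∀ s t, j (s * t) = j s * j t) (hj1 : j 1 = 1)
    {e : S ⊗[k] S} (he : LinearMap.mul' k S e = 1) (m : N) : sepRetract j R e (R.flip m) = m := by
  have key : ∀ x : S ⊗[k] S, TensorProduct.lift ((R.flip ∘ₗ R.flip m ∘ₗ j).compl₂ j) x =
      R (j (LinearMap.mul' k S x)) m := fun x => by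
    induction x with
    | zero => simp
    | add x y hx hy => simp only [map_add, hx, hy, LinearMap.add_apply]
    | tmul s t => simp [hj, h.right_mul]
  rw [sepRetract_apply, key, he, hj1, h.right_one]

theorem sepRetract_left (h : IsBimodule L R) (e : S ⊗[k] S) (b : B) (n : B →ₗ[k] N) :
    sepRetract j R e (homLeft L b n) = L b (sepRetract j R e n) := by
  rw [sepRetract_apply, sepRetract_apply, ← LinearMap.comp_apply]
  congr 1
  ext s t
  simp [h.comm]

/-- ∑ n(s eᵢ)fᵢ = ∑ n(eᵢ)fᵢ s, because the idempotent commutes with s. This is available for s in S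
only, so the retraction is right linear over S and not over all of B. -/
theorem sepRetract_right (h : IsBimodule L R) (hj : ∀ s t, j (s * t) = j s * j t)
    {e : S ⊗[k] S} (he : ∀ s : S, (s ⊗ₜ 1) * e = e * (1 ⊗ₜ s)) (s : S) (n : B →ₗ[k] N) :
    sepRetract j R e (homRight (j s) n) = R (j s) (sepRetract j R e n) := by
  have h1 : ∀ x : S ⊗[k] S,
      TensorProduct.lift ((R.flip ∘ₗ homRight (j s) n ∘ₗ j).compl₂ j) x =
        TensorProduct.lift ((R.flip ∘ₗ n ∘ₗ j).compl₂ j) ((s ⊗ₜ 1) * x) := fun x => by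
    induction x with
    | zero => simp
    | add x y hx hy => simp only [map_add, hx, hy, mul_add]
    | tmul t u => simp [hj]
  have h2 : ∀ x : S ⊗[k] S,
      R (j s) (TensorProduct.lift ((R.flip ∘ₗ n ∘ₗ j).compl₂ j) x) =
        TensorProduct.lift ((R.flip ∘ₗ n ∘ₗ j).compl₂ j) (x * (1 ⊗ₜ s)) := fun x => by
    induction x with
    | zero => simp
    | add x y hx hy => simp only [map_add, hx, hy, add_mul]
    | tmul t u => simp [hj, h.right_mul]
  rw [sepRetract_apply, sepRetract_apply, h1, h2, he]

end Separable

section CokernelSplitting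

variable {k B N : Type*} [CommRing k] [Ring B] [Algebra k B] [AddCommGroup N] [Module k N]
  {R : B →ₗ[k] Module.End k N}

/-- The section of `Hom(B, N) → Hom(B, N) / N` given by a retraction `ρ`. -/
def cokerSection (ρ : (B →ₗ[k] N) →ₗ[k] N) (hρ : ∀ m, ρ (R.flip m) = m) :
    (B →ₗ[k] N) ⧸ coindRange R →ₗ[k] (B →ₗ[k] N) :=
  (coindRange R).liftQ (.id - R.flip ∘ₗ ρ) (by
    rintro _ ⟨m, rfl⟩
    simp [hρ])

theorem cokerSection_mkQ (ρ : (B →ₗ[k] N) →ₗ[k] N) (hρ : ∀ m, ρ (R.flip m) = m)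
    (n : B →ₗ[k] N) : cokerSection ρ hρ ((coindRange R).mkQ n) = n - R.flip (ρ n) := rfl

theorem mkQ_flip (m : N) : (coindRange R).mkQ (R.flip m) = 0 :=
  (Submodule.Quotient.mk_eq_zero _).mpr ⟨m, rfl⟩

theorem mkQ_cokerSection (ρ : (B →ₗ[k] N) →ₗ[k] N) (hρ : ∀ m, ρ (R.flip m) = m)
    (x : (B →ₗ[k] N) ⧸ coindRange R) : (coindRange R).mkQ (cokerSection ρ hρ x) = x := by
  obtain ⟨n, rfl⟩ := Submodule.mkQ_surjective _ x
  rw [cokerSection_mkQ, map_sub, mkQ_flip, sub_zero]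

/-- The section is n - `R.flip` (ρ n) on representatives, so it commutes with every operator with
which both ρ and the embedding commute. -/
theorem cokerSection_comm {f : Module.End k (B →ₗ[k] N)} {g : Module.End k N}
    {f' : Module.End k ((B →ₗ[k] N) ⧸ coindRange R)} (ρ : (B →ₗ[k] N) →ₗ[k] N)
    (hρ : ∀ m, ρ (R.flip m) = m) (hf : ∀ n, f' ((coindRange R).mkQ n) = (coindRange R).mkQ (f n))
    (hg : ∀ m, R.flip (g m) = f (R.flip m)) (hρg : ∀ n, ρ (f n) = g (ρ n))
    (x : (B →ₗ[k] N) ⧸ coindRange R) : cokerSection ρ hρ (f' x) = f (cokerSection ρ hρ x) := by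
  obtain ⟨n, rfl⟩ := Submodule.mkQ_surjective _ x
  rw [hf, cokerSection_mkQ, cokerSection_mkQ, map_sub, hρg, hg]

end CokernelSplitting

section KernelQuotient

variable {k V N : Type*} [CommRing k] [AddCommGroup V] [Module k V] [AddCommGroup N] [Module k N]

theorem nonempty_quotient_equiv (ev : V →ₗ[k] N) (hev : Function.Injective ev)
    {W U : Submodule k V} {Z Z' : Submodule k N} (hU : U ≤ W) (hW : W.map ev = Z)
    (hZ : U.map ev = Z') :
    Nonempty ((W ⧸ U.submoduleOf W) ≃ₗ[k] (Z ⧸ Z'.submoduleOf Z)) := by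
  subst hW hZ
  refine ⟨Submodule.Quotient.equiv _ _ (W.equivMapOfInjective ev hev) ?_⟩
  ext ⟨x, hx⟩
  constructor
  · rintro ⟨y, hy, hyx⟩
    exact ⟨y.1, hy, congrArg Subtype.val hyx⟩
  · rintro ⟨y, hy, hyx⟩
    exact ⟨⟨y, hU hy⟩, hy, Subtype.ext hyx⟩

end KernelQuotient

/-! ### Relative cochains with varying coefficients -/

section RelCochains

variable {k A N N' : Type*} [CommRing k] [Ring A] [Algebra k A] [AddCommGroup N] [Module k N]
  [AddCommGroup N'] [Module k N']

theorem IsRelCochain.comp {S : Subalgebra k A} {L R : A →ₗ[k] Module.End k N}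
    {L' R' : A →ₗ[k] Module.End k N'} (g : N →ₗ[k] N')
    (hL : ∀ s ∈ S, ∀ n, g (L s n) = L' s (g n)) (hR : ∀ s ∈ S, ∀ n, g (R s n) = R' s (g n)) {r : ℕ}
    {φ : MultilinearMap k (fun _ : Fin r => A) N} (h : IsRelCochain S L R φ) :
    IsRelCochain S L' R' (g.compMultilinearMap φ) where
  map_left i hi s hs a := by
    simp only [LinearMap.compMultilinearMap_apply, h.map_left i hi s hs, hL s hs]
  map_right i hi s hs a := by
    simp only [LinearMap.compMultilinearMap_apply, h.map_right i hi s hs, hR s hs]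
  balanced i j hij s hs a := by
    simp only [LinearMap.compMultilinearMap_apply, h.balanced i j hij s hs]
  normalized i a ha := by
    simp only [LinearMap.compMultilinearMap_apply, h.normalized i a ha, map_zero]
  central hr s hs a := by
    simp only [LinearMap.compMultilinearMap_apply, ← hL s hs, h.central hr s hs, hR s hs]

/-- Once the last argument is consumed, balancedness between the last two becomes right S-linearity
in the remaining last one. If no argument remains, left S-linearity becomes centrality. -/
theorem IsRelCochain.contractLast {S : Subalgebra k A} {L R : A →ₗ[k] Module.End k N}
    (K : (A →ₗ[k] N) →ₗ[k] N) (hL : ∀ b ξ, K (homLeft L b ξ) = L b (K ξ))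
    (hR : ∀ b ξ, K (homRight b ξ) = R b (K ξ)) {r : ℕ}
    {φ : MultilinearMap k (fun _ : Fin (r + 1) => A) N} (h : IsRelCochain S L R φ) :
    IsRelCochain S L R (contractLast K r φ) where
  map_left i hi s hs a := by
    rw [contractLast_apply, contractLast_apply, ← hL]
    congr 1
    ext x
    have := h.map_left i.castSucc hi s hs (Fin.snoc a x)
    simp only [Fin.snoc_castSucc, ← Fin.snoc_update] at this
    exact this
  map_right i hi s hs a := by
    rw [contractLast_apply, contractLast_apply, ← hR]
    congr 1
    ext x
    have := h.balanced i.castSucc (Fin.last r) (by simpa using hi.symm) s hs (Fin.snoc a x)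
    simp only [Fin.snoc_castSucc, ← Fin.snoc_update, Fin.snoc_last, Fin.update_snoc_last] at this
    exact this
  balanced i j hij s hs a := by
    rw [contractLast_apply, contractLast_apply]
    congr 1
    ext x
    have := h.balanced i.castSucc j.castSucc hij s hs (Fin.snoc a x)
    simp only [Fin.snoc_castSucc, ← Fin.snoc_update] at this
    exact this
  normalized i a ha := by
    rw [contractLast_apply]
    have : φ.curryRight a = 0 := by
      ext x
      exact h.normalized i.castSucc _ (by simpa using ha)
    rw [this, map_zero]
  central hr s hs a := by
    subst hr
    rw [contractLast_apply, ← hL, ← hR]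
    congr 1
    ext x
    have h1 := h.map_left 0 rfl s hs (Fin.snoc a x)
    have e : ∀ y, Function.update (Fin.snoc a x : Fin 1 → A) 0 y = (Fin.snoc a y : Fin 1 → A) :=
      fun y => Fin.update_snoc_last (n := 0) _ _ _
    rw [e] at h1
    exact h1.symm

end RelCochains

namespace CrossedProduct

variable {k A H : Type*} [CommRing k] [Ring A] [Algebra k A] [Ring H] [HopfAlgebra k H]
  (X : CrossedProduct k A H) {N N' : Type*} [AddCommGroup N] [Module k N] [AddCommGroup N']
  [Module k N'] (S : Subalgebra k A)

section Complex

variable (L R : X.E →ₗ[k] Module.End k N)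

/-- The relative cochains with coefficients in a bimodule given by actions `L` and `R`. -/
def relCochain (r : ℕ) : Submodule k (MultilinearMap k (fun _ : Fin r => A) N) where
  carrier := {φ | IsRelCochain S (L ∘ₗ X.inclA) (R ∘ₗ X.inclA) φ}
  add_mem' {φ ψ} hφ hψ :=
    ⟨fun i hi s hs a => by simp [hφ.map_left i hi s hs a, hψ.map_left i hi s hs a],
      fun i hi s hs a => by simp [hφ.map_right i hi s hs a, hψ.map_right i hi s hs a],
      fun i j hij s hs a => by simp [hφ.balanced i j hij s hs a, hψ.balanced i j hij s hs a],
      fun i a ha => by simp [hφ.normalized i a ha, hψ.normalized i a ha],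
      fun h s hs a => by
        have h1 := hφ.central h s hs a
        have h2 := hψ.central h s hs a
        simp only [LinearMap.comp_apply] at h1 h2
        simp [h1, h2]⟩
  zero_mem' := ⟨by simp, by simp, by simp, by simp, by simp⟩
  smul_mem' c φ hφ :=
    ⟨fun i hi s hs a => by simp [hφ.map_left i hi s hs a],
      fun i hi s hs a => by simp [hφ.map_right i hi s hs a],
      fun i j hij s hs a => by simp [hφ.balanced i j hij s hs a],
      fun i a ha => by simp [hφ.normalized i a ha],
      fun h s hs a => by
        have h1 := hφ.central h s hs a
        simp only [LinearMap.comp_apply] at h1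
        simp [h1]⟩

variable {L R}

theorem isActionPair_inclA (h : IsBimodule L R) :
    IsActionPair (L ∘ₗ X.inclA) (R ∘ₗ X.inclA) where
  left_mul a b n := by simp [inclA_mul, h.left_mul]
  right_mul a b n := by simp [inclA_mul, h.right_mul]
  comm a b n := by simp [h.comm]

/-- The coboundary of relative cochains. -/
def relCoboundary (h : IsBimodule L R) (r : ℕ) :
    X.relCochain S L R r →ₗ[k] X.relCochain S L R (r + 1) :=
  (hochschildD (L ∘ₗ X.inclA) (R ∘ₗ X.inclA) r).restrict fun _ hφ =>
    IsRelCochain.hochschildD (X.isActionPair_inclA h).left_mul (X.isActionPair_inclA h).right_mul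
      (X.isActionPair_inclA h).comm hφ

theorem sweedler_left (h : IsBimodule L R) (s : A) :
    sweedler ((LinearMap.mul k (Module.End k N)).compl₁₂ (L ∘ₗ X.gammaInv)
      ((L ∘ₗ X.inclA) ∘ₗ X.act.flip s)) =
      LinearMap.mulLeft k ((L ∘ₗ X.inclA) s) ∘ₗ (L ∘ₗ X.gammaInv) := by
  ext c m
  have := congrArg (fun g => L (g c) m) (X.sweedler_gammaInv s)
  simpa [sweedler_repr _ (Coalgebra.Repr.arbitrary k c), h.left_mul] using this

theorem sweedler_right (h : IsBimodule L R) (s : A) :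
    sweedler ((LinearMap.mul k (Module.End k N)).flip.compl₁₂ ((R ∘ₗ X.inclA) ∘ₗ X.act.flip s)
      (R ∘ₗ X.gamma)) = LinearMap.mulLeft k ((R ∘ₗ X.inclA) s) ∘ₗ (R ∘ₗ X.gamma) := by
  ext c m
  have := congrArg (fun e => R e m) (X.gamma_mul_inclA c s)
  simpa [sweedler_repr _ (Coalgebra.Repr.arbitrary k c), h.right_mul] using this.symm

variable {S}

/-- The right action of `H` on relative cochains. -/
def relAction (h : IsBimodule L R) (hS : ∀ h, ∀ s ∈ S, X.act h s ∈ S) (r : ℕ) :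
    H →ₗ[k] Module.End k (X.relCochain S L R r) where
  toFun x := (diagonalAct X.act (L ∘ₗ X.gammaInv) (R ∘ₗ X.gamma) r x).restrict fun _ hφ =>
    IsRelCochain.diagonalAct X.act_mul hS (fun s _ => X.sweedler_left h s)
      (fun s _ => X.sweedler_right h s) (fun _ _ _ => (h.comm _ _ _).symm)
      (fun _ _ _ => h.comm _ _ _) hφ x
  map_add' _ _ := by ext; simp; rfl
  map_smul' _ _ := by ext; simp; rfl

theorem relComplex_isRightModuleComplex (h : IsBimodule L R)
    (hS : ∀ h, ∀ s ∈ S, X.act h s ∈ S) (hu : IsUnit (toConv X.gamma))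
    (hf : ∀ h l : H, X.f (h ⊗ₜ l) ∈ S) :
    IsRightModuleComplex (X.relCoboundary S h) (X.relAction h hS) where
  d_comp_d r x := Subtype.ext (hochschildD_hochschildD (X.isActionPair_inclA h) r x.1)
  act_one r x := Subtype.ext <| diagonalAct_one X.one_act
    (fun m => by rw [LinearMap.comp_apply, gamma_one, h.right_one])
    (fun m => by rw [LinearMap.comp_apply, X.gammaInv_one hu, h.left_one]) x.1
  act_mul r x y φ := by
    refine Subtype.ext (diagonalAct_mul (L := L ∘ₗ X.inclA) (R := R ∘ₗ X.inclA) (f := X.f)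
      (T := (S : Set A)) (fun c => ?_) (X.cocycle_act hu) ?_ ?_ ?_ ?_ φ.1 φ.2.isBalanced
      φ.2.insertLeft_eq x y)
    · induction c with
      | zero => rw [map_zero]; exact S.zero_mem
      | add c c' hc hc' => rw [map_add]; exact S.add_mem hc hc'
      | tmul x y => exact hf x y
    -- γ(h)γ(l) = f(h⁽¹⁾, l⁽¹⁾)γ(h⁽²⁾l⁽²⁾), read as operators acting from the right.
    · have e := congrArg WithConv.ofConv X.gammaGamma_eq
      rw [ofConv_mul] at e
      have e2 : pairingRev (R ∘ₗ X.gamma) = R ∘ₗ X.gammaGamma.ofConv := by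
        refine TensorProduct.ext' fun h' l => ?_
        ext m
        exact (h.right_mul _ _ _).symm
      rw [e2, e, comp_sweedler]
      congr 1
      refine LinearMap.ext fun c => LinearMap.ext fun c' => ?_
      ext m
      exact h.right_mul (X.cocycleE.ofConv c) (X.gammaMul.ofConv c') m
    -- γ⁻¹(l⁽¹⁾)γ⁻¹(h⁽¹⁾)f(h⁽²⁾, l⁽²⁾) = γ⁻¹(hl), read as operators acting from the left.
    · have e := congrArg WithConv.ofConv (X.gammaInvGammaInv_cocycle hu)
      rw [ofConv_mul] at e
      have e2 := congrArg (fun g => L ∘ₗ g) e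
      simp only [comp_sweedler] at e2
      refine Eq.trans ?_ e2
      congr 1
      refine TensorProduct.ext' fun h' l => ?_
      refine LinearMap.ext fun c' => ?_
      ext m
      change L _ (L _ (L _ m)) = L (X.gammaInv l * X.gammaInv h' * _) m
      rw [h.left_mul, h.left_mul]
      rfl
    · exact fun _ _ _ => (h.comm _ _ _).symm
    · exact fun _ _ _ => (h.comm _ _ _).symm
  d_act r x φ := Subtype.ext (diagonalAct_hochschildD X.act_mul (X.sweedler_left h)
    (X.sweedler_right h) (fun _ _ _ => (h.comm _ _ _).symm) (fun _ _ _ => h.comm _ _ _) φ.1 x).symm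

end Complex

section Functoriality

variable {S} {L R : X.E →ₗ[k] Module.End k N} {L' R' : X.E →ₗ[k] Module.End k N'}

/-- The map of relative cochains induced by an `S`-bimodule map of the coefficients. -/
def relMap (g : N →ₗ[k] N') (hL : ∀ s ∈ S, ∀ n, g (L (X.inclA s) n) = L' (X.inclA s) (g n))
    (hR : ∀ s ∈ S, ∀ n, g (R (X.inclA s) n) = R' (X.inclA s) (g n)) (r : ℕ) :
    X.relCochain S L R r →ₗ[k] X.relCochain S L' R' r :=
  (g.compMultilinearMapₗ k).restrict fun _ hφ => IsRelCochain.comp g hL hR hφ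

theorem relMap_relCoboundary (h : IsBimodule L R) (h' : IsBimodule L' R') (g : N →ₗ[k] N')
    (hL : ∀ b n, g (L b n) = L' b (g n)) (hR : ∀ b n, g (R b n) = R' b (g n)) (r : ℕ)
    (x : X.relCochain S L R r) :
    X.relMap g (fun _ _ => hL _) (fun _ _ => hR _) (r + 1) (X.relCoboundary S h r x) =
      X.relCoboundary S h' r (X.relMap g (fun _ _ => hL _) (fun _ _ => hR _) r x) :=
  Subtype.ext (hochschildD_compMultilinearMap (L := L ∘ₗ X.inclA) (R := R ∘ₗ X.inclA)
    (L' := L' ∘ₗ X.inclA) (R' := R' ∘ₗ X.inclA) g (fun _ => hL _) (fun _ => hR _) r x.1).symm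

theorem relMap_relAction (h : IsBimodule L R) (h' : IsBimodule L' R')
    (hS : ∀ h, ∀ s ∈ S, X.act h s ∈ S) (g : N →ₗ[k] N')
    (hL : ∀ b n, g (L b n) = L' b (g n)) (hR : ∀ b n, g (R b n) = R' b (g n)) (r : ℕ) (y : H)
    (x : X.relCochain S L R r) :
    X.relMap g (fun _ _ => hL _) (fun _ _ => hR _) r (X.relAction h hS r y x) =
      X.relAction h' hS r y (X.relMap g (fun _ _ => hL _) (fun _ _ => hR _) r x) :=
  Subtype.ext (diagonalAct_compMultilinearMap (P := L ∘ₗ X.gammaInv) (G := R ∘ₗ X.gamma)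
    (P' := L' ∘ₗ X.gammaInv) (G' := R' ∘ₗ X.gamma) g (fun _ => hL _) (fun _ => hR _) x.1 y).symm

end Functoriality

/-! ### Cohomology in degree zero -/

section DegreeZero

variable {S} {L R : X.E →ₗ[k] Module.End k N}

/-- The value of a total cochain of degree `0`. -/
def evalTot (L R : X.E →ₗ[k] Module.End k N) :
    TotCochain k H (fun r => X.relCochain S L R r) 0 →ₗ[k] N :=
  evalAt (0 : Fin 0 → A) ∘ₗ (X.relCochain S L R 0).subtype ∘ₗ evalAt (0 : Fin 0 → H) ∘ₗ
    LinearMap.proj (⟨(0, 0), rfl⟩ : {p : ℕ × ℕ // p.1 + p.2 = 0})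

theorem evalTot_injective :
    Function.Injective (X.evalTot (S := S) L R) := by
  intro x y h
  funext p
  rcases p with ⟨⟨_ | r, _ | s⟩, hp⟩
  · exact evalAt_zero_injective (Subtype.ext (evalAt_zero_injective h))
  all_goals omega

theorem relAction_zero_apply (h : IsBimodule L R) (hS : ∀ h, ∀ s ∈ S, X.act h s ∈ S)
    (φ : X.relCochain S L R 0) (y : H) {ι : Type*} (r : Coalgebra.Repr k y ι) (a : Fin 0 → A) :
    (X.relAction h hS 0 y φ).1 a =
      ∑ i ∈ r.index, L (X.gammaInv (r.left i)) (R (X.gamma (r.right i)) (φ.1 a)) := by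
  change diagonalAct _ _ _ 0 y φ.1 a = _
  rw [diagonalAct_apply, sweedler_repr _ r]
  rfl

theorem gamma_gammaInv_cancel (h : IsBimodule L R) (hu : IsUnit (toConv X.gamma))
    (ζ : H →ₗ[k] N) {y : H} {ι : Type*} (r : Coalgebra.Repr k y ι) {κ : ι → Type*}
    (r₂ : ∀ i, Coalgebra.Repr k (r.right i) (κ i)) :
    ∑ i ∈ r.index, L (X.gamma (r.left i)) (∑ j ∈ (r₂ i).index,
      L (X.gammaInv ((r₂ i).left j)) (ζ ((r₂ i).right j))) = ζ y := by
  have := sum_coassoc (((LinearMap.mul k X.E).compl₁₂ X.gamma X.gammaInv).compr₂ (L.compl₂ ζ)) r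
    (fun i => Coalgebra.Repr.arbitrary k _) r₂
  simp only [LinearMap.compr₂_apply, LinearMap.compl₁₂_apply, LinearMap.mul_apply',
    LinearMap.compl₂_apply, h.left_mul] at this
  simp only [map_sum]
  rw [← this]
  simp only [← h.left_mul, ← LinearMap.sum_apply, ← map_sum, X.sum_mul_gammaInv hu]
  conv_rhs => rw [← Coalgebra.sum_counit_smul r, map_sum]
  rw [Finset.sum_congr rfl fun i _ => ?_]
  rw [Algebra.algebraMap_eq_smul_one, map_smul, LinearMap.smul_apply, h.left_one, map_smul]

theorem gammaInv_gamma_cancel (h : IsBimodule L R) (hu : IsUnit (toConv X.gamma))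
    (ζ : H →ₗ[k] N) {y : H} {ι : Type*} (r : Coalgebra.Repr k y ι) {κ : ι → Type*}
    (r₂ : ∀ i, Coalgebra.Repr k (r.right i) (κ i)) :
    ∑ i ∈ r.index, L (X.gammaInv (r.left i)) (∑ j ∈ (r₂ i).index,
      L (X.gamma ((r₂ i).left j)) (ζ ((r₂ i).right j))) = ζ y := by
  have := sum_coassoc (((LinearMap.mul k X.E).compl₁₂ X.gammaInv X.gamma).compr₂ (L.compl₂ ζ)) r
    (fun i => Coalgebra.Repr.arbitrary k _) r₂
  simp only [LinearMap.compr₂_apply, LinearMap.compl₁₂_apply, LinearMap.mul_apply',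
    LinearMap.compl₂_apply, h.left_mul] at this
  simp only [map_sum]
  rw [← this]
  simp only [← h.left_mul, ← LinearMap.sum_apply, ← map_sum, X.sum_gammaInv_mul hu]
  conv_rhs => rw [← Coalgebra.sum_counit_smul r, map_sum]
  rw [Finset.sum_congr rfl fun i _ => ?_]
  rw [Algebra.algebraMap_eq_smul_one, map_smul, LinearMap.smul_apply, h.left_one, map_smul]

theorem mem_center_iff (h : IsBimodule L R) (m : N) : m ∈ center L R ↔
    (∀ a, L (X.inclA a) m = R (X.inclA a) m) ∧ ∀ y, L (X.gamma y) m = R (X.gamma y) m := by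
  refine ⟨fun hm => ⟨fun a => hm _, fun y => hm _⟩, fun ⟨h1, h2⟩ b => ?_⟩
  induction b using TensorProduct.induction_on with
  | zero =>
    refine Eq.trans (congrArg (fun g : Module.End k N => g m) (map_zero L))
      (congrArg (fun g : Module.End k N => g m) (map_zero R)).symm
  | add b c hb hc =>
    have e1 := congrArg (fun g : Module.End k N => g m) (map_add L b c)
    have e2 := congrArg (fun g : Module.End k N => g m) (map_add R b c)
    exact e1.trans ((congrArg₂ (· + ·) hb hc).trans e2.symm)
  | tmul a y =>
    rw [← X.inclA_mul_gamma, h.left_mul, h.right_mul, h2, h.comm, h1]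

/-- For a 0-cocycle with value m, the component (1, 0) says that m commutes with A, and (0, 1) that
γ⁻¹(h⁽¹⁾)mγ(h⁽²⁾) = ε(h)m. The latter is equivalent to mγ(h) = γ(h)m by convolving with γ or γ⁻¹,
and A and γ(H) generate E. -/
theorem map_ker_totD_zero (h : IsBimodule L R) (hS : ∀ h, ∀ s ∈ S, X.act h s ∈ S)
    (hu : IsUnit (toConv X.gamma)) :
    (LinearMap.ker (totD (X.relCoboundary S h) (X.relAction h hS) 0)).map (X.evalTot L R) =
      center L R := by
  ext m
  rw [X.mem_center_iff h]
  constructor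
  · rintro ⟨x, hx, rfl⟩
    have e0 : ∀ c : Fin 0 → A, c = 0 := fun c => Subsingleton.elim _ _
    have e0' : ∀ c : Fin 0 → H, c = 0 := fun c => Subsingleton.elim _ _
    constructor
    · intro a
      have h1 := congrArg (fun g => (g 0).1 (fun _ => a)) (congrFun hx ⟨(1, 0), rfl⟩)
      rw [totD_succ_zero] at h1
      change hochschildD _ _ 0 (x ⟨(0, 0), _⟩ 0).1 _ = 0 at h1
      rw [hochschildD_apply, e0 (fun i => _)] at h1
      change L (X.inclA a) ((x ⟨(0, 0), rfl⟩ 0).1 0) = R (X.inclA a) ((x ⟨(0, 0), rfl⟩ 0).1 0)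
      simp only [Finset.univ_eq_empty, Finset.sum_empty, add_zero, zero_add, pow_one, neg_smul,
        one_smul, ← sub_eq_add_neg] at h1
      exact sub_eq_zero.mp h1
    · intro y
      have h1 : ∀ y, X.relAction h hS 0 y (x ⟨(0, 0), rfl⟩ 0) =
          Coalgebra.counit (R := k) y • x ⟨(0, 0), rfl⟩ 0 := fun y => by
        have h1 := congrArg (fun g => g (fun _ => y)) (congrFun hx ⟨(0, 1), rfl⟩)
        rw [totD_zero_succ] at h1
        change hochschildD _ _ 0 _ _ = 0 at h1
        rw [hochschildD_apply, e0' (fun i => _)] at h1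
        simp only [Finset.univ_eq_empty, Finset.sum_empty, add_zero, zero_add, pow_one, neg_smul,
          one_smul, ← sub_eq_add_neg, sub_eq_zero] at h1
        exact h1.symm
      set m := X.evalTot L R x with hm
      have r := Coalgebra.Repr.arbitrary k y
      have h2 : ∀ i, ∑ j ∈ (Coalgebra.Repr.arbitrary k (r.right i)).index,
          L (X.gammaInv ((Coalgebra.Repr.arbitrary k (r.right i)).left j))
            ((R.flip m ∘ₗ X.gamma) ((Coalgebra.Repr.arbitrary k (r.right i)).right j)) =
          Coalgebra.counit (R := k) (r.right i) • m := fun i => by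
        have h3 := congrArg (fun φ => φ.1 0) (h1 (r.right i))
        rw [X.relAction_zero_apply h hS _ _ (Coalgebra.Repr.arbitrary k (r.right i))] at h3
        exact h3
      -- Evaluate γ(y⁽¹⁾)γ⁻¹(y⁽²⁾)mγ(y⁽³⁾) in two ways: it is mγ(y), and by invariance it is γ(y)m.
      have h4 := X.gamma_gammaInv_cancel h hu (R.flip m ∘ₗ X.gamma) r
        (fun i => Coalgebra.Repr.arbitrary k _)
      simp only [h2, map_smul] at h4
      rw [LinearMap.comp_apply, LinearMap.flip_apply] at h4
      rw [← h4]
      nth_rewrite 1 [← sum_smul_counit r]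
      simp
  · rintro ⟨h1, h2⟩
    let φ : X.relCochain S L R 0 := ⟨MultilinearMap.constOfIsEmpty k _ m,
      ⟨fun i => i.elim0, fun i => i.elim0, fun i => i.elim0, fun i => i.elim0,
        fun _ s _ _ => h1 s⟩⟩
    let x : TotCochain k H (fun r => X.relCochain S L R r) 0 := fun p => match p with
      | ⟨(0, 0), _⟩ => MultilinearMap.constOfIsEmpty k _ φ
      | ⟨(0, _ + 1), _⟩ => 0
      | ⟨(_ + 1, _), _⟩ => 0
    refine ⟨x, ?_, rfl⟩
    funext p
    rcases p with ⟨⟨_ | r, _ | s⟩, hp⟩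
    · omega
    · obtain rfl : s = 0 := by simpa using hp
      rw [totD_zero_succ]
      ext b
      change (hochschildD _ _ 0 _ b : X.relCochain S L R 0).1 _ = 0
      rw [hochschildD_apply]
      have h3 : X.relAction h hS 0 (b 0) φ = Coalgebra.counit (R := k) (b 0) • φ := by
        refine Subtype.ext (MultilinearMap.ext fun a => ?_)
        have r := Coalgebra.Repr.arbitrary k (b 0)
        rw [X.relAction_zero_apply h hS _ _ r]
        change ∑ i ∈ r.index, L _ (R _ m) = Coalgebra.counit (R := k) (b 0) • m
        simp only [← h2, ← h.left_mul, ← LinearMap.sum_apply, ← map_sum, X.sum_gammaInv_mul hu]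
        rw [Algebra.algebraMap_eq_smul_one, map_smul, LinearMap.smul_apply, h.left_one]
      change (Coalgebra.counit (R := k) (b 0) • φ + _ +
        (-1 : k) ^ (0 + 1) • X.relAction h hS 0 (b 0) φ : X.relCochain S L R 0).1 _ = 0
      rw [h3]
      simp
    · obtain rfl : r = 0 := by simpa using hp
      rw [totD_succ_zero]
      ext b a
      change hochschildD _ _ 0 φ.1 a = 0
      rw [hochschildD_apply]
      change L _ m + _ + (-1 : k) ^ (0 + 1) • R _ m = 0
      rw [h1]
      simp
    · omega

end DegreeZero

end CrossedProduct

/-! ### Exactness of the double complex for coinduced coefficients -/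

theorem sweedler_act_assoc {k B C N : Type*} [CommRing k] [Ring B] [Algebra k B] [AddCommGroup C]
    [Module k C] [Coalgebra k C] [AddCommGroup N] [Module k N] {L : B →ₗ[k] Module.End k N}
    (hL : ∀ a b n, L (a * b) n = L a (L b n)) (u v : C →ₗ[k] B) (ζ : C →ₗ[k] N) :
    sweedler ((L ∘ₗ u).compl₂ (sweedler ((L ∘ₗ v).compl₂ ζ))) =
      sweedler ((L ∘ₗ sweedler ((LinearMap.mul k B).compl₁₂ u v)).compl₂ ζ) := by
  ext c
  have r := Coalgebra.Repr.arbitrary k c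
  have e := sum_coassoc (((LinearMap.mul k B).compl₁₂ u v).compr₂ (L.compl₂ ζ)) r
    (fun i => Coalgebra.Repr.arbitrary k _) (fun i => Coalgebra.Repr.arbitrary k _)
  simp only [LinearMap.compr₂_apply, LinearMap.compl₁₂_apply, LinearMap.mul_apply',
    LinearMap.compl₂_apply] at e
  rw [sweedler_repr _ r, sweedler_repr _ r]
  simp only [LinearMap.compl₂_apply, LinearMap.comp_apply,
    sweedler_repr _ (Coalgebra.Repr.arbitrary k _), LinearMap.compl₁₂_apply, LinearMap.mul_apply',
    map_sum, LinearMap.sum_apply]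
  rw [e]
  simp only [hL]

namespace CrossedProduct

variable {k A H : Type*} [CommRing k] [Ring A] [Algebra k A] [Ring H] [HopfAlgebra k H]
  (X : CrossedProduct k A H) {N : Type*} [AddCommGroup N] [Module k N]

theorem linearMap_E_ext {n n' : X.E →ₗ[k] N}
    (h : ∀ a y, n (X.inclA a * X.gamma y) = n' (X.inclA a * X.gamma y)) : n = n' := by
  refine TensorProduct.ext' fun a y => ?_
  have := h a y
  rw [X.inclA_mul_gamma] at this
  exact this

/-- The map `ξ ↦ (a # h ↦ ξ(a)(γ h))`. -/
def evalGamma : (A →ₗ[k] (X.E →ₗ[k] N)) →ₗ[k] (X.E →ₗ[k] N) where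
  toFun ξ := (TensorProduct.lift (LinearMap.lcomp k N X.gamma ∘ₗ ξ) : A ⊗[k] H →ₗ[k] N)
  map_add' _ _ := TensorProduct.ext' fun _ _ => rfl
  map_smul' _ _ := TensorProduct.ext' fun _ _ => rfl

theorem evalGamma_apply (ξ : A →ₗ[k] (X.E →ₗ[k] N)) (a : A) (y : H) :
    X.evalGamma ξ (X.inclA a * X.gamma y) = ξ a (X.gamma y) := by
  rw [X.inclA_mul_gamma]
  rfl

variable {L : X.E →ₗ[k] Module.End k N}

theorem evalGamma_homLeft (b : A) (ξ : A →ₗ[k] (X.E →ₗ[k] N)) :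
    X.evalGamma (homLeft (homLeft L ∘ₗ X.inclA) b ξ) =
      (homLeft (C := X.E) L ∘ₗ X.inclA) b (X.evalGamma ξ) := by
  refine X.linearMap_E_ext fun a y => ?_
  rw [evalGamma_apply]
  change _ = L (X.inclA b) (X.evalGamma ξ _)
  rw [evalGamma_apply]
  rfl

theorem evalGamma_homRight (b : A) (ξ : A →ₗ[k] (X.E →ₗ[k] N)) :
    X.evalGamma (homRight b ξ) = (homRight ∘ₗ X.inclA) b (X.evalGamma ξ) := by
  refine X.linearMap_E_ext fun a y => ?_
  rw [evalGamma_apply]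
  change _ = X.evalGamma ξ (X.inclA b * _)
  rw [← mul_assoc, ← X.inclA_mul, evalGamma_apply]
  rfl

/-- A map on E = A ⊗ H is determined by its values on aγ(y), so Hom(E, N) is coinduced as an
A-bimodule. `evalGamma` plays the role of `evalOne` for the rows. -/
theorem evalGamma_flip :
    X.evalGamma ∘ₗ (homRight (k := k) (B := X.E) (N := N) ∘ₗ X.inclA).flip = .id := by
  refine LinearMap.ext fun n => X.linearMap_E_ext fun a y => ?_
  exact X.evalGamma_apply _ a y

section RowExact

variable {R : X.E →ₗ[k] Module.End k N} (S : Subalgebra k A)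

/-- The contraction of the rows of the double complex with coinduced coefficients. -/
def rowContraction (L : X.E →ₗ[k] Module.End k N) (r : ℕ) :
    X.relCochain S (homLeft (C := X.E) L) homRight (r + 1) →ₗ[k]
      X.relCochain S (homLeft (C := X.E) L) homRight r :=
  ((-1 : k) ^ (r + 1) • contractLast X.evalGamma r).restrict fun φ hφ =>
    Submodule.smul_mem (X.relCochain S (homLeft (C := X.E) L) homRight r) _
      (IsRelCochain.contractLast (S := S) (L := homLeft (C := X.E) L ∘ₗ X.inclA)
        (R := homRight (k := k) (B := X.E) (N := N) ∘ₗ X.inclA) (φ := φ) X.evalGamma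
        X.evalGamma_homLeft X.evalGamma_homRight hφ)

theorem relCoboundary_rowContraction (h : IsBimodule L R) (r : ℕ)
    (x : X.relCochain S (homLeft (C := X.E) L) homRight (r + 1))
    (hx : X.relCoboundary S (coind_isBimodule h) (r + 1) x = 0) :
    X.relCoboundary S (coind_isBimodule h) r (X.rowContraction S L r x) = x := by
  have e := contractLast_hochschildD (L := homLeft (C := X.E) L ∘ₗ X.inclA)
    (R := homRight (k := k) (B := X.E) (N := N) ∘ₗ X.inclA) X.evalGamma X.evalGamma_homLeft
    X.evalGamma_homRight r x.1
  have hx' : hochschildD (homLeft (C := X.E) L ∘ₗ X.inclA)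
    (homRight (k := k) (B := X.E) (N := N) ∘ₗ X.inclA) (r + 1) x.1 = 0 := congrArg Subtype.val hx
  have e2 : (LinearMap.id : (X.E →ₗ[k] N) →ₗ[k] _).compMultilinearMap x.1 = x.1 := rfl
  rw [hx', map_zero, evalGamma_flip, e2] at e
  refine Subtype.ext ?_
  change hochschildD (homLeft (C := X.E) L ∘ₗ X.inclA)
    (homRight (k := k) (B := X.E) (N := N) ∘ₗ X.inclA) r
      ((-1 : k) ^ (r + 1) • contractLast X.evalGamma r x.1) = x.1
  rw [map_smul, eq_neg_of_add_eq_zero_left e.symm, smul_neg, smul_smul, ← pow_add, ← neg_smul]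
  have : -(-1 : k) ^ (r + 1 + r) = 1 := by
    rw [show r + 1 + r = 2 * r + 1 by ring, pow_succ, pow_mul]
    simp
  rw [this, one_smul]

end RowExact

section Column

/-- The `A`-linear extension of a map `w : H → N` to `E`. -/
def extendA (L : X.E →ₗ[k] Module.End k N) : (H →ₗ[k] N) →ₗ[k] (X.E →ₗ[k] N) where
  toFun w := (TensorProduct.lift ((L ∘ₗ X.inclA).compl₂ w) : A ⊗[k] H →ₗ[k] N)
  map_add' _ _ := TensorProduct.ext' fun a _ => map_add (L (X.inclA a)) _ _
  map_smul' _ _ := TensorProduct.ext' fun a _ => map_smul (L (X.inclA a)) _ _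

theorem extendA_apply (w : H →ₗ[k] N) (a : A) (y : H) :
    X.extendA L w (X.inclA a * X.gamma y) = L (X.inclA a) (w y) := by
  rw [X.inclA_mul_gamma]
  rfl

variable {R : X.E →ₗ[k] Module.End k N}

theorem extendA_gamma (h : IsBimodule L R) (w : H →ₗ[k] N) (y : H) :
    X.extendA L w (X.gamma y) = w y := by
  have := X.extendA_apply (L := L) w 1 y
  rwa [inclA_one, one_mul, h.left_one] at this

theorem extendA_inclA_mul (h : IsBimodule L R) (w : H →ₗ[k] N) (a : A) (y : X.E) :
    X.extendA L w (X.inclA a * y) = L (X.inclA a) (X.extendA L w y) := by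
  have : X.extendA L w ∘ₗ LinearMap.mulLeft k (X.inclA a) = L (X.inclA a) ∘ₗ X.extendA L w := by
    refine X.linearMap_E_ext fun b l => ?_
    simp only [LinearMap.comp_apply, LinearMap.mulLeft_apply]
    rw [← mul_assoc, ← X.inclA_mul, extendA_apply, extendA_apply, X.inclA_mul, h.left_mul]
  exact congrArg (fun g => g y) this

/-- E is extended from H as a left A-module, so left A-linear maps on E are determined by their
restriction along γ. -/
theorem eq_extendA {n : X.E →ₗ[k] N} (hn : ∀ a y, n (X.inclA a * y) = L (X.inclA a) (n y)) :
    n = X.extendA L (n ∘ₗ X.gamma) := by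
  refine X.linearMap_E_ext fun a y => ?_
  rw [hn, extendA_apply]
  rfl

/-- The map `y ↦ γ(y⁽¹⁾) ζ(y⁽²⁾)`. -/
def gammaTwist (L : X.E →ₗ[k] Module.End k N) : (H →ₗ[k] N) →ₗ[k] (H →ₗ[k] N) where
  toFun ζ := sweedler ((L ∘ₗ X.gamma).compl₂ ζ)
  map_add' _ _ := by rw [← map_add]; congr 1; ext; simp
  map_smul' _ _ := by rw [RingHom.id_apply, ← map_smul]; congr 1; ext; simp

theorem gammaTwist_apply (ζ : H →ₗ[k] N) {y : H} {ι : Type*} (r : Coalgebra.Repr k y ι) :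
    X.gammaTwist L ζ y = ∑ i ∈ r.index, L (X.gamma (r.left i)) (ζ (r.right i)) :=
  sweedler_repr _ r

/-- Expand γ(y)γ(l) as f * γ(yl). The left A-linear extension pulls f out, and f * γ(yl) recombines
to γ(y)γ(l), now as operators in front of ζ. -/
theorem extendA_gamma_mul_gamma (h : IsBimodule L R) (ζ : H →ₗ[k] N) {y l : H} {ι κ : Type*}
    (r : Coalgebra.Repr k y ι) (s : Coalgebra.Repr k l κ) :
    X.extendA L (X.gammaTwist L ζ) (X.gamma y * X.gamma l) =
      ∑ i ∈ r.index, L (X.gamma (r.left i)) (∑ j ∈ s.index, L (X.gamma (s.left j))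
        (ζ (r.right i * s.right j))) := by
  have e2 : sweedler ((L ∘ₗ X.gammaMul.ofConv).compl₂ (ζ ∘ₗ LinearMap.mul' k H)) =
      X.gammaTwist L ζ ∘ₗ LinearMap.mul' k H := by
    refine TensorProduct.ext' fun a b => ?_
    have ra := Coalgebra.Repr.arbitrary k a
    have rb := Coalgebra.Repr.arbitrary k b
    rw [sweedler_tmul _ ra rb]
    exact (sweedler_mul ((L ∘ₗ X.gamma).compl₂ ζ) ra rb).symm
  have key : sweedler ((L ∘ₗ X.cocycleE.ofConv).compl₂ (X.gammaTwist L ζ ∘ₗ LinearMap.mul' k H)) =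
      sweedler ((L ∘ₗ X.gammaGamma.ofConv).compl₂ (ζ ∘ₗ LinearMap.mul' k H)) := by
    rw [← e2, gammaGamma_eq, ofConv_mul]
    exact sweedler_act_assoc h.left_mul _ _ _
  have e3 := congrArg (fun g => g (y ⊗ₜ l)) key
  rw [sweedler_tmul _ r s, sweedler_tmul _ r s] at e3
  rw [X.gamma_mul_gamma r s]
  simp only [map_sum, X.extendA_apply]
  refine e3.trans ?_
  refine Finset.sum_congr rfl fun i _ => Finset.sum_congr rfl fun j _ => ?_
  exact h.left_mul (X.gamma (r.left i)) (X.gamma (s.left j)) (ζ (r.right i * s.right j))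

variable (S : Subalgebra k A)

/-- The contraction of the first column of the double complex with coinduced coefficients. -/
def columnContraction (h : IsBimodule L R) :
    (H →ₗ[k] X.relCochain S (homLeft (C := X.E) L) homRight 0) →ₗ[k]
      X.relCochain S (homLeft (C := X.E) L) homRight 0 where
  -- With ζ(y) = ξ(y)(1), the value is the left A-linear map sending γ(y) to γ(y⁽¹⁾)ζ(y⁽²⁾). In the
  -- coordinate ζ the action of H on column 0 cocycles is coinduced, and the contraction is
  -- evaluation at 1.
  toFun ξ := ⟨MultilinearMap.constOfIsEmpty k _ (X.extendA L (X.gammaTwist L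
      (LinearMap.applyₗ (1 : X.E) ∘ₗ evalAt (0 : Fin 0 → A) ∘ₗ Submodule.subtype _ ∘ₗ ξ))),
    ⟨fun i => i.elim0, fun i => i.elim0, fun i => i.elim0, fun i => i.elim0,
      fun _ s _ _ => LinearMap.ext fun y => (X.extendA_inclA_mul h _ s y).symm⟩⟩
  map_add' ξ ξ' := by
    refine Subtype.ext (MultilinearMap.ext fun _ => ?_)
    simp only [LinearMap.comp_add, map_add]
    rfl
  map_smul' c ξ := by
    refine Subtype.ext (MultilinearMap.ext fun _ => ?_)
    simp only [LinearMap.comp_smul, map_smul]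
    rfl

theorem columnContraction_apply (h : IsBimodule L R)
    (ξ : H →ₗ[k] X.relCochain S (homLeft (C := X.E) L) homRight 0) (a : Fin 0 → A) :
    (X.columnContraction S h ξ).1 a = X.extendA L (X.gammaTwist L (LinearMap.applyₗ (1 : X.E) ∘ₗ
      evalAt (0 : Fin 0 → A) ∘ₗ Submodule.subtype _ ∘ₗ ξ)) := rfl

variable {S}

theorem relCoboundary_zero_eq_zero_iff {L R : X.E →ₗ[k] Module.End k N} (h : IsBimodule L R)
    (φ : X.relCochain S L R 0) : X.relCoboundary S h 0 φ = 0 ↔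
      ∀ a, L (X.inclA a) (φ.1 0) = R (X.inclA a) (φ.1 0) := by
  have e : ∀ b : Fin 1 → A, (X.relCoboundary S h 0 φ).1 b =
      L (X.inclA (b 0)) (φ.1 0) - R (X.inclA (b 0)) (φ.1 0) := fun b => by
    change hochschildD _ _ 0 φ.1 b = _
    have e0 : ∀ c : Fin 0 → A, c = 0 := fun c => Subsingleton.elim _ _
    rw [hochschildD_apply, e0 (fun i => b i.succ), e0 (fun i => b i.castSucc)]
    simp only [Finset.univ_eq_empty, Finset.sum_empty, add_zero, zero_add, pow_one, neg_smul,
      one_smul, ← sub_eq_add_neg]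
    rfl
  constructor
  · intro hφ a
    have := e (fun _ => a)
    rw [hφ] at this
    exact (sub_eq_zero.mp this.symm)
  · intro hφ
    refine Subtype.ext (MultilinearMap.ext fun b => ?_)
    rw [e, hφ, sub_self]
    rfl

theorem relCochain_zero_ext {L R : X.E →ₗ[k] Module.End k N} {φ ψ : X.relCochain S L R 0}
    (h : φ.1 0 = ψ.1 0) : φ = ψ :=
  Subtype.ext (evalAt_zero_injective h)

theorem relCoboundary_columnContraction (h : IsBimodule L R)
    (ξ : H →ₗ[k] X.relCochain S (homLeft (C := X.E) L) homRight 0) :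
    X.relCoboundary S (coind_isBimodule h) 0 (X.columnContraction S h ξ) = 0 := by
  rw [relCoboundary_zero_eq_zero_iff]
  exact fun a => LinearMap.ext fun y => (X.extendA_inclA_mul h _ a y).symm

theorem cochain_zero_inclA_mul (h : IsBimodule L R)
    {φ : X.relCochain S (homLeft (C := X.E) L) homRight 0}
    (hφ : X.relCoboundary S (coind_isBimodule h) 0 φ = 0) (a : A) (y : X.E) :
    φ.1 0 (X.inclA a * y) = L (X.inclA a) (φ.1 0 y) := by
  rw [relCoboundary_zero_eq_zero_iff] at hφ
  exact (congrArg (fun g => g y) (hφ a)).symm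

theorem cochain_zero_ext (h : IsBimodule L R)
    {φ ψ : X.relCochain S (homLeft (C := X.E) L) homRight 0}
    (hφ : X.relCoboundary S (coind_isBimodule h) 0 φ = 0)
    (hψ : X.relCoboundary S (coind_isBimodule h) 0 ψ = 0)
    (e : ∀ y, φ.1 0 (X.gamma y) = ψ.1 0 (X.gamma y)) : φ = ψ := by
  refine X.relCochain_zero_ext ?_
  rw [X.eq_extendA (X.cochain_zero_inclA_mul h hφ), X.eq_extendA (X.cochain_zero_inclA_mul h hψ)]
  congr 1
  ext y
  exact e y

theorem coind_relAction_zero_apply (h : IsBimodule L R) (hS : ∀ h, ∀ s ∈ S, X.act h s ∈ S)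
    (φ : X.relCochain S (homLeft (C := X.E) L) homRight 0) (y : H) {ι : Type*}
    (r : Coalgebra.Repr k y ι) (z : X.E) :
    (X.relAction (coind_isBimodule h) hS 0 y φ).1 0 z =
      ∑ i ∈ r.index, L (X.gammaInv (r.left i)) (φ.1 0 (X.gamma (r.right i) * z)) := by
  rw [X.relAction_zero_apply _ hS φ y r, LinearMap.sum_apply]
  rfl

/-- The action of y produces γ⁻¹(y⁽¹⁾)γ(y⁽²⁾)γ(l⁽¹⁾)ζ(y⁽³⁾l⁽²⁾). The first two factors cancel,
leaving the cocycle with coordinate ζ(y ·). -/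
theorem columnContraction_homRight (h : IsBimodule L R) (hu : IsUnit (toConv X.gamma))
    (hf : ∀ h l : H, X.f (h ⊗ₜ l) ∈ S)
    (hS : ∀ h, ∀ s ∈ S, X.act h s ∈ S) (y : H)
    (ξ : H →ₗ[k] X.relCochain S (homLeft (C := X.E) L) homRight 0) :
    X.columnContraction S h (homRight (k := k)
      (N := X.relCochain S (homLeft (C := X.E) L) homRight 0) y ξ) =
      X.relAction (coind_isBimodule h) hS 0 y (X.columnContraction S h ξ) := by
  -- Both sides are left A-linear maps on E, so comparison on γ(H) suffices.
  refine X.cochain_zero_ext h (X.relCoboundary_columnContraction h _) ?_ fun l => ?_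
  · rw [(X.relComplex_isRightModuleComplex (coind_isBimodule h) hS hu hf).d_act,
      X.relCoboundary_columnContraction h, map_zero]
  · have r := Coalgebra.Repr.arbitrary k y
    have s := Coalgebra.Repr.arbitrary k l
    set ζ : H →ₗ[k] N := LinearMap.applyₗ (1 : X.E) ∘ₗ
      evalAt (0 : Fin 0 → A) ∘ₗ Submodule.subtype _ ∘ₗ ξ with hζ
    rw [X.coind_relAction_zero_apply h hS _ y r, columnContraction_apply, extendA_gamma X h,
      columnContraction_apply, ← hζ, X.gammaTwist_apply _ s]
    simp only [X.extendA_gamma_mul_gamma h ζ (Coalgebra.Repr.arbitrary k _) s]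
    have e := X.gammaInv_gamma_cancel h hu (∑ j ∈ s.index, L (X.gamma (s.left j)) ∘ₗ ζ ∘ₗ
      LinearMap.mulRight k (s.right j)) r (fun i => Coalgebra.Repr.arbitrary k _)
    simp only [LinearMap.sum_apply, LinearMap.comp_apply, LinearMap.mulRight_apply] at e
    exact e.symm

/-- For ξ(y) = φ·y the coordinate is ζ(y) = γ⁻¹(y⁽¹⁾)φ(γ(y⁽²⁾)), and convolving with γ gives back φ
on γ(H). -/
theorem columnContraction_flip (h : IsBimodule L R) (hu : IsUnit (toConv X.gamma))
    (hS : ∀ h, ∀ s ∈ S, X.act h s ∈ S)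
    (φ : X.relCochain S (homLeft (C := X.E) L) homRight 0)
    (hφ : X.relCoboundary S (coind_isBimodule h) 0 φ = 0) :
    X.columnContraction S h ((X.relAction (coind_isBimodule h) hS 0).flip φ) = φ := by
  refine X.cochain_zero_ext h (X.relCoboundary_columnContraction h _) hφ fun l => ?_
  have s := Coalgebra.Repr.arbitrary k l
  rw [columnContraction_apply, extendA_gamma X h, X.gammaTwist_apply _ s]
  refine Eq.trans ?_ (X.gamma_gammaInv_cancel h hu (φ.1 0 ∘ₗ X.gamma) s
    fun i => Coalgebra.Repr.arbitrary k _)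
  refine Finset.sum_congr rfl fun i _ => ?_
  congr 1
  change (X.relAction (coind_isBimodule h) hS 0 (s.right i) φ).1 0 1 = _
  rw [X.coind_relAction_zero_apply h hS _ _ (Coalgebra.Repr.arbitrary k _)]
  simp only [mul_one]
  rfl

theorem totD_coind_exact (h : IsBimodule L R) (hu : IsUnit (toConv X.gamma))
    (hf : ∀ h l : H, X.f (h ⊗ₜ l) ∈ S) (hS : ∀ h, ∀ s ∈ S, X.act h s ∈ S) (n : ℕ)
    (x : TotCochain k H (fun r => X.relCochain S (homLeft (C := X.E) L) homRight r) (n + 1))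
    (hx : totD (X.relCoboundary S (coind_isBimodule h)) (X.relAction (coind_isBimodule h) hS)
      (n + 1) x = 0) :
    ∃ y, totD (X.relCoboundary S (coind_isBimodule h)) (X.relAction (coind_isBimodule h) hS) n y =
      x :=
  totD_exact (X.relComplex_isRightModuleComplex (coind_isBimodule h) hS hu hf)
    (X.rowContraction S L) (X.relCoboundary_rowContraction S h) (X.columnContraction S h)
    (X.relCoboundary_columnContraction h) (X.columnContraction_homRight h hu hf hS)
    (X.columnContraction_flip h hu hS) n x hx

end Column

end CrossedProduct

/-! ### The exact sequence N → Hom(E, N) → Q and dimension shifting -/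

section DegreeOne

variable {k : Type*} [CommRing k] {C' C C'' : ℕ → Type*} [∀ n, AddCommGroup (C' n)]
  [∀ n, Module k (C' n)] [∀ n, AddCommGroup (C n)] [∀ n, Module k (C n)]
  [∀ n, AddCommGroup (C'' n)] [∀ n, Module k (C'' n)]
  {d' : ∀ n, C' n →ₗ[k] C' (n + 1)} {d : ∀ n, C n →ₗ[k] C (n + 1)}
  {d'' : ∀ n, C'' n →ₗ[k] C'' (n + 1)} {i : ∀ n, C' n →ₗ[k] C n} {p : ∀ n, C n →ₗ[k] C'' n}
  {r : ∀ n, C n →ₗ[k] C' n} {t : ∀ n, C'' n →ₗ[k] C n} {I Q : Type*} [AddCommGroup I] [Module k I]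
  [AddCommGroup Q] [Module k Q]

/-- The middle complex has cohomology in degree 0, so H¹ is a cokernel of 0-cocycles. Expressed
inside I and Q through the evaluations, it depends only on the modules of 0-cocycles and not on the
complexes. -/
theorem SplitExact.nonempty_one (h : SplitExact d' d d'' i p r t)
    (hd : ∀ n x, d (n + 1) (d n x) = 0) (hv : ∀ x : C 1, d 1 x = 0 → ∃ y, d 0 y = x)
    (ev : C 0 →ₗ[k] I) (ev'' : C'' 0 →ₗ[k] Q) (q : I →ₗ[k] Q) (hev : Function.Injective ev'')
    (hq : ∀ x, ev'' (p 0 x) = q (ev x)) {Z : Submodule k I} {Z'' : Submodule k Q}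
    (hZ : (LinearMap.ker (d 0)).map ev = Z) (hZ'' : (LinearMap.ker (d'' 0)).map ev'' = Z'') :
    Nonempty (Cohomology d' 1 ≃ₗ[k] Z'' ⧸ (Z.map q).submoduleOf Z'') := by
  obtain ⟨e⟩ := h.nonempty_shift hd 0 hv
  have hle : coboundaries d'' 0 ⊔ (LinearMap.ker (d 0)).map (p 0) ≤ LinearMap.ker (d'' 0) := by
    refine sup_le bot_le ?_
    rintro _ ⟨x, hx, rfl⟩
    rw [LinearMap.mem_ker, h.p_d, LinearMap.mem_ker.mp hx, map_zero]
  have hU : (coboundaries d'' 0 ⊔ (LinearMap.ker (d 0)).map (p 0)).map ev'' = Z.map q := by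
    have : coboundaries d'' 0 ⊔ (LinearMap.ker (d 0)).map (p 0) = (LinearMap.ker (d 0)).map (p 0) :=
      bot_sup_eq _
    rw [this, ← hZ, ← Submodule.map_comp, ← Submodule.map_comp]
    congr 1
    ext x
    exact hq x
  obtain ⟨e'⟩ := nonempty_quotient_equiv ev'' hev hle hZ'' hU
  exact ⟨e ≪≫ₗ e'⟩

theorem nonempty_cohomology_zero (ev : C 0 →ₗ[k] I) (hev : Function.Injective ev)
    {Z : Submodule k I} (hZ : (LinearMap.ker (d 0)).map ev = Z) :
    Nonempty (Cohomology d 0 ≃ₗ[k] Z ⧸ (⊥ : Submodule k I).submoduleOf Z) :=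
  nonempty_quotient_equiv ev hev bot_le hZ (Submodule.map_bot _)

end DegreeOne

section Coinduction

variable {k B N : Type*} [CommRing k] [Ring B] [Algebra k B] [AddCommGroup N] [Module k N]
  {L R : B →ₗ[k] Module.End k N}

/-- The left action on the cokernel of `N → Hom(B, N)`. -/
abbrev cokerLeft (h : IsBimodule L R) : B →ₗ[k] Module.End k ((B →ₗ[k] N) ⧸ coindRange R) :=
  quotAct (coindRange R) (homLeft L) (coindRange_left h)

/-- The right action on the cokernel of `N → Hom(B, N)`. -/
abbrev cokerRight (h : IsBimodule L R) : B →ₗ[k] Module.End k ((B →ₗ[k] N) ⧸ coindRange R) :=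
  quotAct (coindRange R) homRight (coindRange_right h)

theorem coker_isBimodule (h : IsBimodule L R) : IsBimodule (cokerLeft h) (cokerRight h) :=
  quot_isBimodule (coind_isBimodule h) _ _ _

theorem flip_left (h : IsBimodule L R) (b : B) (m : N) :
    R.flip (L b m) = homLeft L b (R.flip m) := by
  ext y
  exact (h.comm _ _ _).symm

theorem flip_right (h : IsBimodule L R) (b : B) (m : N) :
    R.flip (R b m) = homRight b (R.flip m) := by
  ext y
  exact (h.right_mul _ _ _).symm

theorem flip_add_cokerSection (ρ : (B →ₗ[k] N) →ₗ[k] N) (hρ : ∀ m, ρ (R.flip m) = m)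
    (n : B →ₗ[k] N) : R.flip (ρ n) + cokerSection ρ hρ ((coindRange R).mkQ n) = n := by
  rw [cokerSection_mkQ, add_sub_cancel]

theorem hochschild_splitExact (h : IsBimodule L R) (ρ : (B →ₗ[k] N) →ₗ[k] N)
    (hρ : ∀ m, ρ (R.flip m) = m) :
    SplitExact (hochschildD L R) (hochschildD (homLeft (C := B) L) homRight)
      (hochschildD (cokerLeft h) (cokerRight h)) (fun _ => R.flip.compMultilinearMapₗ k)
      (fun _ => (coindRange R).mkQ.compMultilinearMapₗ k) (fun _ => ρ.compMultilinearMapₗ k)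
      (fun _ => (cokerSection ρ hρ).compMultilinearMapₗ k) where
  i_d n x := hochschildD_compMultilinearMap R.flip (flip_left h) (flip_right h) n x
  p_d n x := hochschildD_compMultilinearMap (coindRange R).mkQ (fun _ _ => rfl) (fun _ _ => rfl) n x
  p_i _ _ := MultilinearMap.ext fun _ => mkQ_flip _
  r_i _ _ := MultilinearMap.ext fun _ => hρ _
  p_t _ _ := MultilinearMap.ext fun _ => mkQ_cokerSection ρ hρ _
  split _ _ := MultilinearMap.ext fun _ => flip_add_cokerSection ρ hρ _

end Coinduction

section TotMap

variable {k H : Type*} [CommRing k] [Ring H] [HopfAlgebra k H] {C' C C'' : ℕ → Type*}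
  [∀ n, AddCommGroup (C' n)] [∀ n, Module k (C' n)] [∀ n, AddCommGroup (C n)]
  [∀ n, Module k (C n)] [∀ n, AddCommGroup (C'' n)] [∀ n, Module k (C'' n)]
  {d' : ∀ n, C' n →ₗ[k] C' (n + 1)} {d : ∀ n, C n →ₗ[k] C (n + 1)}
  {d'' : ∀ n, C'' n →ₗ[k] C'' (n + 1)} {i : ∀ n, C' n →ₗ[k] C n} {p : ∀ n, C n →ₗ[k] C'' n}
  {r : ∀ n, C n →ₗ[k] C' n} {t : ∀ n, C'' n →ₗ[k] C n}
  {ρ' : ∀ r, H →ₗ[k] Module.End k (C' r)} {ρ : ∀ r, H →ₗ[k] Module.End k (C r)}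
  {ρ'' : ∀ r, H →ₗ[k] Module.End k (C'' r)}

/-- Only i and p are required to be H-linear; the splittings r and t enter bidegree by bidegree and
need no compatibility with the differentials or with H. -/
theorem SplitExact.tot (h : SplitExact d' d d'' i p r t)
    (hi : ∀ n y x, i n (ρ' n y x) = ρ n y (i n x))
    (hp : ∀ n y x, p n (ρ n y x) = ρ'' n y (p n x)) :
    SplitExact (totD d' ρ') (totD d ρ) (totD d'' ρ'') (totMap k H i) (totMap k H p) (totMap k H r)
      (totMap k H t) where
  i_d n x := totD_totMap i (fun n x => (h.i_d n x).symm) hi n x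
  p_d n x := totD_totMap p (fun n x => (h.p_d n x).symm) hp n x
  p_i _ _ := funext fun _ => MultilinearMap.ext fun _ => h.p_i _ _
  r_i _ _ := funext fun _ => MultilinearMap.ext fun _ => h.r_i _ _
  p_t _ _ := funext fun _ => MultilinearMap.ext fun _ => h.p_t _ _
  split _ _ := funext fun _ => MultilinearMap.ext fun _ => h.split _ _

end TotMap

/-! ### Comparison of the two cohomologies -/

namespace CrossedProduct

section Comparison

variable {k A H N : Type*} [CommRing k] [Ring A] [Algebra k A] [Ring H] [HopfAlgebra k H]
  (X : CrossedProduct k A H) [AddCommGroup N] [Module k N] {S : Subalgebra k A}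
  {L R : X.E →ₗ[k] Module.End k N}

/-- A k-linear map of coefficients need not preserve relative cochains; the retraction and the
section must be S-bimodule maps. This is what separability of S provides. -/
theorem rel_splitExact (h : IsBimodule L R) (ρ : (X.E →ₗ[k] N) →ₗ[k] N)
    (hρ : ∀ m, ρ (R.flip m) = m) (hL : ∀ b n, ρ (homLeft L b n) = L b (ρ n))
    (hR : ∀ s ∈ S, ∀ n, ρ (homRight (X.inclA s) n) = R (X.inclA s) (ρ n)) :
    SplitExact (X.relCoboundary S h) (X.relCoboundary S (coind_isBimodule h))
      (X.relCoboundary S (coker_isBimodule h))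
      (X.relMap R.flip (fun _ _ => flip_left h _) (fun _ _ => flip_right h _))
      (X.relMap (coindRange R).mkQ (fun _ _ _ => rfl) (fun _ _ _ => rfl))
      (X.relMap ρ (fun _ _ => hL _) hR)
      (X.relMap (cokerSection ρ hρ)
        (fun _ _ => cokerSection_comm ρ hρ (fun _ => rfl) (flip_left h _) (hL _))
        (fun _ hs => cokerSection_comm ρ hρ (fun _ => rfl) (flip_right h _) (hR _ hs))) where
  i_d n x := (X.relMap_relCoboundary h (coind_isBimodule h) R.flip (flip_left h) (flip_right h) n
    x).symm
  p_d n x := (X.relMap_relCoboundary (coind_isBimodule h) (coker_isBimodule h) (coindRange R).mkQ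
    (fun _ _ => rfl) (fun _ _ => rfl) n x).symm
  p_i _ _ := Subtype.ext <| MultilinearMap.ext fun _ => mkQ_flip _
  r_i _ _ := Subtype.ext <| MultilinearMap.ext fun _ => hρ _
  p_t _ _ := Subtype.ext <| MultilinearMap.ext fun _ => mkQ_cokerSection ρ hρ _
  split _ _ := Subtype.ext <| MultilinearMap.ext fun _ => flip_add_cokerSection ρ hρ _

theorem exists_retraction (hsep : IsSeparableAlgebra k S) (h : IsBimodule L R) :
    ∃ ρ : (X.E →ₗ[k] N) →ₗ[k] N, (∀ m, ρ (R.flip m) = m) ∧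
      (∀ b n, ρ (homLeft L b n) = L b (ρ n)) ∧
      ∀ s ∈ S, ∀ n, ρ (homRight (X.inclA s) n) = R (X.inclA s) (ρ n) := by
  obtain ⟨e, he, hes⟩ := hsep
  have hj : ∀ s t, (X.inclA ∘ₗ S.val.toLinearMap) (s * t) =
      (X.inclA ∘ₗ S.val.toLinearMap) s * (X.inclA ∘ₗ S.val.toLinearMap) t :=
    fun s t => X.inclA_mul _ _
  exact ⟨sepRetract (X.inclA ∘ₗ S.val.toLinearMap) R e, sepRetract_flip h hj rfl he,
    sepRetract_left h e, fun s hs => sepRetract_right h hj hes ⟨s, hs⟩⟩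

theorem nonempty_equiv_zero (h : IsBimodule L R) (hS : ∀ h, ∀ s ∈ S, X.act h s ∈ S)
    (hu : IsUnit (toConv X.gamma)) :
    Nonempty (Cohomology (hochschildD L R) 0 ≃ₗ[k]
      HopfCohomology (X.relCoboundary S h) (X.relAction h hS) 0) := by
  obtain ⟨e⟩ := nonempty_cohomology_zero (d := hochschildD L R) (evalAt (0 : Fin 0 → X.E))
    evalAt_zero_injective (map_ker_hochschildD_zero L R)
  obtain ⟨e'⟩ := nonempty_cohomology_zero (d := totD (X.relCoboundary S h) (X.relAction h hS))
    (X.evalTot L R) X.evalTot_injective (X.map_ker_totD_zero h hS hu)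
  exact ⟨e ≪≫ₗ e'.symm⟩

theorem tot_splitExact (h : IsBimodule L R) (hS : ∀ h, ∀ s ∈ S, X.act h s ∈ S)
    (ρ : (X.E →ₗ[k] N) →ₗ[k] N)
    (hρ : ∀ m, ρ (R.flip m) = m) (hL : ∀ b n, ρ (homLeft L b n) = L b (ρ n))
    (hR : ∀ s ∈ S, ∀ n, ρ (homRight (X.inclA s) n) = R (X.inclA s) (ρ n)) :
    SplitExact (totD (X.relCoboundary S h) (X.relAction h hS))
      (totD (X.relCoboundary S (coind_isBimodule h)) (X.relAction (coind_isBimodule h) hS))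
      (totD (X.relCoboundary S (coker_isBimodule h)) (X.relAction (coker_isBimodule h) hS))
      (totMap k H (X.relMap R.flip (fun _ _ => flip_left h _) (fun _ _ => flip_right h _)))
      (totMap k H (X.relMap (coindRange R).mkQ (fun _ _ _ => rfl) (fun _ _ _ => rfl)))
      (totMap k H (X.relMap ρ (fun _ _ => hL _) hR))
      (totMap k H (X.relMap (cokerSection ρ hρ)
        (fun _ _ => cokerSection_comm ρ hρ (fun _ => rfl) (flip_left h _) (hL _))
        (fun _ hs => cokerSection_comm ρ hρ (fun _ => rfl) (flip_right h _) (hR _ hs)))) :=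
  (X.rel_splitExact h ρ hρ hL hR).tot
    (fun n y x => X.relMap_relAction h (coind_isBimodule h) hS R.flip (flip_left h) (flip_right h)
      n y x)
    (fun n y x => X.relMap_relAction (coind_isBimodule h) (coker_isBimodule h) hS
      (coindRange R).mkQ (fun _ _ => rfl) (fun _ _ => rfl) n y x)

theorem nonempty_equiv_one (h : IsBimodule L R) (hS : ∀ h, ∀ s ∈ S, X.act h s ∈ S)
    (hu : IsUnit (toConv X.gamma)) (hsep : IsSeparableAlgebra k S)
    (hf : ∀ h l : H, X.f (h ⊗ₜ l) ∈ S) :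
    Nonempty (Cohomology (hochschildD L R) 1 ≃ₗ[k]
      HopfCohomology (X.relCoboundary S h) (X.relAction h hS) 1) := by
  obtain ⟨ρ, hρ, hL, hR⟩ := X.exists_retraction hsep h
  -- Both first cohomologies become the centre of the cokernel modulo the image of the centre of
  -- Hom(E, N).
  obtain ⟨e⟩ := (hochschild_splitExact h ρ hρ).nonempty_one
    (hochschildD_hochschildD (coind_isBimodule h).toIsActionPair)
    (hochschildD_coind_exact L 0) (evalAt (0 : Fin 0 → X.E)) (evalAt (0 : Fin 0 → X.E))
    (coindRange R).mkQ evalAt_zero_injective (fun _ => rfl)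
    (map_ker_hochschildD_zero _ _) (map_ker_hochschildD_zero _ _)
  obtain ⟨e'⟩ := (X.tot_splitExact h hS ρ hρ hL hR).nonempty_one
    (totD_totD (X.relComplex_isRightModuleComplex (coind_isBimodule h) hS hu hf))
    (X.totD_coind_exact h hu hf hS 0) (X.evalTot _ _) (X.evalTot _ _)
    (coindRange R).mkQ X.evalTot_injective (fun _ => rfl)
    (X.map_ker_totD_zero (coind_isBimodule h) hS hu)
    (X.map_ker_totD_zero (coker_isBimodule h) hS hu)
  exact ⟨e ≪≫ₗ e'.symm⟩

theorem nonempty_equiv_succ (h : IsBimodule L R) (hS : ∀ h, ∀ s ∈ S, X.act h s ∈ S)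
    (hu : IsUnit (toConv X.gamma)) (hsep : IsSeparableAlgebra k S)
    (hf : ∀ h l : H, X.f (h ⊗ₜ l) ∈ S) (n : ℕ)
    (ih : Nonempty (Cohomology (hochschildD (cokerLeft h) (cokerRight h)) (n + 1) ≃ₗ[k]
      HopfCohomology (X.relCoboundary S (coker_isBimodule h))
        (X.relAction (coker_isBimodule h) hS) (n + 1))) :
    Nonempty (Cohomology (hochschildD L R) (n + 2) ≃ₗ[k]
      HopfCohomology (X.relCoboundary S h) (X.relAction h hS) (n + 2)) := by
  obtain ⟨ρ, hρ, hL, hR⟩ := X.exists_retraction hsep h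
  obtain ⟨e⟩ := (hochschild_splitExact h ρ hρ).nonempty_shift_succ
    (hochschildD_hochschildD (coind_isBimodule h).toIsActionPair) n (hochschildD_coind_exact L)
  obtain ⟨e'⟩ := (X.tot_splitExact h hS ρ hρ hL hR).nonempty_shift_succ
    (totD_totD (X.relComplex_isRightModuleComplex (coind_isBimodule h) hS hu hf)) n
    (X.totD_coind_exact h hu hf hS)
  obtain ⟨i⟩ := ih
  exact ⟨e ≪≫ₗ i ≪≫ₗ e'.symm⟩

end Comparison

/-- The universe of N absorbs that of E, so the cokernel stays in it and the induction may replace N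
by the cokernel. For general N one shift leads into this situation. -/
theorem nonempty_equiv_of_universe.{u, v, w} {k : Type*} {A : Type u} {H : Type v} [CommRing k]
    [Ring A] [Algebra k A] [Ring H] [HopfAlgebra k H] (X : CrossedProduct k A H)
    {S : Subalgebra k A} (hS : ∀ h, ∀ s ∈ S, X.act h s ∈ S) (hu : IsUnit (toConv X.gamma))
    (hsep : IsSeparableAlgebra k S) (hf : ∀ h l : H, X.f (h ⊗ₜ l) ∈ S) (n : ℕ)
    {N : Type (max u v w)} [AddCommGroup N] [Module k N] {L R : X.E →ₗ[k] Module.End k N}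
    (h : IsBimodule L R) :
    Nonempty (Cohomology (hochschildD L R) (n + 1) ≃ₗ[k]
      HopfCohomology (X.relCoboundary S h) (X.relAction h hS) (n + 1)) := by
  induction n generalizing N with
  | zero => exact X.nonempty_equiv_one h hS hu hsep hf
  | succ n ih => exact X.nonempty_equiv_succ h hS hu hsep hf n (ih (coker_isBimodule h))

theorem nonempty_equiv {k A H N : Type*} [CommRing k] [Ring A] [Algebra k A] [Ring H]
    [HopfAlgebra k H] (X : CrossedProduct k A H) [AddCommGroup N] [Module k N]
    {S : Subalgebra k A} {L R : X.E →ₗ[k] Module.End k N} (h : IsBimodule L R)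
    (hS : ∀ h, ∀ s ∈ S, X.act h s ∈ S) (hu : IsUnit (toConv X.gamma))
    (hsep : IsSeparableAlgebra k S) (hf : ∀ h l : H, X.f (h ⊗ₜ l) ∈ S) (n : ℕ) :
    Nonempty (Cohomology (hochschildD L R) n ≃ₗ[k]
      HopfCohomology (X.relCoboundary S h) (X.relAction h hS) n) := by
  rcases n with _ | _ | n
  · exact X.nonempty_equiv_zero h hS hu
  · exact X.nonempty_equiv_one h hS hu hsep hf
  · exact X.nonempty_equiv_succ h hS hu hsep hf n
      (X.nonempty_equiv_of_universe hS hu hsep hf n (coker_isBimodule h))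

end CrossedProduct

theorem isBimodule_leftMul_rightMul {k B N : Type*} [CommRing k] [Ring B] [Algebra k B]
    [AddCommGroup N] [Module k N] [Module B N] [Module Bᵐᵒᵖ N] [IsScalarTower k B N]
    [IsScalarTower k Bᵐᵒᵖ N] [SMulCommClass B Bᵐᵒᵖ N] :
    IsBimodule (leftMul k B N) (rightMul k B N) where
  left_mul a b n := mul_smul a b n
  right_mul a b n := mul_smul (MulOpposite.op b) (MulOpposite.op a) n
  comm a b n := smul_comm a (MulOpposite.op b) n
  left_one n := one_smul B n
  right_one n := one_smul Bᵐᵒᵖ n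

end

end HopfCrossed

theorem theorem3p2p5p1 {k A H M : Type*} [CommRing k] [Ring A] [Algebra k A] [Ring H]
    [HopfAlgebra k H] (X : HopfCrossed.CrossedProduct k A H)
    [AddCommGroup M] [Module k M] [Module X.E M] [Module X.Eᵐᵒᵖ M]
    [IsScalarTower k X.E M] [IsScalarTower k X.Eᵐᵒᵖ M] [SMulCommClass X.E X.Eᵐᵒᵖ M]
    -- the cocycle is convolution invertible
    (hinv : IsUnit (WithConv.toConv X.f))
    -- `S` is a separable subalgebra of `A`, stable under the weak action
    (S : Subalgebra k A) (hsep : HopfCrossed.IsSeparableAlgebra k S)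
    (hS : ∀ h : H, ∀ s ∈ S, X.act h s ∈ S)
    -- the cocycle takes its values in `S`
    (hf : ∀ h l : H, X.f (h ⊗ₜ l) ∈ S) :
    IsUnit (WithConv.toConv X.gamma) ∧
    HopfCrossed.IsRightModuleComplex (X.relD M S) (X.relAct M S hS) ∧
    ∀ n : ℕ, Nonempty (HopfCrossed.HochschildCohomology k X.E M n ≃ₗ[k]
      HopfCrossed.HopfCohomology (X.relD M S) (X.relAct M S hS) n) := by
  have hu := X.isUnit_gamma hinv
  -- `relD` and `relAct` unfold to `relCoboundary` and `relAction` for the given actions on M.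
  exact ⟨hu, X.relComplex_isRightModuleComplex HopfCrossed.isBimodule_leftMul_rightMul hS hu hf,
    X.nonempty_equiv HopfCrossed.isBimodule_leftMul_rightMul hS hu hsep hf⟩
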